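/- Let $(X_t)_{t\in\mathbb Z}$ be a strictly stationary real-valued process with $\mathbb E X_0=0$ and $\mathbb E|X_0|^{2+\zeta}<\infty$ for some $\zeta>0$. For $f:\mathbb R^u\to\mathbb R$ put $\operatorname{Lip} f=\sup_{x\neq y}|f(x)-f(y)|/\sum_{i=1}^u|x_i-y_i|$. Given $\psi:\mathbb N^2\times[0,\infty)^2\to[0,\infty)$, the process is called $(\epsilon,\psi)$-weakly dependent if $(\epsilon(r))_{r\ge 0}$ is a nonincreasing sequence with limit $0$ such that $$\left|\operatorname{Cov}\left(f(X_{s_1},\dots,X_{s_u}),g(X_{t_1},\dots,X_{t_v})\right)\right|\le\psi(u,v,\operatorname{Lip}f,\operatorname{Lip}g)\,\epsilon(r)$$ for all integers $r\ge0$, $u,v\ge1$, all $s_1\le\dots\le s_u\le s_u+r\le t_1\le\dots\le t_v$ in $\mathbb Z$ and all $f:\mathbb R^u\to\mathbb R$, $g:\mathbb R^v\to\mathbb R$ with $\|f\|_\infty\le1$, $\|g\|_\infty\le1$ and $\operatorname{Lip}f+\operatorname{Lip}g<\infty$. Assume that one of the following holds. ($\kappa$ case) The process is weakly dependent with $\psi(u,v,a,b)=uvab$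 and a sequence $\epsilon(r)=O(r^{-\kappa})$, where $\kappa>2+\frac1\zeta$. Put $$A=\frac{\sqrt{(2\kappa-3-\zeta)^2+4(\kappa\zeta-2\zeta-1)}+\zeta+3-2\kappa}{2}\wedge1,\qquad c^*=\frac{(\kappa-1)A}{A+2\kappa(1+A)},\qquad c'=\frac{c^*}{3+A}.$$ ($\lambda$ case) The process is weakly dependent with $\psi(u,v,a,b)=uvab+ua+vb$ and a sequence $\epsilon(r)=O(r^{-\lambda})$, where $\lambda>4+\frac2\zeta$. Put $$B=\frac{\sqrt{(2\lambda-6-\zeta)^2+4(\lambda\zeta-4\zeta-2)}+\zeta+6-2\lambda}{2}\wedge1,\qquad c^*=\frac{(\lambda+1)B}{2+B+2\lambda(1+B)},\qquad c'=\frac{c^*}{3+B}.$$ Then the series $\sigma^2=\sum_{k\in\mathbb Z}\operatorname{Cov}(X_0,X_k)$ converges absolutely and, if $\sigma^2>0$, then for every $c<c'$ $$\sup_{x\in\mathbb R}\left|\mathbb P\left(\frac{X_1+\dots+X_n}{\sqrt n}\le x\right)-\mathbb P(\sigma N\le x)\right|=o(n^{-c})\qquad(n\to\infty),$$ where $N$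 is a standard normal random variable. -/

import Mathlib

open MeasureTheory ProbabilityTheory Filter Asymptotics
open scoped Topology

namespace WeakDep

noncomputable section

/-- The set of difference quotients of `f` on `ℝ^u`, where `ℝ^u` carries the `ℓ¹` distance. -/
def lipQuotients {u : ℕ} (f : (Fin u → ℝ) → ℝ) : Set ℝ :=
  {q | ∃ x y : Fin u → ℝ, x ≠ y ∧ q = |f x - f y| / ∑ i, |x i - y i|}

/-- The Lipschitz modulus `Lip f`; meaningful when `BddAbove (lipQuotients f)`, which expresses
`Lip f < ∞`. -/
def lip {u : ℕ} (f : (Fin u → ℝ) → ℝ) : ℝ := sSup (lipQuotients f)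

/-- `(ε, ψ)`-weak dependence of the process `X`. The tuples `s`, `t` are nondecreasing and the last
entry of `s` precedes the first entry of `t` by at least `r`. -/
structure IsWeaklyDependent {Ω : Type*} [MeasurableSpace Ω] (P : Measure Ω) (X : ℤ → Ω → ℝ)
    (ψ : ℕ → ℕ → ℝ → ℝ → ℝ) (ε : ℕ → ℝ) : Prop where
  antitone : Antitone ε
  tendsto_zero : Tendsto ε atTop (𝓝 0)
  cov_le : ∀ (r u v : ℕ), 1 ≤ u → 1 ≤ v → ∀ (s : Fin u → ℤ) (t : Fin v → ℤ),
    Monotone s → Monotone t → (∀ i j, s i + (r : ℤ) ≤ t j) →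
    ∀ (f : (Fin u → ℝ) → ℝ) (g : (Fin v → ℝ) → ℝ),
      (∀ x, |f x| ≤ 1) → (∀ y, |g y| ≤ 1) →
      BddAbove (lipQuotients f) → BddAbove (lipQuotients g) →
      |cov[fun ω => f (fun i => X (s i) ω), fun ω => g (fun j => X (t j) ω); P]|
        ≤ ψ u v (lip f) (lip g) * ε r

/-- The function `ψ` of `κ`-weak dependence. -/
def psiKappa (u v : ℕ) (a b : ℝ) : ℝ := u * v * a * b

/-- The function `ψ` of `λ`-weak dependence. -/
def psiLambda (u v : ℕ) (a b : ℝ) : ℝ := u * v * a * b + u * a + v * b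

/-- Strict stationarity: the law of the whole path is invariant under time shifts. -/
def IsStationary {Ω : Type*} [MeasurableSpace Ω] (P : Measure Ω) (X : ℤ → Ω → ℝ) : Prop :=
  ∀ h : ℤ, IdentDistrib (fun ω (t : ℤ) => X (t + h) ω) (fun ω (t : ℤ) => X t ω) P P

/-- `σ² = ∑_{k ∈ ℤ} Cov(X_0, X_k)`. -/
def sigmaSq {Ω : Type*} [MeasurableSpace Ω] (P : Measure Ω) (X : ℤ → Ω → ℝ) : ℝ :=
  ∑' k : ℤ, cov[X 0, X k; P]

/-- `S_n = X_1 + ⋯ + X_n`. -/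
def partialSum {Ω : Type*} (X : ℤ → Ω → ℝ) (n : ℕ) (ω : Ω) : ℝ :=
  ∑ i ∈ Finset.Icc 1 n, X (i : ℤ) ω

/-- The distribution function `F_n(x) = P(S_n / √n ≤ x)`. -/
def cdfSum {Ω : Type*} [MeasurableSpace Ω] (P : Measure Ω) (X : ℤ → Ω → ℝ) (n : ℕ) (x : ℝ) : ℝ :=
  P.real {ω | partialSum X n ω / √(n : ℝ) ≤ x}

/-- The distribution function `x ↦ P(σ N ≤ x)` of the centred normal law with variance
`s = σ²` (for `s ≥ 0`). -/
def cdfNormal (s : ℝ) (x : ℝ) : ℝ := (gaussianReal 0 s.toNNReal).real (Set.Iic x)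

/-- `sup_x |F_n(x) - P(σ N ≤ x)|`. -/
def kolmogorovDist {Ω : Type*} [MeasurableSpace Ω] (P : Measure Ω) (X : ℤ → Ω → ℝ) (n : ℕ) : ℝ :=
  ⨆ x : ℝ, |cdfSum P X n x - cdfNormal (sigmaSq P X) x|

/-- The constant `A`. -/
def constA (ζ κ : ℝ) : ℝ :=
  min ((√((2 * κ - 3 - ζ) ^ 2 + 4 * (κ * ζ - 2 * ζ - 1)) + ζ + 3 - 2 * κ) / 2) 1

/-- The constant `B`. -/
def constB (ζ lam : ℝ) : ℝ :=
  min ((√((2 * lam - 6 - ζ) ^ 2 + 4 * (lam * ζ - 4 * ζ - 2)) + ζ + 6 - 2 * lam) / 2) 1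

/-- The exponent `c*` under `κ`-weak dependence. -/
def cStarKappa (ζ κ : ℝ) : ℝ :=
  (κ - 1) * constA ζ κ / (constA ζ κ + 2 * κ * (1 + constA ζ κ))

/-- The exponent `c*` under `λ`-weak dependence. -/
def cStarLambda (ζ lam : ℝ) : ℝ :=
  (lam + 1) * constB ζ lam / (2 + constB ζ lam + 2 * lam * (1 + constB ζ lam))

end

end WeakDep

/-!
The proof combines Bernstein's blocks, truncation, and a smoothing inequality for characteristic
functions.

The indices `1, …, n` are cut into `k` blocks of length `p`, separated by gaps of length `q`, and the
variables in the blocks are truncated at a level `T` and centred (`centredClip`, `blockSum`). Since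
sine and cosine are bounded Lipschitz functions, weak dependence shows that the characteristic
function of the sum over the blocks differs little from the `k`-th power of the characteristic
function `φ` of one block (`PolyWeakDep.norm_integral_exp_blocks_sub_le`). A Taylor expansion of
`φ`, whose remainder is controlled by the second and fourth moment of a block, compares that power
with a Gaussian characteristic function (`norm_pow_sub_exp_le`), and a smoothing inequality with a
Gaussian kernel of width `b` turns this into a bound on distribution functions
(`abs_measureReal_Iic_sub_gaussianReal_le`). What was discarded, namely the gaps, the end piece and
the truncation remainders, has a small second moment and is removed by Chebyshev's inequality
(`abs_measureReal_add_le_sub_le`). The result for fixed `n` is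
`StationaryMoment.abs_cdfSum_sub_cdfNormal_le`.

The moments come from the covariances. Truncating at a level that depends on the lag gives
`|Cov (ψ (X i), ψ (X j))| ≤ C (1 + |j - i|) ^ (-θ')` with `θ' > 2`, uniformly over the contractions
`ψ` that fix `0` (`StationaryMoment.exists_abs_cov_le`). With `ψ` the identity this yields the
absolute convergence of the series for `σ²`, and `Var (X 1 + ⋯ + X p) = p σ² + O(1)`. With `ψ` the
truncation remainder, and after interpolation with the direct bound in terms of `T`, it yields the
variance of the discarded part. Fourth moments follow from the classical argument that splits a
product of four variables at its widest gap (`PolyWeakDep.abs_integral_four_le`).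

Finally `p`, `q`, `T` and `b` are taken as powers of `n`. The quadratic inequalities satisfied by the
constants `A` and `B` (`constA_spec`, `constB_spec`) are what makes the exponents compatible with
every rate `n ^ (-c)` with `c < c'`; a factor `n ^ η` is lost, and absorbed by a slightly larger `c`
(`isLittleO_of_powBound`).
-/

/-! ### Smoothing inequality -/

namespace WeakDep

open Complex in
/-- Fourier inversion for the Gaussian density: it is, up to a factor, the characteristic function
of the Gaussian law with the inverse variance. -/
lemma gaussianPDFReal_eq_integral (w y : ℝ) {v : NNReal} (hv : v ≠ 0) :
    ((gaussianPDFReal w v y : ℝ) : ℂ) =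
      ((√(2 * Real.pi * v))⁻¹ : ℝ) *
        ∫ t, cexp (t * w * I) * cexp (-(t * y * I)) ∂(gaussianReal 0 v⁻¹) := by
  have h1 : ∫ t, cexp (t * w * I) * cexp (-(t * y * I)) ∂(gaussianReal 0 v⁻¹)
      = charFun (gaussianReal 0 v⁻¹) (w - y) := by
    rw [charFun_apply_real]
    congr 1; ext t
    rw [← Complex.exp_add]; congr 1; push_cast; ring
  rw [h1, charFun_gaussianReal, gaussianPDFReal]
  push_cast
  congr 1
  have : (v : ℂ) ≠ 0 := by exact_mod_cast hv
  congr 1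
  field_simp
  ring

open Complex in
/-- A bound that does not depend on the length of the interval, so that the left end point can be
sent to `-∞` in the smoothing inequality. -/
lemma norm_setIntegral_exp_le {a b t : ℝ} (hab : a ≤ b) (ht : t ≠ 0) :
    ‖∫ y in Set.Ioc a b, cexp (-(t * y * I))‖ ≤ 2 / |t| := by
  rw [← intervalIntegral.integral_of_le hab]
  have h0 : (-(t * I) : ℂ) ≠ 0 := by simp [ht]
  have : ∀ y : ℝ, cexp (-(t * y * I)) = cexp ((-(t * I)) * y) := by
    intro y; congr 1; ring
  simp_rw [this]
  rw [integral_exp_mul_complex h0, norm_div]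
  have hn : ‖(-(t * I) : ℂ)‖ = |t| := by simp
  rw [hn]
  gcongr
  refine (norm_sub_le _ _).trans ?_
  have e : ∀ y : ℝ, ‖cexp (-(t * I) * y)‖ = 1 := by
    intro y
    have := Complex.norm_exp_ofReal_mul_I (-(t * y))
    rw [← this]; congr 2; push_cast; ring
  rw [e, e]; norm_num

open Complex in
/-- The mass that the Gaussian mollification of `μ` gives to an interval, in terms of the
characteristic function of `μ`. The Gaussian density is itself written as a characteristic
function, of the Gaussian law with the inverse variance. -/
lemma integral_gaussianReal_Ioc_eq (μ : Measure ℝ) [IsProbabilityMeasure μ] {v : NNReal}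
    (hv : v ≠ 0) (a b : ℝ) :
    ((∫ w, (gaussianReal w v).real (Set.Ioc a b) ∂μ : ℝ) : ℂ) =
      ((√(2 * Real.pi * v))⁻¹ : ℝ) *
        ∫ t, (∫ y in Set.Ioc a b, cexp (-(t * y * I))) * charFun μ t ∂(gaussianReal 0 v⁻¹) := by
  have h1 : ∀ w, (((gaussianReal w v).real (Set.Ioc a b) : ℝ) : ℂ) =
      ((√(2 * Real.pi * v))⁻¹ : ℝ) *
        ∫ t, (∫ y in Set.Ioc a b, cexp (-(t * y * I))) * cexp (t * w * I)
          ∂(gaussianReal 0 v⁻¹) := by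
    intro w
    rw [Measure.real, gaussianReal_apply_eq_integral _ hv, ENNReal.toReal_ofReal
      (setIntegral_nonneg measurableSet_Ioc fun x _ => gaussianPDFReal_nonneg _ _ _),
      ← integral_complex_ofReal]
    simp_rw [gaussianPDFReal_eq_integral w _ hv]
    rw [integral_const_mul]
    congr 1
    rw [integral_integral_swap]
    · congr 1; ext t
      rw [integral_const_mul, mul_comm]
    · refine Integrable.of_bound (C := 1) (by fun_prop) (ae_of_all _ ?_)
      rintro ⟨y, t⟩
      simp [Complex.norm_exp]
  rw [← integral_complex_ofReal]
  simp_rw [h1]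
  rw [integral_const_mul]
  congr 1
  rw [integral_integral_swap]
  · congr 1; ext t
    rw [integral_const_mul, charFun_apply_real]
  · have hm : StronglyMeasurable fun t : ℝ => ∫ y in Set.Ioc a b, cexp (-(t * y * I)) := by
      refine StronglyMeasurable.integral_prod_right
        (f := fun t : ℝ => fun y : ℝ => cexp (-(t * y * I))) ?_
      exact (by fun_prop : Continuous (fun p : ℝ × ℝ => cexp (-(p.1 * p.2 * I)))).stronglyMeasurable
    refine Integrable.of_bound (C := (volume.restrict (Set.Ioc a b)).real Set.univ) ?_
      (ae_of_all _ ?_)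
    · refine AEStronglyMeasurable.mul ?_ (by fun_prop)
      exact (hm.comp_measurable measurable_snd).aestronglyMeasurable
    · rintro ⟨w, t⟩
      simp only [Function.uncurry]
      rw [norm_mul]
      have e2 : ‖cexp (t * w * I)‖ = 1 := by simp [Complex.norm_exp]
      rw [e2, mul_one]
      refine (norm_integral_le_of_norm_le_const (C := 1) (ae_of_all _ fun y => ?_)).trans ?_
      · simp [Complex.norm_exp]
      · simp

lemma measurable_gaussianReal_real (v : NNReal) {s : Set ℝ} (hs : MeasurableSet s) :
    Measurable fun w => (gaussianReal w v).real s := by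
  have h : Measurable fun w => gaussianReal w v :=
    measurable_gaussianReal.comp (measurable_id.prodMk measurable_const)
  exact (Measure.measurable_coe hs |>.comp h).ennreal_toReal

lemma integrable_gaussianReal_real (μ : Measure ℝ) [IsProbabilityMeasure μ] (v : NNReal)
    {s : Set ℝ} (hs : MeasurableSet s) :
    Integrable (fun w => (gaussianReal w v).real s) μ := by
  refine Integrable.of_bound (C := 1)
    (measurable_gaussianReal_real v hs).aestronglyMeasurable (ae_of_all _ fun w => ?_)
  rw [Real.norm_of_nonneg measureReal_nonneg]
  exact measureReal_le_one

lemma tendsto_integral_gaussianReal_Iic (μ : Measure ℝ) [IsProbabilityMeasure μ] (v : NNReal) :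
    Tendsto (fun a => ∫ w, (gaussianReal w v).real (Set.Iic a) ∂μ) atBot (𝓝 0) := by
  have h := tendsto_integral_filter_of_dominated_convergence (μ := μ) (l := atBot)
    (F := fun a w => (gaussianReal w v).real (Set.Iic a)) (f := fun _ => (0 : ℝ))
    (fun _ => (1 : ℝ)) ?_ ?_ (integrable_const _) ?_
  · simpa using h
  · exact Eventually.of_forall fun a =>
      (measurable_gaussianReal_real v measurableSet_Iic).aestronglyMeasurable
  · refine Eventually.of_forall fun a => ae_of_all _ fun w => ?_
    rw [Real.norm_of_nonneg measureReal_nonneg]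
    exact measureReal_le_one
  · refine ae_of_all _ fun w => ?_
    exact (tendsto_cdf_atBot (gaussianReal w v)).congr fun a => cdf_eq_real _ _

open Complex in
/-- Smoothing inequality, first half: the mollified distribution functions are compared through
the characteristic functions. -/
lemma abs_integral_gaussianReal_Iic_sub_le (μ ν : Measure ℝ) [IsProbabilityMeasure μ]
    [IsProbabilityMeasure ν] {v : NNReal} (hv : v ≠ 0) {G : ℝ → ℝ} (hG : Integrable G)
    (hb : ∀ t, ‖charFun μ t - charFun ν t‖ * Real.exp (-(v * t ^ 2 / 2)) ≤ |t| * G t) (x : ℝ) :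
    |∫ w, (gaussianReal w v).real (Set.Iic x) ∂μ - ∫ w, (gaussianReal w v).real (Set.Iic x) ∂ν|
      ≤ (∫ t, G t) / Real.pi := by
  have hvpos : (0 : ℝ) < v := lt_of_le_of_ne v.2 (by exact_mod_cast hv.symm)
  have hv' : v⁻¹ ≠ 0 := inv_ne_zero hv
  have hsplit : ∀ (η : Measure ℝ) [IsProbabilityMeasure η] (a : ℝ), a ≤ x →
      ∫ w, (gaussianReal w v).real (Set.Iic x) ∂η
        = ∫ w, (gaussianReal w v).real (Set.Iic a) ∂η
          + ∫ w, (gaussianReal w v).real (Set.Ioc a x) ∂η := by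
    intro η _ a ha
    rw [← integral_add (integrable_gaussianReal_real _ _ measurableSet_Iic)
      (integrable_gaussianReal_real _ _ measurableSet_Ioc)]
    congr 1; ext w
    rw [← measureReal_union _ measurableSet_Ioc, Set.Iic_union_Ioc_eq_Iic ha]
    rw [Set.disjoint_left]; intro y hy hy'; exact absurd hy'.1 (not_lt.2 hy)
  have key : ∀ a ≤ x, |∫ w, (gaussianReal w v).real (Set.Ioc a x) ∂μ
      - ∫ w, (gaussianReal w v).real (Set.Ioc a x) ∂ν| ≤ (∫ t, G t) / Real.pi := by
    intro a ha
    have hm : StronglyMeasurable fun t : ℝ => ∫ y in Set.Ioc a x, cexp (-(t * y * I)) := by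
      refine StronglyMeasurable.integral_prod_right
        (f := fun t : ℝ => fun y : ℝ => cexp (-(t * y * I))) ?_
      exact (by fun_prop : Continuous (fun p : ℝ × ℝ => cexp (-(p.1 * p.2 * I)))).stronglyMeasurable
    have hint : ∀ (η : Measure ℝ) [IsProbabilityMeasure η], Integrable (fun t : ℝ =>
        (∫ y in Set.Ioc a x, cexp (-(t * y * I))) * charFun η t) (gaussianReal 0 v⁻¹) := by
      intro η _
      refine Integrable.of_bound (C := (volume.restrict (Set.Ioc a x)).real Set.univ) ?_
        (ae_of_all _ ?_)
      · exact hm.aestronglyMeasurable.mul stronglyMeasurable_charFun.aestronglyMeasurable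
      · intro t
        rw [norm_mul]
        refine (mul_le_mul (norm_integral_le_of_norm_le_const (C := 1)
          (ae_of_all _ fun y => ?_)) (norm_charFun_le_one t) (norm_nonneg _) (by positivity)).trans ?_
        · simp [Complex.norm_exp]
        · simp
    have e1 := integral_gaussianReal_Ioc_eq μ hv a x
    have e2 := integral_gaussianReal_Ioc_eq ν hv a x
    rw [← Real.norm_eq_abs, ← Complex.norm_real, Complex.ofReal_sub, e1, e2, ← mul_sub,
      ← integral_sub (hint μ) (hint ν), norm_mul, Complex.norm_real,
      Real.norm_of_nonneg (by positivity : (0 : ℝ) ≤ (√(2 * Real.pi * v))⁻¹)]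
    rw [integral_gaussianReal_eq_integral_smul hv']
    have hpt : ∀ᵐ t : ℝ, ‖gaussianPDFReal 0 v⁻¹ t •
        ((∫ y in Set.Ioc a x, cexp (-(t * y * I))) * charFun μ t -
          (∫ y in Set.Ioc a x, cexp (-(t * y * I))) * charFun ν t)‖ ≤
        (√(2 * Real.pi * (v : ℝ)⁻¹))⁻¹ * 2 * G t := by
      filter_upwards [Measure.ae_ne volume (0 : ℝ)] with t ht
      have htp : 0 < |t| := abs_pos.2 ht
      rw [← mul_sub, norm_smul, norm_mul, Real.norm_of_nonneg (gaussianPDFReal_nonneg _ _ _),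
        gaussianPDFReal]
      have he : -(t - 0) ^ 2 / (2 * ((v⁻¹ : NNReal) : ℝ)) = -(v * t ^ 2 / 2) := by
        push_cast; field_simp; ring
      have hc : (0 : ℝ) ≤ (√(2 * Real.pi * (v : ℝ)⁻¹))⁻¹ := by positivity
      rw [he, NNReal.coe_inv]
      generalize (√(2 * Real.pi * (v : ℝ)⁻¹))⁻¹ = C at hc ⊢
      rw [mul_assoc, mul_assoc]
      refine mul_le_mul_of_nonneg_left ?_ hc
      calc Real.exp (-(v * t ^ 2 / 2)) * (‖∫ y in Set.Ioc a x, cexp (-(t * y * I))‖ *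
            ‖charFun μ t - charFun ν t‖)
          ≤ Real.exp (-(v * t ^ 2 / 2)) * (2 / |t| * ‖charFun μ t - charFun ν t‖) := by
            gcongr; exact norm_setIntegral_exp_le ha ht
        _ = 2 / |t| * (‖charFun μ t - charFun ν t‖ * Real.exp (-(v * t ^ 2 / 2))) := by ring
        _ ≤ 2 / |t| * (|t| * G t) :=
            mul_le_mul_of_nonneg_left (hb t) (div_nonneg zero_le_two htp.le)
        _ = 2 * G t := by field_simp
    have hc : (0 : ℝ) ≤ (√(2 * Real.pi * v))⁻¹ := by positivity
    have hfin := norm_integral_le_of_norm_le (hG.const_mul _) hpt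
    rw [integral_const_mul] at hfin
    refine (mul_le_mul_of_nonneg_left hfin hc).trans (le_of_eq ?_)
    -- the two normalizing constants multiply to `(2 π)⁻¹`
    have hs : √(2 * Real.pi * v) * √(2 * Real.pi * (v : ℝ)⁻¹) = 2 * Real.pi := by
      have h2 : 2 * Real.pi * v * (2 * Real.pi * (v : ℝ)⁻¹) = (2 * Real.pi) ^ 2 := by
        field_simp
      rw [← Real.sqrt_mul (by positivity), h2]
      exact Real.sqrt_sq (by positivity)
    have : (√(2 * Real.pi * v))⁻¹ * ((√(2 * Real.pi * (v : ℝ)⁻¹))⁻¹ * 2 * ∫ t, G t) =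
        (√(2 * Real.pi * v) * √(2 * Real.pi * (v : ℝ)⁻¹))⁻¹ * 2 * ∫ t, G t := by
      rw [mul_inv]; ring
    rw [this, hs]
    field_simp
  -- the mass to the left of `a` disappears as `a → -∞`
  have hlim : Tendsto (fun a => |∫ w, (gaussianReal w v).real (Set.Iic a) ∂μ| +
      |∫ w, (gaussianReal w v).real (Set.Iic a) ∂ν| + (∫ t, G t) / Real.pi) atBot
      (𝓝 (|0| + |0| + (∫ t, G t) / Real.pi)) :=
    ((tendsto_integral_gaussianReal_Iic μ v).abs.add
      (tendsto_integral_gaussianReal_Iic ν v).abs).add tendsto_const_nhds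
  simp only [abs_zero, zero_add] at hlim
  refine ge_of_tendsto hlim ?_
  filter_upwards [eventually_le_atBot x] with a ha
  rw [hsplit μ a ha, hsplit ν a ha]
  have := key a ha
  rw [abs_le] at this
  rw [abs_le]
  constructor
  · linarith [neg_abs_le (∫ w, (gaussianReal w v).real (Set.Iic a) ∂μ),
      le_abs_self (∫ w, (gaussianReal w v).real (Set.Iic a) ∂ν)]
  · linarith [le_abs_self (∫ w, (gaussianReal w v).real (Set.Iic a) ∂μ),
      neg_abs_le (∫ w, (gaussianReal w v).real (Set.Iic a) ∂ν)]

lemma gaussianReal_real_Ici_le (w : ℝ) {v : NNReal} (hv : v ≠ 0) {d : ℝ} (hd : 0 ≤ d) :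
    (gaussianReal w v).real (Set.Ici (w + d)) ≤ Real.exp (-(d ^ 2 / (2 * v))) := by
  have hvpos : (0 : ℝ) < v := lt_of_le_of_ne v.2 (by exact_mod_cast hv.symm)
  have h := measure_ge_le_exp_mul_mgf (μ := gaussianReal w v) (X := id) (t := d / v) (w + d)
    (by positivity) (by simpa using integrable_exp_mul_gaussianReal (d / v))
  rw [mgf_id_gaussianReal, ← Real.exp_add] at h
  refine h.trans (le_of_eq ?_)
  congr 1; field_simp; ring

lemma gaussianReal_real_Iic_le (w : ℝ) {v : NNReal} (hv : v ≠ 0) {d : ℝ} (hd : 0 ≤ d) :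
    (gaussianReal w v).real (Set.Iic (w - d)) ≤ Real.exp (-(d ^ 2 / (2 * v))) := by
  have hvpos : (0 : ℝ) < v := lt_of_le_of_ne v.2 (by exact_mod_cast hv.symm)
  have h := measure_le_le_exp_mul_mgf (μ := gaussianReal w v) (X := id) (t := -(d / v)) (w - d)
    (by simp; positivity) (by simpa using integrable_exp_mul_gaussianReal (-(d / v)))
  rw [mgf_id_gaussianReal, ← Real.exp_add] at h
  refine h.trans (le_of_eq ?_)
  congr 1; field_simp; ring

/-- A Gaussian displacement exceeds `d` only with exponentially small probability, so mollification
decreases a distribution function by little once the argument is shifted by `d`. -/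
lemma measureReal_Iic_le_integral_gaussianReal (μ : Measure ℝ) [IsProbabilityMeasure μ]
    {v : NNReal} (hv : v ≠ 0) {d : ℝ} (hd : 0 ≤ d) (x : ℝ) :
    μ.real (Set.Iic x) ≤ ∫ w, (gaussianReal w v).real (Set.Iic (x + d)) ∂μ
      + Real.exp (-(d ^ 2 / (2 * v))) := by
  have h1 : ∫ w, (Set.Iic x).indicator (fun _ => (1 : ℝ)) w ∂μ = μ.real (Set.Iic x) := by
    rw [integral_indicator measurableSet_Iic]; simp
  have h2 : ∫ w, ((gaussianReal w v).real (Set.Iic (x + d)) + Real.exp (-(d ^ 2 / (2 * v)))) ∂μ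
      = ∫ w, (gaussianReal w v).real (Set.Iic (x + d)) ∂μ + Real.exp (-(d ^ 2 / (2 * v))) := by
    rw [integral_add (integrable_gaussianReal_real _ _ measurableSet_Iic) (integrable_const _)]
    simp
  rw [← h1, ← h2]
  refine integral_mono ((integrable_const _).indicator measurableSet_Iic)
    ((integrable_gaussianReal_real _ _ measurableSet_Iic).add (integrable_const _)) fun w => ?_
  by_cases hw : w ∈ Set.Iic x
  · simp only [Set.indicator_of_mem hw]
    have hc : (gaussianReal w v).real (Set.Iic (x + d))ᶜ ≤ Real.exp (-(d ^ 2 / (2 * v))) := by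
      refine (measureReal_mono ?_).trans (gaussianReal_real_Ici_le w hv hd)
      intro y hy
      simp only [Set.mem_compl_iff, Set.mem_Iic, not_le, Set.mem_Ici] at hy hw ⊢
      linarith
    rw [probReal_compl_eq_one_sub measurableSet_Iic] at hc
    linarith
  · simp only [Set.indicator_of_notMem hw]; positivity

/-- The counterpart of `measureReal_Iic_le_integral_gaussianReal` in the other direction. -/
lemma integral_gaussianReal_le_measureReal_Iic (μ : Measure ℝ) [IsProbabilityMeasure μ]
    {v : NNReal} (hv : v ≠ 0) {d : ℝ} (hd : 0 ≤ d) (x : ℝ) :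
    ∫ w, (gaussianReal w v).real (Set.Iic x) ∂μ ≤ μ.real (Set.Iic (x + d))
      + Real.exp (-(d ^ 2 / (2 * v))) := by
  have h1 : ∫ w, ((Set.Iic (x + d)).indicator (fun _ => (1 : ℝ)) w
      + Real.exp (-(d ^ 2 / (2 * v)))) ∂μ
      = μ.real (Set.Iic (x + d)) + Real.exp (-(d ^ 2 / (2 * v))) := by
    rw [integral_add ((integrable_const _).indicator measurableSet_Iic) (integrable_const _),
      integral_indicator measurableSet_Iic]; simp
  rw [← h1]
  refine integral_mono (integrable_gaussianReal_real _ _ measurableSet_Iic)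
    (((integrable_const _).indicator measurableSet_Iic).add (integrable_const _)) fun w => ?_
  by_cases hw : w ∈ Set.Iic (x + d)
  · simp only [Set.indicator_of_mem hw]
    have := measureReal_le_one (μ := gaussianReal w v) (s := Set.Iic x)
    have := Real.exp_pos (-(d ^ 2 / (2 * v) : ℝ))
    linarith
  · simp only [Set.indicator_of_notMem hw, zero_add]
    refine (measureReal_mono ?_).trans (gaussianReal_real_Iic_le w hv hd)
    intro y hy
    simp only [Set.mem_Iic, not_le] at hy hw ⊢
    linarith

/-- Smoothing inequality: two distribution functions are close, up to a shift of the argument,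
when the characteristic functions are close against the weight `exp (-v t² / 2) / |t|`. -/
lemma measureReal_Iic_le_of_charFun (μ ν : Measure ℝ) [IsProbabilityMeasure μ]
    [IsProbabilityMeasure ν] {v : NNReal} (hv : v ≠ 0) {G : ℝ → ℝ} (hG : Integrable G)
    (hb : ∀ t, ‖charFun μ t - charFun ν t‖ * Real.exp (-(v * t ^ 2 / 2)) ≤ |t| * G t)
    {d : ℝ} (hd : 0 ≤ d) (x : ℝ) :
    μ.real (Set.Iic x) ≤ ν.real (Set.Iic (x + 2 * d)) + (∫ t, G t) / Real.pi
      + 2 * Real.exp (-(d ^ 2 / (2 * v))) := by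
  have h1 := measureReal_Iic_le_integral_gaussianReal μ hv hd x
  have h2 := abs_integral_gaussianReal_Iic_sub_le μ ν hv hG hb (x + d)
  have h3 := integral_gaussianReal_le_measureReal_Iic ν hv hd (x + d)
  rw [show x + d + d = x + 2 * d by ring] at h3
  linarith [(abs_le.1 h2).2]

/-- Two-sided smoothing inequality towards a law whose distribution function is Lipschitz. -/
lemma abs_measureReal_Iic_sub_le_of_charFun (μ ν : Measure ℝ) [IsProbabilityMeasure μ]
    [IsProbabilityMeasure ν] {v : NNReal} (hv : v ≠ 0) {G : ℝ → ℝ} (hG : Integrable G)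
    (hb : ∀ t, ‖charFun μ t - charFun ν t‖ * Real.exp (-(v * t ^ 2 / 2)) ≤ |t| * G t)
    {d : ℝ} (hd : 0 ≤ d) {L : ℝ}
    (hL : ∀ x y, x ≤ y → ν.real (Set.Iic y) ≤ ν.real (Set.Iic x) + L * (y - x)) (x : ℝ) :
    |μ.real (Set.Iic x) - ν.real (Set.Iic x)| ≤ (∫ t, G t) / Real.pi + 2 * L * d
      + 2 * Real.exp (-(d ^ 2 / (2 * v))) := by
  have h1 := measureReal_Iic_le_of_charFun μ ν hv hG hb hd x
  have h2 := measureReal_Iic_le_of_charFun ν μ hv hG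
    (fun t => by rw [norm_sub_rev]; exact hb t) hd (x - 2 * d)
  rw [sub_add_cancel] at h2
  have h3 := hL x (x + 2 * d) (by linarith)
  have h4 := hL (x - 2 * d) x (by linarith)
  rw [abs_le]
  constructor <;> linarith

lemma gaussianReal_real_Iic_le_add {v : NNReal} (hv : v ≠ 0) (x y : ℝ) (hxy : x ≤ y) :
    (gaussianReal 0 v).real (Set.Iic y) ≤ (gaussianReal 0 v).real (Set.Iic x)
      + (√(2 * Real.pi * v))⁻¹ * (y - x) := by
  have hu : Set.Iic y = Set.Iic x ∪ Set.Ioc x y := (Set.Iic_union_Ioc_eq_Iic hxy).symm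
  rw [hu]
  refine (measureReal_union_le _ _).trans ?_
  gcongr
  rw [Measure.real, gaussianReal_apply_eq_integral _ hv, ENNReal.toReal_ofReal
      (setIntegral_nonneg measurableSet_Ioc fun x _ => gaussianPDFReal_nonneg _ _ _)]
  have h := norm_setIntegral_le_of_norm_le_const (μ := volume) (s := Set.Ioc x y)
    (f := gaussianPDFReal 0 v) (C := (√(2 * Real.pi * v))⁻¹) (by simp) (fun z _ => by
      rw [Real.norm_of_nonneg (gaussianPDFReal_nonneg _ _ _), gaussianPDFReal]
      refine mul_le_of_le_one_right (by positivity) (Real.exp_le_one_iff.2 ?_)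
      rw [neg_div]
      exact neg_nonpos.2 (by positivity))
  refine (le_abs_self _).trans (h.trans ?_)
  simp [Measure.real, ENNReal.toReal_ofReal (sub_nonneg.2 hxy)]

end WeakDep

/-! ### From characteristic functions to distribution functions -/

namespace WeakDep

lemma norm_pow_sub_pow_le_mul (a b : ℂ) {M : ℝ} (ha : ‖a‖ ≤ M) (hb : ‖b‖ ≤ M) (k : ℕ) :
    ‖a ^ (k + 1) - b ^ (k + 1)‖ ≤ (k + 1) * ‖a - b‖ * M ^ k := by
  have hM : 0 ≤ M := (norm_nonneg a).trans ha
  induction k with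
  | zero => simp
  | succ k ih =>
    have e : a ^ (k + 1 + 1) - b ^ (k + 1 + 1)
        = a * (a ^ (k + 1) - b ^ (k + 1)) + (a - b) * b ^ (k + 1) := by ring
    rw [e]
    refine (norm_add_le _ _).trans ?_
    rw [norm_mul, norm_mul, norm_pow]
    have h1 : ‖a‖ * ‖a ^ (k + 1) - b ^ (k + 1)‖ ≤ M * ((k + 1) * ‖a - b‖ * M ^ k) := by gcongr
    have h2 : ‖a - b‖ * ‖b‖ ^ (k + 1) ≤ ‖a - b‖ * M ^ (k + 1) := by gcongr
    push_cast
    calc _ ≤ _ := add_le_add h1 h2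
      _ = _ := by ring

/-- Comparison of the `k`-th power of a characteristic function with a Gaussian one, in the range
where the second-order Taylor expansion controls the decay of the former. -/
lemma norm_pow_sub_exp_le {φ : ℂ} {t v ρ : ℝ} (k : ℕ) (hv : 0 ≤ v) (hρ : 0 ≤ ρ)
    (hvρ : v ^ 3 ≤ ρ ^ 2) (ht : |t| * (24 * ρ) ≤ v)
    (hφ : ‖φ - ((1 - v * t ^ 2 / 2 : ℝ) : ℂ)‖ ≤ 4 * ρ * |t| ^ 3) :
    ‖φ ^ k - ((Real.exp (-(k * v * t ^ 2 / 2)) : ℝ) : ℂ)‖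
      ≤ 10 * k * ρ * |t| ^ 3 * Real.exp (-(k * v * t ^ 2 / 3)) := by
  rcases k with _ | k
  · simp
  have hts : |t| ^ 2 = t ^ 2 := sq_abs t
  have ht0 := abs_nonneg t
  -- `v³ ≤ ρ²` together with `24 |t| ρ ≤ v` forces `v t²` to be small
  have hx1 : v * t ^ 2 ≤ 1 / 576 := by
    rcases hv.eq_or_lt with h0 | h0
    · rw [← h0]; norm_num
    · have h1 : (|t| * (24 * ρ)) ^ 2 ≤ v ^ 2 := by gcongr
      have h2 : 576 * t ^ 2 * v ^ 3 ≤ v ^ 2 := by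
        calc 576 * t ^ 2 * v ^ 3 ≤ 576 * t ^ 2 * ρ ^ 2 := by gcongr
          _ = (|t| * (24 * ρ)) ^ 2 := by rw [mul_pow, hts]; ring
          _ ≤ _ := h1
      have h3 : v ^ 2 * (576 * (v * t ^ 2)) ≤ v ^ 2 * 1 := by nlinarith
      have := le_of_mul_le_mul_left h3 (by positivity)
      linarith
  set x := v * t ^ 2 / 2 with hx
  have hx0 : 0 ≤ x := by positivity
  have h6 : 4 * ρ * |t| ^ 3 ≤ x / 3 := by
    have : |t| * (24 * ρ) * |t| ^ 2 ≤ v * |t| ^ 2 := by gcongr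
    rw [hx, ← hts]; nlinarith
  -- `M` bounds both numbers whose powers are compared: the Taylor remainder eats at most a third of
  -- the quadratic term
  set M := Real.exp (-(2 * x / 3)) with hM
  have hM1 : 1 - 2 * x / 3 ≤ M := by
    have := Real.add_one_le_exp (-(2 * x / 3)); linarith
  have hφM : ‖φ‖ ≤ M := by
    have h1 : ‖φ‖ ≤ ‖φ - ((1 - x : ℝ) : ℂ)‖ + ‖((1 - x : ℝ) : ℂ)‖ := by
      simpa using norm_add_le (φ - ((1 - x : ℝ) : ℂ)) ((1 - x : ℝ) : ℂ)
    rw [Complex.norm_real, Real.norm_of_nonneg (by linarith : 0 ≤ 1 - x)] at h1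
    linarith
  set ψ : ℂ := ((Real.exp (-x) : ℝ) : ℂ) with hψ
  have hψM : ‖ψ‖ ≤ M := by
    rw [hψ, Complex.norm_real, Real.norm_of_nonneg (Real.exp_pos _).le]
    exact Real.exp_le_exp.2 (by linarith)
  have hdiff : ‖φ - ψ‖ ≤ 5 * ρ * |t| ^ 3 := by
    have h1 : ‖φ - ψ‖ ≤ ‖φ - ((1 - x : ℝ) : ℂ)‖ + ‖((1 - x : ℝ) : ℂ) - ψ‖ := by
      simpa using norm_add_le (φ - ((1 - x : ℝ) : ℂ)) (((1 - x : ℝ) : ℂ) - ψ)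
    have h2 : ‖((1 - x : ℝ) : ℂ) - ψ‖ ≤ x ^ 2 := by
      rw [hψ, ← Complex.ofReal_sub, Complex.norm_real, Real.norm_eq_abs, abs_sub_comm]
      have := Real.abs_exp_sub_one_sub_id_le (x := -x) (by rw [abs_neg, abs_of_nonneg hx0]; linarith)
      rw [neg_sq] at this
      convert this using 2; ring
    have h3 : v ^ 2 * |t| ≤ ρ := by
      refine abs_le_of_sq_le_sq' ?_ hρ |>.2
      calc (v ^ 2 * |t|) ^ 2 = v ^ 3 * (v * t ^ 2) := by rw [mul_pow, hts]; ring
        _ ≤ ρ ^ 2 * 1 := by gcongr; linarith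
        _ = ρ ^ 2 := mul_one _
    have h4 : x ^ 2 ≤ ρ * |t| ^ 3 := by
      have : x ^ 2 = (v ^ 2 * |t|) * |t| ^ 3 / 4 := by rw [hx, ← hts]; ring
      rw [this]
      have : (v ^ 2 * |t|) * |t| ^ 3 ≤ ρ * |t| ^ 3 := by gcongr
      have : 0 ≤ ρ * |t| ^ 3 := by positivity
      linarith
    linarith
  have hpow := norm_pow_sub_pow_le_mul φ ψ hφM hψM k
  have e1 : ψ ^ (k + 1) = ((Real.exp (-((k + 1 : ℕ) * v * t ^ 2 / 2)) : ℝ) : ℂ) := by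
    rw [hψ, ← Complex.ofReal_pow, ← Real.exp_nat_mul]
    congr 2; rw [hx]; push_cast; ring
  rw [← e1]
  refine hpow.trans ?_
  have hMk : M ^ k ≤ 2 * Real.exp (-((k + 1 : ℕ) * v * t ^ 2 / 3)) := by
    have h2 : Real.exp (2 * x / 3) ≤ 2 := by
      have h := Real.abs_exp_sub_one_le (x := 2 * x / 3)
        (by rw [abs_of_nonneg (by positivity)]; linarith)
      rw [abs_of_nonneg (by positivity : 0 ≤ 2 * x / 3)] at h
      linarith [le_abs_self (Real.exp (2 * x / 3) - 1)]
    have : M ^ k = Real.exp (2 * x / 3) * Real.exp (-((k + 1 : ℕ) * v * t ^ 2 / 3)) := by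
      rw [hM, ← Real.exp_nat_mul, ← Real.exp_add]
      congr 1; rw [hx]; push_cast; ring
    rw [this]; gcongr
  push_cast at hMk ⊢
  calc (k + 1 : ℝ) * ‖φ - ψ‖ * M ^ k ≤ (k + 1) * (5 * ρ * |t| ^ 3) *
        (2 * Real.exp (-((k + 1) * v * t ^ 2 / 3))) := by gcongr
    _ = _ := by ring

lemma mul_exp_neg_mul_sq_le {s : ℝ} (hs : 0 < s) (t : ℝ) :
    t ^ 2 * Real.exp (-(2 * s * t ^ 2)) ≤ 1 / s * Real.exp (-(s * t ^ 2)) := by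
  have h1 : s * t ^ 2 ≤ Real.exp (s * t ^ 2) := by linarith [Real.add_one_le_exp (s * t ^ 2)]
  have h2 : Real.exp (-(2 * s * t ^ 2)) = Real.exp (-(s * t ^ 2)) * (Real.exp (s * t ^ 2))⁻¹ := by
    rw [← Real.exp_neg, ← Real.exp_add]; congr 1; ring
  rw [h2]
  have hp := Real.exp_pos (s * t ^ 2)
  have h3 : t ^ 2 * (Real.exp (s * t ^ 2))⁻¹ ≤ 1 / s := by
    rw [← div_eq_mul_inv, div_le_div_iff₀ hp hs]; linarith
  calc t ^ 2 * (Real.exp (-(s * t ^ 2)) * (Real.exp (s * t ^ 2))⁻¹)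
      = (t ^ 2 * (Real.exp (s * t ^ 2))⁻¹) * Real.exp (-(s * t ^ 2)) := by ring
    _ ≤ _ := by gcongr

lemma abs_exp_neg_sub_exp_neg_le {a b m : ℝ} (ha : m ≤ a) (hb : m ≤ b) :
    |Real.exp (-a) - Real.exp (-b)| ≤ |a - b| * Real.exp (-m) := by
  wlog hab : a ≤ b generalizing a b
  · rw [abs_sub_comm, abs_sub_comm a b]; exact this hb ha (le_of_not_ge hab)
  have h1 : Real.exp (-b) ≤ Real.exp (-a) := Real.exp_le_exp.2 (by linarith)
  rw [abs_of_nonneg (by linarith), abs_of_nonpos (by linarith)]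
  have h2 : 1 - (b - a) ≤ Real.exp (-(b - a)) := by
    linarith [Real.add_one_le_exp (-(b - a))]
  have h3 : Real.exp (-b) = Real.exp (-a) * Real.exp (-(b - a)) := by
    rw [← Real.exp_add]; congr 1; ring
  have h4 : Real.exp (-a) ≤ Real.exp (-m) := Real.exp_le_exp.2 (by linarith)
  rw [h3]
  nlinarith [Real.exp_pos (-a)]

lemma abs_mul_exp_neg_le {h : ℝ} (hh : 0 < h) (t : ℝ) :
    |t| * Real.exp (-(h ^ 2 * t ^ 2 / 2)) ≤ 1 / h * Real.exp (-(h ^ 2 / 4 * t ^ 2)) := by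
  have h1 : h * |t| ≤ Real.exp (h ^ 2 / 4 * t ^ 2) := by
    refine le_trans ?_ (Real.add_one_le_exp _)
    rw [← sq_abs t]
    nlinarith [sq_nonneg (h * |t| / 2 - 1)]
  have h2 : Real.exp (-(h ^ 2 * t ^ 2 / 2)) =
      Real.exp (-(h ^ 2 / 4 * t ^ 2)) * (Real.exp (h ^ 2 / 4 * t ^ 2))⁻¹ := by
    rw [← Real.exp_neg, ← Real.exp_add]; congr 1; ring
  have hp := Real.exp_pos (h ^ 2 / 4 * t ^ 2)
  have h3 : |t| * (Real.exp (h ^ 2 / 4 * t ^ 2))⁻¹ ≤ 1 / h := by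
    rw [← div_eq_mul_inv, div_le_div_iff₀ hp hh]; linarith
  rw [h2]
  calc |t| * (Real.exp (-(h ^ 2 / 4 * t ^ 2)) * (Real.exp (h ^ 2 / 4 * t ^ 2))⁻¹)
      = (|t| * (Real.exp (h ^ 2 / 4 * t ^ 2))⁻¹) * Real.exp (-(h ^ 2 / 4 * t ^ 2)) := by ring
    _ ≤ _ := by gcongr

/-- The comparison of `norm_pow_sub_exp_le`, with the variance `k v` replaced by its limit `S`. The
extra decay of the exponentials turns every power of `|t|` into the single factor `|t|` that the
smoothing inequality requires. -/
lemma norm_pow_sub_exp_le_of_abs_le {φ : ℂ} {t v ρ A₄ S : ℝ} (k : ℕ) (hv : 0 ≤ v) (hρ : 0 ≤ ρ)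
    (hvρ : v ^ 3 ≤ ρ ^ 2) (ht : |t| * (24 * ρ) ≤ v)
    (hφ : ‖φ - ((1 - v * t ^ 2 / 2 : ℝ) : ℂ)‖ ≤ 4 * ρ * |t| ^ 3)
    (hA₄ : |k * v - S| ≤ A₄) (hS : 0 < S) (hkv : S / 2 ≤ k * v) :
    ‖φ ^ k - ((Real.exp (-(S * t ^ 2 / 2)) : ℝ) : ℂ)‖ ≤
      |t| * ((10 * k * ρ + A₄) * (1 + 12 / S) * Real.exp (-(S / 12 * t ^ 2))) := by
  have ht0 := abs_nonneg t
  have hts : |t| ^ 2 = t ^ 2 := sq_abs t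
  have ht2 := sq_nonneg t
  have hA₄0 : 0 ≤ A₄ := (abs_nonneg _).trans hA₄
  set H := Real.exp (-(S / 12 * t ^ 2)) with hH
  have hH0 : 0 < H := Real.exp_pos _
  set ψ : ℂ := ((Real.exp (-(S * t ^ 2 / 2)) : ℝ) : ℂ) with hψ
  have h1 := norm_pow_sub_exp_le k hv hρ hvρ ht hφ
  have h2 : ‖(((Real.exp (-(k * v * t ^ 2 / 2)) : ℝ) : ℂ)) - ψ‖ ≤
      A₄ * t ^ 2 * Real.exp (-(S / 6 * t ^ 2)) := by
    rw [hψ, ← Complex.ofReal_sub, Complex.norm_real, Real.norm_eq_abs]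
    refine (abs_exp_neg_sub_exp_neg_le (m := S / 6 * t ^ 2) ?_ ?_).trans ?_
    · nlinarith only [mul_le_mul_of_nonneg_right hkv ht2, hS.le, ht2, mul_nonneg hS.le ht2]
    · nlinarith only [mul_nonneg hS.le ht2]
    · gcongr
      rw [show (k : ℝ) * v * t ^ 2 / 2 - S * t ^ 2 / 2 = (k * v - S) * (t ^ 2 / 2) by ring,
        abs_mul, abs_of_nonneg (by positivity : 0 ≤ t ^ 2 / 2)]
      nlinarith only [mul_le_mul_of_nonneg_right hA₄ ht2, mul_nonneg hA₄0 ht2]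
  have h3 : Real.exp (-(k * v * t ^ 2 / 3)) ≤ Real.exp (-(S / 6 * t ^ 2)) :=
    Real.exp_le_exp.2 (by nlinarith only [mul_le_mul_of_nonneg_right hkv ht2])
  have h4 : Real.exp (-(S / 6 * t ^ 2)) ≤ H :=
    Real.exp_le_exp.2 (by nlinarith only [mul_nonneg hS.le ht2])
  have h5 : t ^ 2 * Real.exp (-(S / 6 * t ^ 2)) ≤ 12 / S * H := by
    have := mul_exp_neg_mul_sq_le (s := S / 12) (by positivity) t
    rw [show 2 * (S / 12) = S / 6 by ring, one_div_div] at this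
    exact this
  have h6 : |t| * Real.exp (-(S / 6 * t ^ 2)) ≤ (1 + 12 / S) * H := by
    have : |t| ≤ 1 + t ^ 2 := by rw [← hts]; nlinarith only [sq_nonneg (|t| - 1), sq_nonneg |t|]
    calc |t| * Real.exp (-(S / 6 * t ^ 2))
        ≤ (1 + t ^ 2) * Real.exp (-(S / 6 * t ^ 2)) := by gcongr
      _ = Real.exp (-(S / 6 * t ^ 2)) + t ^ 2 * Real.exp (-(S / 6 * t ^ 2)) := by ring
      _ ≤ H + 12 / S * H := add_le_add h4 h5
      _ = _ := by ring
  have h7 : t ^ 2 * Real.exp (-(S / 6 * t ^ 2)) ≤ (1 + 12 / S) * H := by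
    refine h5.trans ?_; gcongr; linarith
  have htri2 : ‖φ ^ k - ψ‖ ≤ 10 * k * ρ * |t| ^ 3 * Real.exp (-(S / 6 * t ^ 2))
      + A₄ * t ^ 2 * Real.exp (-(S / 6 * t ^ 2)) := by
    refine (norm_sub_le_norm_sub_add_norm_sub _ _ _).trans
      (add_le_add (h1.trans ?_) h2)
    gcongr
  calc _ ≤ _ := htri2
      _ = |t| * (10 * k * ρ * (t ^ 2 * Real.exp (-(S / 6 * t ^ 2)))
          + A₄ * (|t| * Real.exp (-(S / 6 * t ^ 2)))) := by rw [← hts]; ring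
      _ ≤ |t| * (10 * k * ρ * ((1 + 12 / S) * H) + A₄ * ((1 + 12 / S) * H)) := by gcongr
      _ = _ := by ring

/-- Pointwise bound on the difference of characteristic functions that feeds the smoothing
inequality. For `|t| ≤ R` the comparison of powers applies; for larger `t` the mollifier is
already negligible. -/
lemma norm_sub_mul_exp_le {z φ : ℂ} {t v ρ A₁ A₂ A₄ R h S : ℝ} (k : ℕ) (hv : 0 ≤ v) (hρ : 0 ≤ ρ)
    (hvρ : v ^ 3 ≤ ρ ^ 2) (hφ : ‖φ - ((1 - v * t ^ 2 / 2 : ℝ) : ℂ)‖ ≤ 4 * ρ * |t| ^ 3)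
    (hφ1 : ‖φ‖ ≤ 1) (hz : ‖z - φ ^ k‖ ≤ A₁ * t ^ 2 + A₂ * |t|) (hA₁ : 0 ≤ A₁) (hA₂ : 0 ≤ A₂)
    (hA₄ : |k * v - S| ≤ A₄) (hS : 0 < S) (hkv : S / 2 ≤ k * v) (hR : 0 < R)
    (hRv : R * (24 * ρ) ≤ v) (hh : 0 < h) :
    ‖z - ((Real.exp (-(S * t ^ 2 / 2)) : ℝ) : ℂ)‖ * Real.exp (-(h ^ 2 * t ^ 2 / 2)) ≤
      |t| * ((A₁ / h + A₂ + 2 / R * Real.exp (-(h ^ 2 * R ^ 2 / 4)))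
          * Real.exp (-(h ^ 2 / 4 * t ^ 2))
        + (10 * k * ρ + A₄) * (1 + 12 / S) * Real.exp (-(S / 12 * t ^ 2))) := by
  have ht0 := abs_nonneg t
  have hts : |t| ^ 2 = t ^ 2 := sq_abs t
  have hA₄0 : 0 ≤ A₄ := (abs_nonneg _).trans hA₄
  set E := Real.exp (-(h ^ 2 * t ^ 2 / 2)) with hE
  set F := Real.exp (-(h ^ 2 / 4 * t ^ 2)) with hF
  set H := Real.exp (-(S / 12 * t ^ 2)) with hH
  have hE0 : 0 < E := Real.exp_pos _
  have hF0 : 0 < F := Real.exp_pos _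
  have hH0 : 0 < H := Real.exp_pos _
  have hE1 : E ≤ 1 := Real.exp_le_one_iff.2 (by simp only [Left.neg_nonpos_iff]; positivity)
  have hEF : E ≤ F := Real.exp_le_exp.2 (by nlinarith [sq_nonneg (h * t)])
  set ψ : ℂ := ((Real.exp (-(S * t ^ 2 / 2)) : ℝ) : ℂ) with hψ
  have htri : ‖z - ψ‖ ≤ ‖z - φ ^ k‖ + ‖φ ^ k - ψ‖ := by
    simpa using norm_add_le (z - φ ^ k) (φ ^ k - ψ)
  have hfirst : (A₁ * t ^ 2 + A₂ * |t|) * E ≤ |t| * ((A₁ / h + A₂) * F) := by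
    have h1 := abs_mul_exp_neg_le hh t
    rw [← hE, ← hF] at h1
    calc (A₁ * t ^ 2 + A₂ * |t|) * E = |t| * (A₁ * (|t| * E) + A₂ * E) := by rw [← hts]; ring
      _ ≤ |t| * (A₁ * (1 / h * F) + A₂ * F) := by gcongr
      _ = _ := by ring
  have hsecond : ‖φ ^ k - ψ‖ * E ≤ |t| * (2 / R * Real.exp (-(h ^ 2 * R ^ 2 / 4)) * F
      + (10 * k * ρ + A₄) * (1 + 12 / S) * H) := by
    rcases le_or_gt |t| R with htR | htR
    · have h8 := norm_pow_sub_exp_le_of_abs_le k hv hρ hvρ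
        ((mul_le_mul_of_nonneg_right htR (by positivity)).trans hRv) hφ hA₄ hS hkv
      rw [← hψ, ← hH] at h8
      calc ‖φ ^ k - ψ‖ * E ≤ ‖φ ^ k - ψ‖ * 1 := by gcongr
        _ ≤ |t| * (0 + (10 * k * ρ + A₄) * (1 + 12 / S) * H) := by rw [mul_one, zero_add]; exact h8
        _ ≤ _ := by gcongr; positivity
    · have h1 : ‖φ ^ k - ψ‖ ≤ 2 := by
        refine (norm_sub_le _ _).trans ?_
        have a1 : ‖φ ^ k‖ ≤ 1 := by rw [norm_pow]; exact pow_le_one₀ (norm_nonneg _) hφ1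
        have a2 : ‖ψ‖ ≤ 1 := by
          rw [hψ, Complex.norm_real, Real.norm_of_nonneg (Real.exp_pos _).le]
          exact Real.exp_le_one_iff.2 (by simp only [Left.neg_nonpos_iff]; positivity)
        linarith
      have h2 : E ≤ Real.exp (-(h ^ 2 * R ^ 2 / 4)) * F := by
        rw [hE, hF, ← Real.exp_add]
        apply Real.exp_le_exp.2
        have : R ^ 2 ≤ t ^ 2 := by rw [← hts]; gcongr
        nlinarith [sq_nonneg h]
      have h3 : 1 ≤ |t| / R := by rw [le_div_iff₀ hR]; linarith
      calc ‖φ ^ k - ψ‖ * E ≤ 2 * (Real.exp (-(h ^ 2 * R ^ 2 / 4)) * F) := by gcongr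
        _ ≤ |t| / R * (2 * (Real.exp (-(h ^ 2 * R ^ 2 / 4)) * F)) :=
            le_mul_of_one_le_left (by positivity) h3
        _ = |t| * (2 / R * Real.exp (-(h ^ 2 * R ^ 2 / 4)) * F + 0) := by ring
        _ ≤ _ := by gcongr; positivity
  calc ‖z - ψ‖ * E ≤ (‖z - φ ^ k‖ + ‖φ ^ k - ψ‖) * E := by gcongr
    _ ≤ (A₁ * t ^ 2 + A₂ * |t| + ‖φ ^ k - ψ‖) * E := by gcongr
    _ = (A₁ * t ^ 2 + A₂ * |t|) * E + ‖φ ^ k - ψ‖ * E := by ring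
    _ ≤ _ := add_le_add hfirst hsecond
    _ = _ := by ring

/-- Kolmogorov distance to a centred normal law of a probability measure whose characteristic
function is close to the `k`-th power of one with a good second-order expansion. Here `h` is the
width of the Gaussian mollifier, `d` the admitted shift of the argument and `R` the range of
frequencies in which the expansion is used. -/
lemma abs_measureReal_Iic_sub_gaussianReal_le (μ : Measure ℝ) [IsProbabilityMeasure μ]
    {φ : ℝ → ℂ} {v ρ A₁ A₂ A₄ R h S d : ℝ} (k : ℕ) (hv : 0 ≤ v) (hρ : 0 ≤ ρ)
    (hvρ : v ^ 3 ≤ ρ ^ 2)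
    (hφ : ∀ t, ‖φ t - ((1 - v * t ^ 2 / 2 : ℝ) : ℂ)‖ ≤ 4 * ρ * |t| ^ 3)
    (hφ1 : ∀ t, ‖φ t‖ ≤ 1)
    (hz : ∀ t, ‖charFun μ t - φ t ^ k‖ ≤ A₁ * t ^ 2 + A₂ * |t|) (hA₁ : 0 ≤ A₁) (hA₂ : 0 ≤ A₂)
    (hA₄ : |k * v - S| ≤ A₄) (hS : 0 < S) (hkv : S / 2 ≤ k * v) (hR : 0 < R)
    (hRv : R * (24 * ρ) ≤ v) (hh : 0 < h) (hd : 0 ≤ d) (x : ℝ) :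
    |μ.real (Set.Iic x) - (gaussianReal 0 S.toNNReal).real (Set.Iic x)| ≤
      ((A₁ / h + A₂ + 2 / R * Real.exp (-(h ^ 2 * R ^ 2 / 4))) * (√Real.pi * 2 / h)
        + (10 * k * ρ + A₄) * (1 + 12 / S) * √(12 * Real.pi / S)) / Real.pi
      + 2 * (√(2 * Real.pi * S))⁻¹ * d + 2 * Real.exp (-(d ^ 2 / (2 * h ^ 2))) := by
  have hSn : S.toNNReal ≠ 0 := by simpa using hS
  have hvn : (h ^ 2).toNNReal ≠ 0 := by simp only [ne_eq, Real.toNNReal_eq_zero, not_le]; positivity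
  have hSc : ((S.toNNReal : NNReal) : ℝ) = S := Real.coe_toNNReal _ hS.le
  have hvc : (((h ^ 2).toNNReal : NNReal) : ℝ) = h ^ 2 := Real.coe_toNNReal _ (by positivity)
  have hi1 : Integrable fun t : ℝ => Real.exp (-(h ^ 2 / 4 * t ^ 2)) := by
    simpa only [neg_mul] using integrable_exp_neg_mul_sq (by positivity : 0 < h ^ 2 / 4)
  have hi2 : Integrable fun t : ℝ => Real.exp (-(S / 12 * t ^ 2)) := by
    simpa only [neg_mul] using integrable_exp_neg_mul_sq (by positivity : 0 < S / 12)
  have key := abs_measureReal_Iic_sub_le_of_charFun μ (gaussianReal 0 S.toNNReal) hvn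
    (G := fun t => (A₁ / h + A₂ + 2 / R * Real.exp (-(h ^ 2 * R ^ 2 / 4)))
          * Real.exp (-(h ^ 2 / 4 * t ^ 2))
        + (10 * k * ρ + A₄) * (1 + 12 / S) * Real.exp (-(S / 12 * t ^ 2)))
    ((hi1.const_mul _).add (hi2.const_mul _)) (fun t => by
      have h0 := norm_sub_mul_exp_le k hv hρ hvρ (hφ t) (hφ1 t) (hz t) hA₁ hA₂ hA₄ hS hkv hR
        hRv hh
      rw [charFun_gaussianReal, hSc, hvc]
      convert h0 using 4
      push_cast
      congr 1
      ring) hd (L := (√(2 * Real.pi * S))⁻¹)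
    (fun x y hxy => by
      have := gaussianReal_real_Iic_le_add hSn x y hxy
      rwa [hSc] at this) x
  rw [hvc, integral_add (hi1.const_mul _) (hi2.const_mul _), integral_const_mul,
    integral_const_mul] at key
  have e1 : ∫ t : ℝ, Real.exp (-(h ^ 2 / 4 * t ^ 2)) = √Real.pi * 2 / h := by
    have := integral_gaussian (h ^ 2 / 4)
    simp only [neg_mul] at this
    rw [this, show Real.pi / (h ^ 2 / 4) = Real.pi * (2 / h) ^ 2 by field_simp; ring,
      Real.sqrt_mul Real.pi_pos.le, Real.sqrt_sq (by positivity)]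
    ring
  have e2 : ∫ t : ℝ, Real.exp (-(S / 12 * t ^ 2)) = √(12 * Real.pi / S) := by
    have := integral_gaussian (S / 12)
    simp only [neg_mul] at this
    rw [this]; congr 1; field_simp
  rw [e1, e2] at key
  exact key

open Complex in
/-- Second-order Taylor expansion of the imaginary exponential, with an absolute constant valid on
the whole line. -/
lemma norm_exp_mul_I_sub_le (x : ℝ) :
    ‖cexp (x * I) - (1 + x * I - ((x ^ 2 / 2 : ℝ) : ℂ))‖ ≤ 4 * |x| ^ 3 := by
  rcases le_or_gt |x| 1 with hx | hx
  · have h := Complex.exp_bound (x := x * I) (by simpa using hx) (n := 3) (by norm_num)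
    have e : ∑ m ∈ Finset.range 3, (x * I : ℂ) ^ m / (m.factorial : ℂ)
        = 1 + x * I - ((x ^ 2 / 2 : ℝ) : ℂ) := by
      simp only [Finset.sum_range_succ, Finset.sum_range_zero, Nat.factorial]
      push_cast
      rw [mul_pow (x : ℂ) I 2, I_sq]
      ring
    rw [e] at h
    refine h.trans ?_
    have : ‖(x * I : ℂ)‖ = |x| := by simp
    rw [this, mul_comm]
    gcongr
    norm_num [Nat.factorial]
  · have h1 : ‖cexp (x * I)‖ = 1 := Complex.norm_exp_ofReal_mul_I x
    have h2 : ‖(1 + x * I - ((x ^ 2 / 2 : ℝ) : ℂ))‖ ≤ 1 + |x| + x ^ 2 / 2 := by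
      refine (norm_sub_le _ _).trans (add_le_add ((norm_add_le _ _).trans ?_) ?_)
      · simp
      · rw [Complex.norm_real, Real.norm_of_nonneg (by positivity)]
    refine (norm_sub_le _ _).trans ?_
    rw [h1, ← sq_abs] at *
    nlinarith [mul_pos (sub_pos.2 hx) (sub_pos.2 hx), pow_pos (sub_pos.2 hx) 3]

end WeakDep

/-! ### Weak dependence and decoupling of blocks -/

namespace WeakDep

/-- Weak dependence at the polynomial rate `K (1 + r) ^ (-θ)`, with `ψ(u, v, a, b)` equal to
`u v a b + β (u a + v b)`; the values `β = 0` and `β = 1` give the `κ` and the `λ` case. Lipschitz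
moduli enter through upper bounds `a`, `b`. -/
structure PolyWeakDep {Ω : Type*} [MeasurableSpace Ω] (P : Measure Ω) (X : ℤ → Ω → ℝ)
    (β K θ : ℝ) : Prop where
  cov_le : ∀ (r u v : ℕ), 1 ≤ u → 1 ≤ v → ∀ (s : Fin u → ℤ) (t : Fin v → ℤ),
    Monotone s → Monotone t → (∀ i j, s i + (r : ℤ) ≤ t j) →
    ∀ (f : (Fin u → ℝ) → ℝ) (g : (Fin v → ℝ) → ℝ),
      (∀ x, |f x| ≤ 1) → (∀ y, |g y| ≤ 1) → ∀ a b : ℝ, 0 ≤ a → 0 ≤ b →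
      (∀ x y, |f x - f y| ≤ a * ∑ i, |x i - y i|) → (∀ x y, |g x - g y| ≤ b * ∑ i, |x i - y i|) →
      |cov[fun ω => f (fun i => X (s i) ω), fun ω => g (fun j => X (t j) ω); P]|
        ≤ (u * v * a * b + β * (u * a + v * b)) * (K * (1 + r : ℝ) ^ (-θ))

lemma lipQuotients_le {u : ℕ} {f : (Fin u → ℝ) → ℝ} {a : ℝ}
    (hf : ∀ x y, |f x - f y| ≤ a * ∑ i, |x i - y i|) : ∀ q ∈ lipQuotients f, q ≤ a := by
  rintro q ⟨x, y, hxy, rfl⟩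
  refine div_le_of_le_mul₀ (Finset.sum_nonneg fun _ _ => abs_nonneg _) ?_ (hf x y)
  obtain ⟨i, hi⟩ := Function.ne_iff.1 hxy
  have h1 : 0 < ∑ i, |x i - y i| :=
    Finset.sum_pos' (fun _ _ => abs_nonneg _) ⟨i, Finset.mem_univ _, abs_pos.2 (sub_ne_zero.2 hi)⟩
  have h2 := (abs_nonneg _).trans (hf x y)
  exact nonneg_of_mul_nonneg_left h2 h1

lemma lip_nonneg {u : ℕ} (f : (Fin u → ℝ) → ℝ) : 0 ≤ lip f := by
  refine Real.sSup_nonneg ?_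
  rintro q ⟨x, y, -, rfl⟩
  positivity

section Conversion

variable {Ω : Type*} [MeasurableSpace Ω] {P : Measure Ω} {X : ℤ → Ω → ℝ}

/-- Monotonicity extends the asymptotic bound to the finitely many remaining indices. -/
lemma exists_le_mul_rpow_of_isBigO {ε : ℕ → ℝ} {θ : ℝ} (hθ : 0 < θ) (hanti : Antitone ε)
    (hO : ε =O[atTop] (fun r : ℕ => (r : ℝ) ^ (-θ))) :
    ∃ K, 0 < K ∧ ∀ r, ε r ≤ K * (1 + r : ℝ) ^ (-θ) := by
  obtain ⟨C, hC0, hC⟩ := hO.exists_pos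
  rw [IsBigOWith] at hC
  obtain ⟨N, hN⟩ := eventually_atTop.1 hC
  refine ⟨max (C * 2 ^ θ) (|ε 0| * (1 + (N + 1) : ℝ) ^ θ), lt_max_of_lt_left (by positivity),
    fun r => ?_⟩
  have hr : (0 : ℝ) < 1 + r := by positivity
  rcases le_or_gt (N + 1) r with h | h
  · have h1 := hN r (by omega)
    have hr1 : (1 : ℝ) ≤ r := by exact_mod_cast (by omega : 1 ≤ r)
    rw [Real.norm_eq_abs, Real.norm_of_nonneg (by positivity)] at h1
    have h2 : (r : ℝ) ^ (-θ) ≤ 2 ^ θ * (1 + r : ℝ) ^ (-θ) := by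
      rw [Real.rpow_neg (by positivity), Real.rpow_neg (by positivity), ← div_eq_mul_inv,
        ← Real.div_rpow (by positivity) (by positivity), ← Real.inv_rpow (by positivity)]
      apply Real.rpow_le_rpow (by positivity) _ hθ.le
      rw [inv_le_comm₀ (by positivity) (by positivity), inv_div]
      linarith
    calc ε r ≤ |ε r| := le_abs_self _
      _ ≤ C * (2 ^ θ * (1 + r : ℝ) ^ (-θ)) := h1.trans (by gcongr)
      _ = C * 2 ^ θ * (1 + r : ℝ) ^ (-θ) := by ring
      _ ≤ _ := by gcongr; exact le_max_left _ _
  · have h2 : 1 ≤ (1 + (N + 1) : ℝ) ^ θ * (1 + r : ℝ) ^ (-θ) := by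
      rw [Real.rpow_neg (by positivity), ← div_eq_mul_inv,
        ← Real.div_rpow (by positivity) (by positivity)]
      apply Real.one_le_rpow _ hθ.le
      rw [one_le_div (by positivity)]
      have : (r : ℝ) ≤ N + 1 := by exact_mod_cast h.le
      linarith
    calc ε r ≤ ε 0 := hanti (Nat.zero_le r)
      _ ≤ |ε 0| * 1 := by rw [mul_one]; exact le_abs_self _
      _ ≤ |ε 0| * ((1 + (N + 1) : ℝ) ^ θ * (1 + r : ℝ) ^ (-θ)) := by gcongr
      _ = |ε 0| * (1 + (N + 1) : ℝ) ^ θ * (1 + r : ℝ) ^ (-θ) := by ring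
      _ ≤ _ := by gcongr; exact le_max_right _ _

lemma IsWeaklyDependent.polyWeakDep {ψ : ℕ → ℕ → ℝ → ℝ → ℝ} {ε : ℕ → ℝ} {β θ : ℝ} (hβ : 0 ≤ β)
    (hψ : ∀ u v a b, ψ u v a b = u * v * a * b + β * (u * a + v * b))
    (h : IsWeaklyDependent P X ψ ε) (hθ : 0 < θ)
    (hO : ε =O[atTop] (fun r : ℕ => (r : ℝ) ^ (-θ))) :
    ∃ K, 0 < K ∧ PolyWeakDep P X β K θ := by
  obtain ⟨K, hK0, hK⟩ := exists_le_mul_rpow_of_isBigO hθ h.antitone hO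
  have hε : ∀ r, 0 ≤ ε r := fun r => h.antitone.le_of_tendsto h.tendsto_zero r
  refine ⟨K, hK0, ⟨fun r u v hu hv s t hs ht hst f g hf hg a b ha hb hfa hgb => ?_⟩⟩
  have lf : lip f ≤ a := Real.sSup_le (lipQuotients_le hfa) ha
  have lg : lip g ≤ b := Real.sSup_le (lipQuotients_le hgb) hb
  refine (h.cov_le r u v hu hv s t hs ht hst f g hf hg ⟨a, lipQuotients_le hfa⟩
    ⟨b, lipQuotients_le hgb⟩).trans ?_
  rw [hψ]
  have := lip_nonneg f
  have := lip_nonneg g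
  have := hε r
  have := hK r
  gcongr

end Conversion

section Blocks

variable {Ω : Type*} [MeasurableSpace Ω] {P : Measure Ω} {X : ℤ → Ω → ℝ}

lemma IsStationary.integral_shift {E : Type*} [NormedAddCommGroup E] [NormedSpace ℝ E]
    [MeasurableSpace E] [BorelSpace E] (hstat : IsStationary P X) (h : ℤ)
    {G : (ℤ → ℝ) → E} (hG : Measurable G) :
    ∫ ω, G (fun t => X (t + h) ω) ∂P = ∫ ω, G (fun t => X t ω) ∂P :=
  ((hstat h).comp hG).integral_eq

/-- Weak dependence for functions of partial sums over two separated finite index sets. -/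
lemma PolyWeakDep.cov_sum_le {β K θ : ℝ} (hw : PolyWeakDep P X β K θ) {r : ℕ} {A B : Finset ℤ}
    (hA : A.Nonempty) (hB : B.Nonempty) (hAB : ∀ a ∈ A, ∀ b ∈ B, a + (r : ℤ) ≤ b)
    {ψ : ℝ → ℝ} (hψ : ∀ x y, |ψ x - ψ y| ≤ |x - y|) {F G : ℝ → ℝ} (hF : ∀ x, |F x| ≤ 1)
    (hG : ∀ x, |G x| ≤ 1) {a b : ℝ} (ha : 0 ≤ a) (hb : 0 ≤ b)
    (hFa : ∀ x y, |F x - F y| ≤ a * |x - y|) (hGb : ∀ x y, |G x - G y| ≤ b * |x - y|) :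
    |cov[fun ω => F (∑ i ∈ A, ψ (X i ω)), fun ω => G (∑ i ∈ B, ψ (X i ω)); P]| ≤
      (A.card * B.card * a * b + β * (A.card * a + B.card * b)) * (K * (1 + r : ℝ) ^ (-θ)) := by
  have hsum : ∀ (C : Finset ℤ) (w : ℤ → ℝ),
      ∑ i ∈ C, w i = ∑ j : Fin C.card, w (C.orderEmbOfFin rfl j) := by
    intro C w
    conv_lhs => rw [← Finset.map_orderEmbOfFin_univ C rfl]
    rw [Finset.sum_map]; rfl
  have hlip : ∀ (n : ℕ) (x y : Fin n → ℝ),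
      |∑ i, ψ (x i) - ∑ i, ψ (y i)| ≤ ∑ i, |x i - y i| := by
    intro n x y
    rw [← Finset.sum_sub_distrib]
    exact (Finset.abs_sum_le_sum_abs _ _).trans (Finset.sum_le_sum fun i _ => hψ _ _)
  have := hw.cov_le r A.card B.card hA.card_pos hB.card_pos (A.orderEmbOfFin rfl)
    (B.orderEmbOfFin rfl) (A.orderEmbOfFin rfl).monotone (B.orderEmbOfFin rfl).monotone
    (fun i j => hAB _ (Finset.orderEmbOfFin_mem _ _ _) _ (Finset.orderEmbOfFin_mem _ _ _))
    (fun x => F (∑ i, ψ (x i))) (fun x => G (∑ i, ψ (x i))) (fun _ => hF _) (fun _ => hG _) a b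
    ha hb (fun x y => (hFa _ _).trans (mul_le_mul_of_nonneg_left (hlip _ _ _) ha))
    (fun x y => (hGb _ _).trans (mul_le_mul_of_nonneg_left (hlip _ _ _) hb))
  simp_rw [hsum]
  exact this

variable [IsProbabilityMeasure P]

open Complex in
/-- Decoupling of a sum of two variables: the defect of multiplicativity of the characteristic
function consists of four covariances of sines and cosines. -/
lemma norm_integral_exp_add_sub_le {U V : Ω → ℝ} (hU : Measurable U) (hV : Measurable V) (s D : ℝ)
    (hD : ∀ f ∈ ({Real.sin, Real.cos} : Set (ℝ → ℝ)), ∀ g ∈ ({Real.sin, Real.cos} : Set (ℝ → ℝ)),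
      |cov[fun ω => f (s * U ω), fun ω => g (s * V ω); P]| ≤ D) :
    ‖∫ ω, cexp ((s * (U ω + V ω) : ℝ) * I) ∂P
      - (∫ ω, cexp ((s * U ω : ℝ) * I) ∂P) * ∫ ω, cexp ((s * V ω : ℝ) * I) ∂P‖ ≤ 4 * D := by
  have hexp : ∀ x : ℝ, cexp ((x : ℝ) * I) = ((Real.cos x : ℝ) : ℂ) + ((Real.sin x : ℝ) : ℂ) * I := by
    intro x; rw [Complex.exp_mul_I]; push_cast; rfl
  have ic : ∀ (W : Ω → ℝ), Measurable W → Integrable (fun ω => Real.cos (s * W ω)) P := fun W hW =>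
    Integrable.of_bound (C := 1) (by fun_prop) (ae_of_all _ fun ω => Real.abs_cos_le_one _)
  have is : ∀ (W : Ω → ℝ), Measurable W → Integrable (fun ω => Real.sin (s * W ω)) P := fun W hW =>
    Integrable.of_bound (C := 1) (by fun_prop) (ae_of_all _ fun ω => Real.abs_sin_le_one _)
  have hint : ∀ (W : Ω → ℝ), Measurable W → ∫ ω, cexp ((s * W ω : ℝ) * I) ∂P =
      ((∫ ω, Real.cos (s * W ω) ∂P : ℝ) : ℂ) + ((∫ ω, Real.sin (s * W ω) ∂P : ℝ) : ℂ) * I := by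
    intro W hW
    simp_rw [hexp]
    rw [integral_add (ic W hW).ofReal ((is W hW).ofReal.mul_const _), integral_mul_const,
      integral_complex_ofReal, integral_complex_ofReal]
  have mc : ∀ (W : Ω → ℝ), Measurable W → MemLp (fun ω => Real.cos (s * W ω)) 2 P := fun W hW =>
    MemLp.of_bound (by fun_prop) 1 (ae_of_all _ fun ω => Real.abs_cos_le_one _)
  have ms : ∀ (W : Ω → ℝ), Measurable W → MemLp (fun ω => Real.sin (s * W ω)) 2 P := fun W hW =>
    MemLp.of_bound (by fun_prop) 1 (ae_of_all _ fun ω => Real.abs_sin_le_one _)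
  have hcc := covariance_eq_sub (mc U hU) (mc V hV)
  have hss := covariance_eq_sub (ms U hU) (ms V hV)
  have hcs := covariance_eq_sub (mc U hU) (ms V hV)
  have hsc := covariance_eq_sub (ms U hU) (mc V hV)
  have icc := (mc U hU).integrable_mul (mc V hV)
  have iss := (ms U hU).integrable_mul (ms V hV)
  have ics := (mc U hU).integrable_mul (ms V hV)
  have isc := (ms U hU).integrable_mul (mc V hV)
  have e1 : ∫ ω, Real.cos (s * (U ω + V ω)) ∂P =
      ∫ ω, ((fun ω => Real.cos (s * U ω)) * fun ω => Real.cos (s * V ω)) ω ∂P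
      - ∫ ω, ((fun ω => Real.sin (s * U ω)) * fun ω => Real.sin (s * V ω)) ω ∂P := by
    rw [← integral_sub icc iss]
    congr 1; ext ω; simp only [Pi.mul_apply]; rw [mul_add, Real.cos_add]
  have e2 : ∫ ω, Real.sin (s * (U ω + V ω)) ∂P =
      ∫ ω, ((fun ω => Real.sin (s * U ω)) * fun ω => Real.cos (s * V ω)) ω ∂P
      + ∫ ω, ((fun ω => Real.cos (s * U ω)) * fun ω => Real.sin (s * V ω)) ω ∂P := by
    rw [← integral_add isc ics]
    congr 1; ext ω; simp only [Pi.mul_apply]; rw [mul_add, Real.sin_add]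
  rw [hint (fun ω => U ω + V ω) (hU.add hV), hint U hU, hint V hV, e1, e2]
  have key : ((((∫ ω, ((fun ω => Real.cos (s * U ω)) * fun ω => Real.cos (s * V ω)) ω ∂P
      - ∫ ω, ((fun ω => Real.sin (s * U ω)) * fun ω => Real.sin (s * V ω)) ω ∂P : ℝ)) : ℂ)
      + ((∫ ω, ((fun ω => Real.sin (s * U ω)) * fun ω => Real.cos (s * V ω)) ω ∂P
      + ∫ ω, ((fun ω => Real.cos (s * U ω)) * fun ω => Real.sin (s * V ω)) ω ∂P : ℝ) : ℂ) * I)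
      - (((∫ ω, Real.cos (s * U ω) ∂P : ℝ) : ℂ) + ((∫ ω, Real.sin (s * U ω) ∂P : ℝ) : ℂ) * I)
        * (((∫ ω, Real.cos (s * V ω) ∂P : ℝ) : ℂ) + ((∫ ω, Real.sin (s * V ω) ∂P : ℝ) : ℂ) * I)
      = ((cov[fun ω => Real.cos (s * U ω), fun ω => Real.cos (s * V ω); P]
        - cov[fun ω => Real.sin (s * U ω), fun ω => Real.sin (s * V ω); P] : ℝ) : ℂ)
        + ((cov[fun ω => Real.sin (s * U ω), fun ω => Real.cos (s * V ω); P]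
        + cov[fun ω => Real.cos (s * U ω), fun ω => Real.sin (s * V ω); P] : ℝ) : ℂ) * I := by
    rw [hcc, hss, hcs, hsc]
    push_cast
    linear_combination (-((∫ ω, Real.sin (s * U ω) ∂P : ℝ) : ℂ) *
      ((∫ ω, Real.sin (s * V ω) ∂P : ℝ) : ℂ)) * I_sq
  rw [key]
  refine (norm_add_le _ _).trans ?_
  rw [norm_mul, norm_I, mul_one, Complex.norm_real, Complex.norm_real, Real.norm_eq_abs,
    Real.norm_eq_abs]
  have d1 := hD Real.cos (by simp) Real.cos (by simp)
  have d2 := hD Real.sin (by simp) Real.sin (by simp)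
  have d3 := hD Real.sin (by simp) Real.cos (by simp)
  have d4 := hD Real.cos (by simp) Real.sin (by simp)
  have := abs_sub (cov[fun ω => Real.cos (s * U ω), fun ω => Real.cos (s * V ω); P])
    (cov[fun ω => Real.sin (s * U ω), fun ω => Real.sin (s * V ω); P])
  have := abs_add_le (cov[fun ω => Real.sin (s * U ω), fun ω => Real.cos (s * V ω); P])
    (cov[fun ω => Real.cos (s * U ω), fun ω => Real.sin (s * V ω); P])
  linarith

/-- The `j`-th block `{j L + 1, …, j L + p}` of length `p`; consecutive blocks start `L` apart. -/
noncomputable def block (p L j : ℕ) : Finset ℤ := Finset.Ioc ((j * L : ℕ) : ℤ) ((j * L : ℕ) + p : ℤ)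

lemma card_block (p L j : ℕ) : (block p L j).card = p := by simp [block]

lemma sum_block (p L j : ℕ) (w : ℤ → ℝ) :
    ∑ i ∈ block p L j, w i = ∑ i ∈ Finset.Ioc (0 : ℤ) p, w (i + (j * L : ℕ)) := by
  rw [block, add_comm, show ((j * L : ℕ) : ℤ) = 0 + ((j * L : ℕ) : ℤ) by simp,
    ← add_assoc, add_zero, ← Finset.map_add_right_Ioc, Finset.sum_map]
  simp

lemma block_subset (p L j n : ℕ) (hj : j * L + p ≤ n) : block p L j ⊆ Finset.Ioc (0 : ℤ) n := by
  intro i hi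
  simp only [block, Finset.mem_Ioc] at hi ⊢
  constructor
  · exact lt_of_le_of_lt (by positivity) hi.1
  · exact hi.2.trans (by exact_mod_cast hj)

lemma pairwiseDisjoint_block {p L : ℕ} (hpL : p ≤ L) (s : Set ℕ) :
    s.PairwiseDisjoint (block p L) := by
  have key : ∀ i j : ℕ, i < j → Disjoint (block p L i) (block p L j) := by
    intro i j hij
    rw [Finset.disjoint_left]
    intro x hx hx'
    simp only [block, Finset.mem_Ioc] at hx hx'
    have h1 : i * L + p ≤ j * L := by nlinarith
    have h2 : ((i * L : ℕ) : ℤ) + p ≤ ((j * L : ℕ) : ℤ) := by exact_mod_cast h1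
    linarith [hx.2, hx'.1]
  intro i _ j _ hij
  rcases lt_or_gt_of_ne hij with h | h
  · exact key i j h
  · exact (key j i h).symm

/-- The union of the first `m` blocks. -/
noncomputable def blocks (p L m : ℕ) : Finset ℤ := (Finset.range m).biUnion (block p L)

lemma sum_blocks {p L : ℕ} (hpL : p ≤ L) (m : ℕ) (w : ℤ → ℝ) :
    ∑ i ∈ blocks p L m, w i = ∑ j ∈ Finset.range m, ∑ i ∈ block p L j, w i :=
  Finset.sum_biUnion (pairwiseDisjoint_block hpL _)

lemma card_blocks {p L : ℕ} (hpL : p ≤ L) (m : ℕ) : (blocks p L m).card = m * p := by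
  rw [blocks, Finset.card_biUnion fun i _ j _ hij =>
    pairwiseDisjoint_block hpL Set.univ (Set.mem_univ i) (Set.mem_univ j) hij]
  simp [card_block]

lemma abs_sin_mul_sub_le (s x y : ℝ) : |Real.sin (s * x) - Real.sin (s * y)| ≤ |s| * |x - y| := by
  rw [← abs_mul, mul_sub]
  have := Real.lipschitzWith_sin.dist_le_mul (s * x) (s * y)
  simpa [Real.dist_eq] using this

lemma abs_cos_mul_sub_le (s x y : ℝ) : |Real.cos (s * x) - Real.cos (s * y)| ≤ |s| * |x - y| := by
  rw [← abs_mul, mul_sub]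
  have := Real.lipschitzWith_cos.dist_le_mul (s * x) (s * y)
  simpa [Real.dist_eq] using this

open Complex in
lemma norm_integral_exp_le_one (Z : Ω → ℝ) : ‖∫ ω, cexp ((Z ω : ℝ) * I) ∂P‖ ≤ 1 := by
  refine (norm_integral_le_of_norm_le_const (C := 1) (ae_of_all _ fun ω => ?_)).trans (by simp)
  rw [Complex.norm_exp_ofReal_mul_I]

open Complex in
/-- The characteristic function of the sum over `m` blocks, separated by gaps of length `q`, is
close to the `m`-th power of the characteristic function of one block. -/
lemma PolyWeakDep.norm_integral_exp_blocks_sub_le (hmeas : ∀ t, Measurable (X t))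
    (hstat : IsStationary P X) {β K θ : ℝ} (hβ : 0 ≤ β) (hK : 0 ≤ K)
    (hw : PolyWeakDep P X β K θ) {ψ : ℝ → ℝ} (hψ : ∀ x y, |ψ x - ψ y| ≤ |x - y|)
    (hψm : Measurable ψ) {p q n : ℕ} (hp : 1 ≤ p) (s : ℝ) (m : ℕ) (hm : m * (p + q) ≤ n) :
    ‖∫ ω, cexp ((s * ∑ j ∈ Finset.range m, ∑ i ∈ block p (p + q) j, ψ (X i ω) : ℝ) * I) ∂P
      - (∫ ω, cexp ((s * ∑ i ∈ block p (p + q) 0, ψ (X i ω) : ℝ) * I) ∂P) ^ m‖ ≤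
      m * (4 * ((n * p * s ^ 2 + β * ((n + p) * |s|)) * (K * (1 + q : ℝ) ^ (-θ)))) := by
  set D := (n * p * s ^ 2 + β * ((n + p) * |s|)) * (K * (1 + q : ℝ) ^ (-θ)) with hD
  have hD0 : 0 ≤ D := by positivity
  set φ := ∫ ω, cexp ((s * ∑ i ∈ block p (p + q) 0, ψ (X i ω) : ℝ) * I) ∂P with hφ
  have hsm : ∀ C : Finset ℤ, Measurable fun ω => ∑ i ∈ C, ψ (X i ω) := fun C =>
    Finset.measurable_sum _ fun i _ => hψm.comp (hmeas i)
  have hφj : ∀ j, ∫ ω, cexp ((s * ∑ i ∈ block p (p + q) j, ψ (X i ω) : ℝ) * I) ∂P = φ := by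
    intro j
    have hG : Measurable fun x : ℤ → ℝ =>
        cexp ((s * ∑ i ∈ Finset.Ioc (0 : ℤ) p, ψ (x i) : ℝ) * I) := by
      have : Measurable fun x : ℤ → ℝ => ∑ i ∈ Finset.Ioc (0 : ℤ) p, ψ (x i) :=
        Finset.measurable_sum _ fun i _ => hψm.comp (measurable_pi_apply i)
      fun_prop
    have h := fun j : ℕ => hstat.integral_shift ((j * (p + q) : ℕ) : ℤ) hG
    simp_rw [hφ, sum_block, h]
  -- the last block is split off; it lies at distance at least `q` from all the previous ones
  induction m with
  | zero => simp
  | succ m ih =>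
    have ih' := ih (by nlinarith)
    simp_rw [Finset.sum_range_succ]
    set SA : Ω → ℝ := fun ω => ∑ j ∈ Finset.range m, ∑ i ∈ block p (p + q) j, ψ (X i ω) with hSA
    set SB : Ω → ℝ := fun ω => ∑ i ∈ block p (p + q) m, ψ (X i ω) with hSB
    have hSAm : Measurable SA := Finset.measurable_sum _ fun j _ => hsm _
    have hpair : ‖∫ ω, cexp ((s * (SA ω + SB ω) : ℝ) * I) ∂P
        - (∫ ω, cexp ((s * SA ω : ℝ) * I) ∂P) * ∫ ω, cexp ((s * SB ω : ℝ) * I) ∂P‖ ≤ 4 * D := by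
      rcases Nat.eq_zero_or_pos m with rfl | hm0
      · simp [hSA, hD0]
      refine norm_integral_exp_add_sub_le hSAm (hsm _) s D ?_
      -- weak dependence is applied to the two sums as functions of all `m p` and `p` variables
      have hSAe : ∀ ω, SA ω = ∑ i ∈ blocks p (p + q) m, ψ (X i ω) := fun ω =>
        (sum_blocks (by omega) m _).symm
      intro f hf g hg
      have hf' : (∀ x, |f x| ≤ 1) ∧ ∀ x y, |f (s * x) - f (s * y)| ≤ |s| * |x - y| := by
        rcases hf with rfl | rfl
        · exact ⟨Real.abs_sin_le_one, abs_sin_mul_sub_le s⟩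
        · exact ⟨Real.abs_cos_le_one, abs_cos_mul_sub_le s⟩
      have hg' : (∀ x, |g x| ≤ 1) ∧ ∀ x y, |g (s * x) - g (s * y)| ≤ |s| * |x - y| := by
        rcases hg with rfl | rfl
        · exact ⟨Real.abs_sin_le_one, abs_sin_mul_sub_le s⟩
        · exact ⟨Real.abs_cos_le_one, abs_cos_mul_sub_le s⟩
      have hcA := card_blocks (show p ≤ p + q by omega) m
      have hcB := card_block p (p + q) m
      simp_rw [hSAe]
      refine (hw.cov_sum_le (r := q) (A := blocks p (p + q) m) (B := block p (p + q) m)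
        (Finset.card_pos.1 (by rw [hcA]; positivity)) (Finset.card_pos.1 (by rw [hcB]; omega)) ?_ hψ
        (F := fun x => f (s * x)) (G := fun x => g (s * x)) (fun x => hf'.1 _) (fun x => hg'.1 _)
        (abs_nonneg s) (abs_nonneg s) hf'.2 hg'.2).trans ?_
      · intro a ha b hb
        simp only [blocks, Finset.mem_biUnion, Finset.mem_range] at ha
        obtain ⟨j, hj, hja⟩ := ha
        simp only [block, Finset.mem_Ioc] at hja hb
        have h1 : j * (p + q) + p + q ≤ m * (p + q) := by nlinarith
        have h2 : ((j * (p + q) : ℕ) : ℤ) + p + q ≤ ((m * (p + q) : ℕ) : ℤ) := by exact_mod_cast h1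
        linarith [hja.2, hb.1]
      · rw [hcA, hcB, hD]
        have h1 : ((m * p : ℕ) : ℝ) ≤ n := by
          exact_mod_cast (by nlinarith : m * p ≤ n)
        have h2 : (((m * p : ℕ) : ℝ) * p * |s| * |s|) ≤ n * p * s ^ 2 := by
          rw [mul_assoc _ |s|, ← sq, sq_abs]; gcongr
        have h3 : ((m * p : ℕ) : ℝ) * |s| + p * |s| ≤ (n + p) * |s| := by
          rw [← add_mul]; gcongr
        gcongr
    have e : ∫ ω, cexp ((s * (SA ω + SB ω) : ℝ) * I) ∂P - φ ^ (m + 1) =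
        (∫ ω, cexp ((s * (SA ω + SB ω) : ℝ) * I) ∂P
        - (∫ ω, cexp ((s * SA ω : ℝ) * I) ∂P) * ∫ ω, cexp ((s * SB ω : ℝ) * I) ∂P)
        + (∫ ω, cexp ((s * SA ω : ℝ) * I) ∂P - φ ^ m) * φ := by
      rw [hφj m]; ring
    rw [e]
    refine (norm_add_le _ _).trans ?_
    rw [norm_mul]
    have h1 : ‖∫ ω, cexp ((s * SA ω : ℝ) * I) ∂P - φ ^ m‖ * ‖φ‖ ≤ m * (4 * D) * 1 := by
      have := norm_integral_exp_le_one (P := P) fun ω => s * ∑ i ∈ block p (p + q) 0, ψ (X i ω)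
      gcongr
    rw [Nat.cast_succ]
    linarith

end Blocks

end WeakDep

/-! ### Covariances of contractions of the process -/

namespace WeakDep

/-- A `1`-Lipschitz function on the line that fixes the origin. -/
structure IsContr (ψ : ℝ → ℝ) : Prop where
  zero : ψ 0 = 0
  lip : ∀ x y, |ψ x - ψ y| ≤ |x - y|

lemma IsContr.abs_le {ψ : ℝ → ℝ} (h : IsContr ψ) (x : ℝ) : |ψ x| ≤ |x| := by
  simpa [h.zero] using h.lip x 0

lemma IsContr.measurable {ψ : ℝ → ℝ} (h : IsContr ψ) : Measurable ψ := by
  have : LipschitzWith 1 ψ := LipschitzWith.of_dist_le_mul fun x y => by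
    simpa [Real.dist_eq] using h.lip x y
  exact this.continuous.measurable

lemma isContr_id : IsContr fun x => x := ⟨rfl, fun _ _ => le_rfl⟩

/-- Truncation of a real number at the levels `±M`. -/
noncomputable def clip (M x : ℝ) : ℝ := max (-M) (min x M)

lemma abs_clip_le {M : ℝ} (hM : 0 ≤ M) (x : ℝ) : |clip M x| ≤ M := by
  rw [abs_le]
  exact ⟨le_max_left _ _, max_le (by linarith) (min_le_right _ _)⟩

lemma clip_eq_self {M x : ℝ} (hx : |x| ≤ M) : clip M x = x := by
  rw [abs_le] at hx
  rw [clip, min_eq_left hx.2, max_eq_right hx.1]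

lemma clip_sub_mem {M x y : ℝ} (hxy : x ≤ y) :
    0 ≤ clip M y - clip M x ∧ clip M y - clip M x ≤ y - x := by
  unfold clip
  constructor
  · have : min x M ≤ min y M := min_le_min_right _ hxy
    linarith [max_le_max_left (-M) this]
  · rcases le_total x M with h1 | h1 <;> rcases le_total y M with h2 | h2 <;>
      rcases le_total (-M) x with h3 | h3 <;> rcases le_total (-M) y with h4 | h4 <;>
      rcases le_total (-M) M with h5 | h5 <;> simp [h1, h2, h3, h4, h5] <;> linarith

lemma isContr_clip {M : ℝ} (hM : 0 ≤ M) : IsContr (clip M) := by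
  refine ⟨clip_eq_self (by simpa using hM), fun x y => ?_⟩
  wlog h : y ≤ x generalizing x y
  · rw [abs_sub_comm, abs_sub_comm x]; exact this y x (le_of_not_ge h)
  have := clip_sub_mem (M := M) h
  rw [abs_of_nonneg this.1, abs_of_nonneg (by linarith)]; exact this.2

lemma isContr_sub_clip {M : ℝ} (hM : 0 ≤ M) : IsContr fun x => x - clip M x := by
  refine ⟨by simp [(isContr_clip hM).zero], fun x y => ?_⟩
  wlog h : y ≤ x generalizing x y
  · rw [abs_sub_comm, abs_sub_comm x]; exact this y x (le_of_not_ge h)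
  have := clip_sub_mem (M := M) h
  rw [abs_of_nonneg (by linarith), abs_of_nonneg (by linarith)]; linarith

lemma IsContr.comp {ψ χ : ℝ → ℝ} (h : IsContr ψ) (h' : IsContr χ) : IsContr fun x => ψ (χ x) :=
  ⟨by rw [h'.zero, h.zero], fun x y => (h.lip _ _).trans (h'.lip _ _)⟩

/-- The remainder vanishes unless `|x| > M`, and then `(max |x| |y| / M) ^ ζ ≥ 1` may be inserted. -/
lemma abs_sub_clip_mul_le {M ζ : ℝ} (hM : 0 < M) (hζ : 0 < ζ) (x y : ℝ) :
    |x - clip M x| * |y| ≤ M ^ (-ζ) * (|x| ^ (2 + ζ) + |y| ^ (2 + ζ)) := by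
  rcases le_or_gt |x| M with h | h
  · rw [clip_eq_self h, sub_self, abs_zero, zero_mul]; positivity
  · have h1 : |x - clip M x| ≤ |x| := (isContr_sub_clip hM.le).abs_le x
    have hx : 0 < |x| := hM.trans h
    set m := max |x| |y| with hm
    have hm0 : 0 < m := lt_max_of_lt_left hx
    have h2 : 1 ≤ M ^ (-ζ) * m ^ ζ := by
      rw [Real.rpow_neg hM.le, mul_comm, ← div_eq_mul_inv, ← Real.div_rpow hm0.le hM.le]
      apply Real.one_le_rpow _ hζ.le
      rw [one_le_div hM]; exact h.le.trans (le_max_left _ _)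
    have h3 : m ^ (2 + ζ) ≤ |x| ^ (2 + ζ) + |y| ^ (2 + ζ) := by
      rcases max_cases |x| |y| with ⟨h, -⟩ | ⟨h, -⟩
      · rw [hm, h]; linarith [Real.rpow_nonneg (abs_nonneg y) (2 + ζ)]
      · rw [hm, h]; linarith [Real.rpow_nonneg (abs_nonneg x) (2 + ζ)]
    calc |x - clip M x| * |y| ≤ m * m := by
          gcongr
          · exact h1.trans (le_max_left _ _)
          · exact le_max_right _ _
      _ = m ^ (2 : ℝ) * 1 := by rw [Real.rpow_two]; ring
      _ ≤ m ^ (2 : ℝ) * (M ^ (-ζ) * m ^ ζ) := by gcongr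
      _ = M ^ (-ζ) * m ^ (2 + ζ) := by rw [Real.rpow_add hm0]; ring
      _ ≤ _ := by gcongr

/-- The standing assumptions on the process: strict stationarity, mean zero and a finite moment of
order `2 + ζ`. -/
structure StationaryMoment {Ω : Type*} [MeasurableSpace Ω] (P : Measure Ω) (X : ℤ → Ω → ℝ)
    (ζ : ℝ) : Prop where
  meas : ∀ t, Measurable (X t)
  stat : IsStationary P X
  mean : ∫ ω, X 0 ω ∂P = 0
  pos : 0 < ζ
  mom : Integrable (fun ω => |X 0 ω| ^ (2 + ζ)) P

section

variable {Ω : Type*} [MeasurableSpace Ω] {P : Measure Ω} {X : ℤ → Ω → ℝ} {ζ : ℝ}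

namespace StationaryMoment

lemma identDistrib (h : StationaryMoment P X ζ) (t : ℤ) : IdentDistrib (X t) (X 0) P P := by
  have := (h.stat t).comp (measurable_pi_apply (0 : ℤ))
  simpa [Function.comp_def] using this

lemma integrable_rpow (h : StationaryMoment P X ζ) (t : ℤ) :
    Integrable (fun ω => |X t ω| ^ (2 + ζ)) P :=
  ((h.identDistrib t).comp (u := fun x => |x| ^ (2 + ζ)) (by fun_prop)).integrable_iff.2 h.mom

lemma integral_rpow (h : StationaryMoment P X ζ) (t : ℤ) :
    ∫ ω, |X t ω| ^ (2 + ζ) ∂P = ∫ ω, |X 0 ω| ^ (2 + ζ) ∂P :=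
  ((h.identDistrib t).comp (u := fun x => |x| ^ (2 + ζ)) (by fun_prop)).integral_eq

lemma integral_comp_eq (h : StationaryMoment P X ζ) {ψ : ℝ → ℝ} (hψ : Measurable ψ) (t : ℤ) :
    ∫ ω, ψ (X t ω) ∂P = ∫ ω, ψ (X 0 ω) ∂P :=
  ((h.identDistrib t).comp hψ).integral_eq

lemma cov_shift (h : StationaryMoment P X ζ) {ψ : ℝ → ℝ} (hψ : Measurable ψ) (i j : ℤ) :
    cov[fun ω => ψ (X i ω), fun ω => ψ (X j ω); P]
      = cov[fun ω => ψ (X 0 ω), fun ω => ψ (X (j - i) ω); P] := by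
  unfold covariance
  rw [h.integral_comp_eq hψ i, h.integral_comp_eq hψ j, h.integral_comp_eq hψ (j - i)]
  set m := ∫ ω, ψ (X 0 ω) ∂P
  have := h.stat.integral_shift (P := P) i
    (G := fun x : ℤ → ℝ => (ψ (x 0) - m) * (ψ (x (j - i)) - m)) (by fun_prop)
  simpa using this

variable [IsProbabilityMeasure P]

lemma memLp (h : StationaryMoment P X ζ) (t : ℤ) : MemLp (X t) 2 P := by
  rw [memLp_two_iff_integrable_sq (h.meas t).aestronglyMeasurable]
  refine ((integrable_const (1 : ℝ)).add (h.integrable_rpow t)).mono'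
    ((h.meas t).pow_const 2).aestronglyMeasurable (ae_of_all _ fun ω => ?_)
  have hz := h.pos
  rw [Real.norm_of_nonneg (sq_nonneg _), ← sq_abs, Pi.add_apply]
  rcases le_total |X t ω| 1 with h1 | h1
  · have : |X t ω| ^ 2 ≤ 1 := pow_le_one₀ (abs_nonneg _) h1
    linarith [Real.rpow_nonneg (abs_nonneg (X t ω)) (2 + ζ)]
  · have : |X t ω| ^ (2 : ℝ) ≤ |X t ω| ^ (2 + ζ) :=
      Real.rpow_le_rpow_of_exponent_le h1 (by linarith)
    rw [Real.rpow_two] at this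
    linarith

lemma memLp_comp (h : StationaryMoment P X ζ) {ψ : ℝ → ℝ} (hψ : IsContr ψ) (t : ℤ) :
    MemLp (fun ω => ψ (X t ω)) 2 P :=
  (h.memLp t).mono (hψ.measurable.comp (h.meas t)).aestronglyMeasurable
    (ae_of_all _ fun _ => hψ.abs_le _)

/-- Covariance of a truncation remainder with another contraction. -/
lemma abs_cov_sub_clip_le (h : StationaryMoment P X ζ) {M : ℝ} (hM : 1 ≤ M) {ψ χ : ℝ → ℝ}
    (hψ : IsContr ψ) (hχ : IsContr χ) (i j : ℤ) :
    |cov[fun ω => ψ (X i ω) - clip M (ψ (X i ω)), fun ω => χ (X j ω); P]| ≤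
      (2 * (∫ ω, |X 0 ω| ^ (2 + ζ) ∂P) + (∫ ω, |X 0 ω| ^ (2 + ζ) ∂P) *
        (1 + ∫ ω, |X 0 ω| ^ (2 + ζ) ∂P)) * M ^ (-ζ) := by
  set m := ∫ ω, |X 0 ω| ^ (2 + ζ) ∂P with hm
  have hz := h.pos
  have hM0 : 0 < M := by linarith
  have hm0 : 0 ≤ m := integral_nonneg fun ω => by positivity
  have hτ : IsContr fun x => ψ x - clip M (ψ x) := (isContr_sub_clip hM0.le).comp hψ
  have L1 := h.memLp_comp hτ i
  have L2 := h.memLp_comp hχ j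
  have hpt : ∀ x y : ℝ, |ψ x - clip M (ψ x)| * |y| ≤
      M ^ (-ζ) * (|x| ^ (2 + ζ) + |y| ^ (2 + ζ)) := fun x y =>
    (abs_sub_clip_mul_le hM0 hz (ψ x) y).trans (by
      have := hψ.abs_le x
      gcongr)
  rw [covariance_eq_sub L1 L2]
  have b1 : |∫ ω, ((fun ω => ψ (X i ω) - clip M (ψ (X i ω))) * fun ω => χ (X j ω)) ω ∂P| ≤
      M ^ (-ζ) * (2 * m) := by
    refine (abs_integral_le_integral_abs).trans ?_
    have e : M ^ (-ζ) * (2 * m) =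
        ∫ ω, M ^ (-ζ) * (|X i ω| ^ (2 + ζ) + |X j ω| ^ (2 + ζ)) ∂P := by
      rw [integral_const_mul, integral_add (h.integrable_rpow i) (h.integrable_rpow j),
        h.integral_rpow i, h.integral_rpow j]; ring
    rw [e]
    refine integral_mono (L1.integrable_mul L2).abs
      (((h.integrable_rpow i).add (h.integrable_rpow j)).const_mul _) fun ω => ?_
    simp only [Pi.mul_apply]
    rw [abs_mul]
    exact (mul_le_mul_of_nonneg_left (hχ.abs_le _) (abs_nonneg _)).trans (hpt _ _)
  have b2 : |∫ ω, (ψ (X i ω) - clip M (ψ (X i ω))) ∂P| ≤ M ^ (-ζ) * m := by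
    refine (abs_integral_le_integral_abs).trans ?_
    rw [hm, ← h.integral_rpow i, ← integral_const_mul]
    refine integral_mono (L1.integrable (by norm_num)).abs
      ((h.integrable_rpow i).const_mul _) fun ω => ?_
    simp only
    rcases le_or_gt |ψ (X i ω)| M with h' | h'
    · rw [clip_eq_self h', sub_self, abs_zero]; positivity
    · have hx : 1 ≤ |X i ω| := (hM.trans h'.le).trans (hψ.abs_le _)
      have hx0 : 0 < |X i ω| := by linarith
      have a1 : 1 ≤ M ^ (-ζ) * |X i ω| ^ ζ := by
        rw [Real.rpow_neg hM0.le, mul_comm, ← div_eq_mul_inv, ← Real.div_rpow hx0.le hM0.le]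
        apply Real.one_le_rpow _ hz.le
        rw [one_le_div hM0]; exact h'.le.trans (hψ.abs_le _)
      calc |ψ (X i ω) - clip M (ψ (X i ω))| ≤ |X i ω| := hτ.abs_le _
        _ ≤ |X i ω| ^ 2 := by nlinarith
        _ ≤ |X i ω| ^ (2 : ℝ) * (M ^ (-ζ) * |X i ω| ^ ζ) := by
            rw [Real.rpow_two]; exact le_mul_of_one_le_right (by positivity) a1
        _ = M ^ (-ζ) * |X i ω| ^ (2 + ζ) := by rw [Real.rpow_add hx0]; ring
  have b3 : |∫ ω, χ (X j ω) ∂P| ≤ 1 + m := by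
    refine (abs_integral_le_integral_abs).trans ?_
    have e : 1 + m = ∫ ω, (1 + |X j ω| ^ (2 + ζ)) ∂P := by
      rw [integral_add (integrable_const _) (h.integrable_rpow j), h.integral_rpow j]; simp [hm]
    rw [e]
    refine integral_mono (L2.integrable (by norm_num)).abs
      ((integrable_const _).add (h.integrable_rpow j)) fun ω => ?_
    simp only
    refine (hχ.abs_le _).trans ?_
    rcases le_total |X j ω| 1 with h1 | h1
    · linarith [Real.rpow_nonneg (abs_nonneg (X j ω)) (2 + ζ)]
    · have : |X j ω| ^ (1 : ℝ) ≤ |X j ω| ^ (2 + ζ) :=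
        Real.rpow_le_rpow_of_exponent_le h1 (by linarith)
      rw [Real.rpow_one] at this
      linarith
  refine (abs_sub _ _).trans ?_
  rw [abs_mul]
  have b4 := mul_le_mul b2 b3 (abs_nonneg _) (by positivity)
  calc _ ≤ M ^ (-ζ) * (2 * m) + M ^ (-ζ) * m * (1 + m) := add_le_add b1 b4
    _ = _ := by ring

/-- Covariance of a contraction of the process at lag `k`, with the level `M` of the truncation
still free. -/
lemma abs_cov_le_of_level (h : StationaryMoment P X ζ) {β K θ : ℝ} (hw : PolyWeakDep P X β K θ)
    {M : ℝ} (hM : 1 ≤ M) {ψ : ℝ → ℝ} (hψ : IsContr ψ) (k : ℕ) :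
    |cov[fun ω => ψ (X 0 ω), fun ω => ψ (X k ω); P]| ≤
      (1 + 2 * β * M) * (K * (1 + k : ℝ) ^ (-θ)) +
      2 * (2 * (∫ ω, |X 0 ω| ^ (2 + ζ) ∂P) + (∫ ω, |X 0 ω| ^ (2 + ζ) ∂P) *
        (1 + ∫ ω, |X 0 ω| ^ (2 + ζ) ∂P)) * M ^ (-ζ) := by
  have hM0 : 0 < M := by linarith
  have hc : IsContr fun x => clip M (ψ x) := (isContr_clip hM0.le).comp hψ
  have ht : IsContr fun x => ψ x - clip M (ψ x) := (isContr_sub_clip hM0.le).comp hψ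
  have c1 := h.abs_cov_sub_clip_le hM hψ hψ 0 k
  have c2 := h.abs_cov_sub_clip_le hM hψ hc k 0
  -- both factors are truncated, one after the other
  have e1 : cov[fun ω => ψ (X 0 ω), fun ω => ψ (X k ω); P] =
      cov[fun ω => ψ (X 0 ω) - clip M (ψ (X 0 ω)), fun ω => ψ (X k ω); P]
      + cov[fun ω => ψ (X k ω) - clip M (ψ (X k ω)), fun ω => clip M (ψ (X 0 ω)); P]
      + cov[fun ω => clip M (ψ (X 0 ω)), fun ω => clip M (ψ (X k ω)); P] := by
    rw [covariance_fun_sub_left (h.memLp_comp hψ 0) (h.memLp_comp hc 0) (h.memLp_comp hψ k),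
      covariance_fun_sub_left (h.memLp_comp hψ k) (h.memLp_comp hc k) (h.memLp_comp hc 0),
      covariance_comm (fun ω => ψ (X k ω)), covariance_comm (fun ω => clip M (ψ (X k ω)))]
    ring
  have c3 : |cov[fun ω => clip M (ψ (X 0 ω)), fun ω => clip M (ψ (X k ω)); P]| ≤
      (1 + 2 * β * M) * (K * (1 + k : ℝ) ^ (-θ)) := by
    have hF1 : ∀ x, |clip M x / M| ≤ 1 := fun x => by
      rw [abs_div, abs_of_pos hM0, div_le_one hM0]; exact abs_clip_le hM0.le x
    have hF2 : ∀ x y, |clip M x / M - clip M y / M| ≤ 1 / M * |x - y| := fun x y => by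
      rw [← sub_div, abs_div, abs_of_pos hM0, div_eq_mul_one_div, mul_comm]
      exact mul_le_mul_of_nonneg_left ((isContr_clip hM0.le).lip x y) (by positivity)
    -- after division by `M` the truncations are bounded by `1` and `1 / M`-Lipschitz
    have := hw.cov_sum_le (r := k) (A := {0}) (B := {(k : ℤ)}) (by simp) (by simp) (by simp)
      hψ.lip hF1 hF1 (by positivity) (by positivity) hF2 hF2
    simp only [Finset.sum_singleton, Finset.card_singleton, Nat.cast_one] at this
    rw [covariance_fun_div_left, covariance_fun_div_right, div_div, abs_div,
      abs_of_pos (by positivity : 0 < M * M), div_le_iff₀ (by positivity)] at this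
    refine this.trans (le_of_eq ?_)
    field_simp
    ring
  rw [e1]
  refine (abs_add_three _ _ _).trans ?_
  linarith

/-- Polynomial decay of the covariances, uniformly over all contractions of the process. The
truncation level at lag `k` is `(1 + k) ^ e`. -/
lemma exists_abs_cov_le (h : StationaryMoment P X ζ) {β K θ θ' e : ℝ} (hβ : 0 ≤ β) (hK : 0 ≤ K)
    (hw : PolyWeakDep P X β K θ) (he : 0 ≤ e) (h1 : θ' ≤ e * ζ) (h2 : θ' ≤ θ)
    (h3 : β = 0 ∨ θ' ≤ θ - e) :
    ∃ C, 0 < C ∧ ∀ ψ : ℝ → ℝ, IsContr ψ → ∀ i j : ℤ,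
      |cov[fun ω => ψ (X i ω), fun ω => ψ (X j ω); P]| ≤ C * (1 + |((j - i : ℤ) : ℝ)|) ^ (-θ') := by
  set m := ∫ ω, |X 0 ω| ^ (2 + ζ) ∂P with hm
  have hm0 : 0 ≤ m := integral_nonneg fun ω => by positivity
  set C := (1 + 2 * β) * K + 2 * (2 * m + m * (1 + m)) + 1 with hC
  have hC0 : 0 < C := by positivity
  have key : ∀ ψ : ℝ → ℝ, IsContr ψ → ∀ k : ℕ,
      |cov[fun ω => ψ (X 0 ω), fun ω => ψ (X k ω); P]| ≤ C * (1 + k : ℝ) ^ (-θ') := by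
    intro ψ hψ k
    have hk1 : (1 : ℝ) ≤ 1 + k := by simp
    have hk0 : (0 : ℝ) < 1 + k := by linarith
    have hM : 1 ≤ (1 + k : ℝ) ^ e := Real.one_le_rpow hk1 he
    refine (h.abs_cov_le_of_level hw hM hψ k).trans ?_
    have a1 : (1 + k : ℝ) ^ (-θ) ≤ (1 + k : ℝ) ^ (-θ') :=
      Real.rpow_le_rpow_of_exponent_le hk1 (by linarith)
    have a2 : ((1 + k : ℝ) ^ e) ^ (-ζ) ≤ (1 + k : ℝ) ^ (-θ') := by
      rw [← Real.rpow_mul hk0.le]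
      exact Real.rpow_le_rpow_of_exponent_le hk1 (by linarith)
    have a3 : β * ((1 + k : ℝ) ^ e * (1 + k : ℝ) ^ (-θ)) ≤ β * (1 + k : ℝ) ^ (-θ') := by
      rcases h3 with h3 | h3
      · simp [h3]
      · rw [← Real.rpow_add hk0]
        exact mul_le_mul_of_nonneg_left
          (Real.rpow_le_rpow_of_exponent_le hk1 (by linarith)) hβ
    set y := (1 + k : ℝ) ^ (-θ') with hy
    have hy0 : 0 ≤ y := by positivity
    calc (1 + 2 * β * (1 + k : ℝ) ^ e) * (K * (1 + k : ℝ) ^ (-θ)) +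
          2 * (2 * m + m * (1 + m)) * ((1 + k : ℝ) ^ e) ^ (-ζ)
        = K * (1 + k : ℝ) ^ (-θ) + 2 * K * (β * ((1 + k : ℝ) ^ e * (1 + k : ℝ) ^ (-θ)))
          + 2 * (2 * m + m * (1 + m)) * ((1 + k : ℝ) ^ e) ^ (-ζ) := by ring
      _ ≤ K * y + 2 * K * (β * y) + 2 * (2 * m + m * (1 + m)) * y := by gcongr
      _ ≤ C * y := by rw [hC]; linarith
  refine ⟨C, hC0, fun ψ hψ i j => ?_⟩
  wlog hij : i ≤ j generalizing i j
  · have := this j i (le_of_not_ge hij)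
    rw [covariance_comm, ← neg_sub j i, Int.cast_neg, abs_neg] at this
    exact this
  rw [h.cov_shift hψ.measurable]
  obtain ⟨k, hk⟩ := Int.eq_ofNat_of_zero_le (sub_nonneg.2 hij)
  rw [hk]
  have := key ψ hψ k
  simpa using this

end StationaryMoment

end

end WeakDep

/-! ### Variances of partial sums -/

namespace WeakDep

lemma summable_one_add_abs_rpow {s : ℝ} (hs : 1 < s) :
    Summable fun k : ℤ => (1 + |(k : ℝ)|) ^ (-s) := by
  have h1 : Summable fun n : ℕ => ((n + 1 : ℕ) : ℝ) ^ (-s) :=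
    (summable_nat_add_iff 1).2 (Real.summable_nat_rpow.2 (by linarith))
  refine summable_int_iff_summable_nat_and_neg.2 ⟨?_, ?_⟩ <;>
  · refine h1.congr fun n => ?_
    push_cast
    simp [add_comm]

lemma sum_sub_le_tsum {g : ℤ → ℝ} (hg0 : ∀ k, 0 ≤ g k) (hg : Summable g) (A : Finset ℤ) (i : ℤ) :
    ∑ j ∈ A, g (j - i) ≤ ∑' k, g k := by
  have : ∑ j ∈ A, g (j - i) = ∑ k ∈ A.map (Equiv.subRight i).toEmbedding, g k := by
    rw [Finset.sum_map]; rfl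
  rw [this]
  exact hg.sum_le_tsum _ fun k _ => hg0 k

lemma summable_cov {Ω : Type*} [MeasurableSpace Ω] {P : Measure Ω} {X : ℤ → Ω → ℝ} {C θ' : ℝ}
    (hcov : ∀ ψ : ℝ → ℝ, IsContr ψ → ∀ i j : ℤ,
      |cov[fun ω => ψ (X i ω), fun ω => ψ (X j ω); P]| ≤ C * (1 + |((j - i : ℤ) : ℝ)|) ^ (-θ'))
    (hθ' : 1 < θ') : Summable fun k : ℤ => cov[X 0, X k; P] := by
  refine Summable.of_norm_bounded ((summable_one_add_abs_rpow hθ').mul_left C) fun k => ?_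
  have := hcov _ isContr_id 0 k
  rwa [sub_zero] at this

section

variable {Ω : Type*} [MeasurableSpace Ω] {P : Measure Ω} [IsProbabilityMeasure P]
  {X : ℤ → Ω → ℝ} {ζ : ℝ}

namespace StationaryMoment

lemma variance_sum_eq (h : StationaryMoment P X ζ) {ψ : ℝ → ℝ} (hψ : IsContr ψ) (A : Finset ℤ) :
    Var[fun ω => ∑ i ∈ A, ψ (X i ω); P] =
      ∑ i ∈ A, ∑ j ∈ A, cov[fun ω => ψ (X i ω), fun ω => ψ (X j ω); P] := by
  rw [← covariance_self, covariance_fun_sum_fun_sum' (fun i _ => h.memLp_comp hψ i)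
    (fun i _ => h.memLp_comp hψ i)]
  exact (Finset.measurable_sum _ fun i _ => hψ.measurable.comp (h.meas i)).aemeasurable

lemma variance_sum_le (h : StationaryMoment P X ζ) {ψ : ℝ → ℝ} (hψ : IsContr ψ) {g : ℤ → ℝ}
    (hg : Summable g)
    (hcov : ∀ i j, |cov[fun ω => ψ (X i ω), fun ω => ψ (X j ω); P]| ≤ g (j - i)) (A : Finset ℤ) :
    Var[fun ω => ∑ i ∈ A, ψ (X i ω); P] ≤ A.card * ∑' k, g k := by
  have hg0 : ∀ k, 0 ≤ g k := fun k => by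
    simpa using (abs_nonneg _).trans (hcov 0 k)
  rw [h.variance_sum_eq hψ, ← nsmul_eq_mul]
  refine Finset.sum_le_card_nsmul _ _ _ fun i _ => ?_
  exact (Finset.sum_le_sum fun j _ => (le_abs_self _).trans (hcov i j)).trans
    (sum_sub_le_tsum hg0 hg A i)

/-- The truncation remainder contributes a small variance. The two available bounds on a
covariance, by the lag and by the truncation level, are interpolated with weights `s` and
`1 - s`. -/
lemma exists_variance_sum_sub_clip_le (h : StationaryMoment P X ζ) {C θ' s : ℝ} (hC : 0 ≤ C)
    (hcov : ∀ ψ : ℝ → ℝ, IsContr ψ → ∀ i j : ℤ,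
      |cov[fun ω => ψ (X i ω), fun ω => ψ (X j ω); P]| ≤ C * (1 + |((j - i : ℤ) : ℝ)|) ^ (-θ'))
    (hs0 : 0 < s) (hs1 : s < 1) (hs : 1 < s * θ') :
    ∃ C', 0 ≤ C' ∧ ∀ T : ℝ, 1 ≤ T → ∀ A : Finset ℤ,
      Var[fun ω => ∑ i ∈ A, (X i ω - clip T (X i ω)); P] ≤ C' * A.card * T ^ (-(ζ * (1 - s))) := by
  set m := ∫ ω, |X 0 ω| ^ (2 + ζ) ∂P with hm
  have hm0 : 0 ≤ m := integral_nonneg fun ω => by positivity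
  set D := 2 * m + m * (1 + m) with hD
  have hD0 : 0 ≤ D := by positivity
  have hsum := summable_one_add_abs_rpow hs
  refine ⟨C ^ s * D ^ (1 - s) * ∑' k : ℤ, (1 + |(k : ℝ)|) ^ (-(s * θ')), mul_nonneg (by positivity)
    (tsum_nonneg fun k => by positivity), fun T hT A => ?_⟩
  have hT0 : 0 < T := by linarith
  have hψ := isContr_sub_clip hT0.le
  have hb : ∀ i j, |cov[fun ω => X i ω - clip T (X i ω), fun ω => X j ω - clip T (X j ω); P]| ≤
      C ^ s * D ^ (1 - s) * T ^ (-(ζ * (1 - s))) *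
        (1 + |((j - i : ℤ) : ℝ)|) ^ (-(s * θ')) := by
    intro i j
    have b1 := hcov _ hψ i j
    have b2 := h.abs_cov_sub_clip_le hT isContr_id hψ i j
    rw [← hm, ← hD] at b2
    set c := |cov[fun ω => X i ω - clip T (X i ω), fun ω => X j ω - clip T (X j ω); P]| with hc
    have hc0 : 0 ≤ c := abs_nonneg _
    set y := 1 + |((j - i : ℤ) : ℝ)| with hy
    have hy0 : 0 ≤ y := by positivity
    calc c = c ^ s * c ^ (1 - s) := by
          rw [← Real.rpow_add_of_nonneg hc0 hs0.le (by linarith), add_sub_cancel, Real.rpow_one]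
      _ ≤ (C * y ^ (-θ')) ^ s * (D * T ^ (-ζ)) ^ (1 - s) := by
          gcongr
      _ = _ := by
          rw [Real.mul_rpow hC (by positivity), Real.mul_rpow hD0 (by positivity),
            ← Real.rpow_mul hy0, ← Real.rpow_mul hT0.le]
          ring_nf
  refine (h.variance_sum_le hψ (g := fun k => C ^ s * D ^ (1 - s) * T ^ (-(ζ * (1 - s))) *
        (1 + |(k : ℝ)|) ^ (-(s * θ'))) (hsum.mul_left _) hb A).trans (le_of_eq ?_)
  rw [tsum_mul_left]
  ring

lemma card_filter_add_notMem_le (p : ℕ) (m : ℤ) :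
    (((Finset.Ioc (0 : ℤ) p).filter fun i => i + m ∉ Finset.Ioc (0 : ℤ) p).card : ℝ) ≤ |(m : ℝ)| := by
  have hsub : (Finset.Ioc (0 : ℤ) p).filter (fun i => i + m ∉ Finset.Ioc (0 : ℤ) p) ⊆
      if 0 ≤ m then Finset.Ioc (p - m : ℤ) p else Finset.Ioc 0 (-m) := by
    intro i hi
    simp only [Finset.mem_filter, Finset.mem_Ioc, not_and, not_le] at hi
    split_ifs with hm
    · simp only [Finset.mem_Ioc]
      have := hi.2 (by omega)
      omega
    · simp only [Finset.mem_Ioc]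
      by_contra hcon
      have := hi.2 (by omega)
      omega
  have hcard := Finset.card_le_card hsub
  have h2 : (((if 0 ≤ m then Finset.Ioc (p - m : ℤ) p else Finset.Ioc 0 (-m)).card : ℤ)) = |m| := by
    split_ifs with hm
    · rw [Int.card_Ioc, abs_of_nonneg hm]; omega
    · rw [Int.card_Ioc, abs_of_neg (by omega)]; omega
  have h3 : (((Finset.Ioc (0 : ℤ) p).filter fun i => i + m ∉ Finset.Ioc (0 : ℤ) p).card : ℤ) ≤ |m| := by
    rw [← h2]; exact_mod_cast hcard
  exact_mod_cast h3

/-- The variance of a sum over `p` consecutive indices is `p σ²` up to a bounded error: the lag `m`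
misses at most `|m|` pairs. -/
lemma exists_abs_variance_sub_le (h : StationaryMoment P X ζ) {C θ' : ℝ} (hC : 0 ≤ C)
    (hcov : ∀ ψ : ℝ → ℝ, IsContr ψ → ∀ i j : ℤ,
      |cov[fun ω => ψ (X i ω), fun ω => ψ (X j ω); P]| ≤ C * (1 + |((j - i : ℤ) : ℝ)|) ^ (-θ'))
    (hθ' : 2 < θ') :
    ∃ C', 0 ≤ C' ∧ ∀ p : ℕ,
      |Var[fun ω => ∑ i ∈ Finset.Ioc (0 : ℤ) p, X i ω; P] - p * sigmaSq P X| ≤ C' := by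
  have hs := summable_cov hcov (by linarith)
  have hs2 := summable_one_add_abs_rpow (s := θ' - 1) (by linarith)
  refine ⟨∑' k : ℤ, C * (1 + |(k : ℝ)|) ^ (-(θ' - 1)), tsum_nonneg fun k => by positivity,
    fun p => ?_⟩
  set I := Finset.Ioc (0 : ℤ) p with hI
  have hcard : I.card = p := by simp [hI]
  set γ : ℤ → ℝ := fun k => cov[X 0, X k; P] with hγ
  have hsig : sigmaSq P X = ∑' k, γ k := rfl
  have hγb : ∀ k, |γ k| ≤ C * (1 + |(k : ℝ)|) ^ (-θ') := fun k => by
    have := hcov _ isContr_id 0 k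
    rwa [sub_zero] at this
  have hrow : ∀ i, ∑ j ∈ I, γ (j - i) = ∑' m, if i + m ∈ I then γ m else 0 := by
    intro i
    have e : ∑ j ∈ I, γ (j - i) = ∑ m ∈ I.map (Equiv.subRight i).toEmbedding,
        if i + m ∈ I then γ m else 0 := by
      rw [Finset.sum_map]
      refine Finset.sum_congr rfl fun j hj => ?_
      simp [hj]
    rw [e]
    refine (tsum_eq_sum fun m hm => if_neg fun hm' => hm ?_).symm
    exact Finset.mem_map.2 ⟨i + m, hm', by simp⟩
  have hsi : ∀ i, Summable fun m => if i + m ∈ I then γ m else 0 := fun i =>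
    Summable.of_norm_bounded hs.norm fun m => by split_ifs <;> simp
  have hsi' : ∀ i, Summable fun m => if i + m ∉ I then γ m else 0 := fun i =>
    Summable.of_norm_bounded hs.norm fun m => by split_ifs <;> simp
  have hdiff : ∀ i, ∑' m, γ m - ∑ j ∈ I, γ (j - i) = ∑' m, if i + m ∉ I then γ m else 0 := by
    intro i
    rw [hrow i, ← hs.tsum_sub (hsi i)]
    refine tsum_congr fun m => ?_
    by_cases hm : i + m ∈ I <;> simp [hm, hγ]
  have hV := h.variance_sum_eq isContr_id I
  have hV2 : Var[fun ω => ∑ i ∈ I, X i ω; P] = ∑ i ∈ I, ∑ j ∈ I, γ (j - i) := by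
    rw [hV]
    exact Finset.sum_congr rfl fun i _ => Finset.sum_congr rfl fun j _ =>
      h.cov_shift measurable_id i j
  -- the difference is a sum over lags, weighted with the number of missing pairs
  have hmain : p * sigmaSq P X - Var[fun ω => ∑ i ∈ I, X i ω; P] =
      ∑' m, ((I.filter fun i => i + m ∉ I).card : ℝ) * γ m := by
    have : (p : ℝ) * sigmaSq P X = ∑ i ∈ I, ∑' m, γ m := by
      rw [Finset.sum_const, hcard, nsmul_eq_mul, hsig]
    rw [this, hV2, ← Finset.sum_sub_distrib, Finset.sum_congr rfl fun i _ => hdiff i,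
      ← Summable.tsum_finsetSum fun i _ => hsi' i]
    refine tsum_congr fun m => ?_
    rw [← Finset.sum_filter, Finset.sum_const, nsmul_eq_mul]
  rw [abs_sub_comm, hmain]
  rw [← Real.norm_eq_abs]
  refine tsum_of_norm_bounded (hs2.mul_left C).hasSum fun m => ?_
  rw [norm_mul, Real.norm_of_nonneg (Nat.cast_nonneg _), Real.norm_eq_abs]
  have hy : 0 < 1 + |(m : ℝ)| := by positivity
  calc _ ≤ |(m : ℝ)| * (C * (1 + |(m : ℝ)|) ^ (-θ')) :=
        mul_le_mul (card_filter_add_notMem_le p m) (hγb m) (abs_nonneg _) (abs_nonneg _)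
    _ ≤ (1 + |(m : ℝ)|) * (C * (1 + |(m : ℝ)|) ^ (-θ')) := by gcongr; linarith
    _ = C * (1 + |(m : ℝ)|) ^ (-(θ' - 1)) := by
        rw [show -(θ' - 1) = 1 + -θ' by ring, Real.rpow_add hy, Real.rpow_one]; ring

end StationaryMoment

end

end WeakDep

/-! ### Fourth moments of partial sums -/

namespace WeakDep

lemma abs_prod_sub_prod_le {ι : Type*} (s : Finset ι) (a b : ι → ℝ) (ha : ∀ i, |a i| ≤ 1)
    (hb : ∀ i, |b i| ≤ 1) : |∏ i ∈ s, a i - ∏ i ∈ s, b i| ≤ ∑ i ∈ s, |a i - b i| := by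
  classical
  induction s using Finset.induction_on with
  | empty => simp
  | insert i s hi ih =>
    rw [Finset.prod_insert hi, Finset.prod_insert hi, Finset.sum_insert hi]
    have e : a i * ∏ i ∈ s, a i - b i * ∏ i ∈ s, b i =
        (a i - b i) * ∏ i ∈ s, a i + b i * (∏ i ∈ s, a i - ∏ i ∈ s, b i) := by ring
    have h1 : |∏ i ∈ s, a i| ≤ 1 := by
      rw [Finset.abs_prod]; exact Finset.prod_le_one (fun _ _ => abs_nonneg _) fun i _ => ha i
    rw [e]
    refine (abs_add_le _ _).trans ?_
    rw [abs_mul, abs_mul]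
    have := mul_le_mul_of_nonneg_left h1 (abs_nonneg (a i - b i))
    have := mul_le_mul (hb i) ih (abs_nonneg _) zero_le_one
    linarith

section

variable {Ω : Type*} [MeasurableSpace Ω] {P : Measure Ω} {X : ℤ → Ω → ℝ}

/-- Weak dependence for products of bounded Lipschitz functions of single variables. -/
lemma PolyWeakDep.cov_prod_le {β K θ : ℝ} (hw : PolyWeakDep P X β K θ) {ψ : ℝ → ℝ} {l : ℝ}
    (hl : 0 ≤ l) (hψ1 : ∀ x, |ψ x| ≤ 1) (hψl : ∀ x y, |ψ x - ψ y| ≤ l * |x - y|) {r u v : ℕ}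
    (hu : 1 ≤ u) (hv : 1 ≤ v) {s : Fin u → ℤ} {t : Fin v → ℤ} (hs : Monotone s) (ht : Monotone t)
    (hst : ∀ i j, s i + (r : ℤ) ≤ t j) :
    |cov[fun ω => ∏ i, ψ (X (s i) ω), fun ω => ∏ j, ψ (X (t j) ω); P]| ≤
      (u * v * l * l + β * (u * l + v * l)) * (K * (1 + r : ℝ) ^ (-θ)) := by
  have h1 : ∀ (n : ℕ) (x : Fin n → ℝ), |∏ i, ψ (x i)| ≤ 1 := fun n x => by
    rw [Finset.abs_prod]
    exact Finset.prod_le_one (fun _ _ => abs_nonneg _) fun i _ => hψ1 _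
  have h2 : ∀ (n : ℕ) (x y : Fin n → ℝ), |∏ i, ψ (x i) - ∏ i, ψ (y i)| ≤ l * ∑ i, |x i - y i| := by
    intro n x y
    refine (abs_prod_sub_prod_le _ _ _ (fun _ => hψ1 _) fun _ => hψ1 _).trans ?_
    rw [Finset.mul_sum]
    exact Finset.sum_le_sum fun i _ => hψl _ _
  exact hw.cov_le r u v hu hv s t hs ht hst (fun x => ∏ i, ψ (x i)) (fun x => ∏ i, ψ (x i))
    (h1 u) (h1 v) l l hl hl (h2 u) (h2 v)

variable [IsProbabilityMeasure P]

/-- Fourth-order mixed moments. The product is split at its widest gap `k`, and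
`(1 + k) ^ (-θ)` is at most the product of the powers `-θ / 3` over all three gaps. A split in the
middle leaves a product of two second moments. -/
lemma PolyWeakDep.abs_integral_four_le (hmeas : ∀ t, Measurable (X t)) {β K θ : ℝ} (hβ : 0 ≤ β)
    (hK : 0 ≤ K) (hθ : 0 ≤ θ) (hw : PolyWeakDep P X β K θ) {ψ : ℝ → ℝ} (hψm : Measurable ψ) {l : ℝ}
    (hl : 0 ≤ l) (hψ1 : ∀ x, |ψ x| ≤ 1) (hψl : ∀ x y, |ψ x - ψ y| ≤ l * |x - y|)
    (hψ0 : ∀ t, ∫ ω, ψ (X t ω) ∂P = 0) {γ : ℕ → ℝ}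
    (hγ : ∀ (i : ℤ) (k : ℕ), |∫ ω, ψ (X i ω) * ψ (X (i + k) ω) ∂P| ≤ γ k) (a : ℤ) (k₁ k₂ k₃ : ℕ) :
    |∫ ω, ψ (X a ω) * ψ (X (a + k₁) ω) * ψ (X (a + k₁ + k₂) ω) * ψ (X (a + k₁ + k₂ + k₃) ω) ∂P| ≤
      K * (4 * l ^ 2 + 4 * β * l) * ((1 + k₁ : ℝ) ^ (-(θ / 3)) * (1 + k₂ : ℝ) ^ (-(θ / 3)) *
        (1 + k₃ : ℝ) ^ (-(θ / 3))) + γ k₁ * γ k₃ := by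
  set D := K * (4 * l ^ 2 + 4 * β * l) with hD
  have hD0 : 0 ≤ D := by positivity
  have hγ0 : ∀ k, 0 ≤ γ k := fun k => (abs_nonneg _).trans (hγ 0 k)
  have hm : ∀ n (s : Fin n → ℤ), MemLp (fun ω => ∏ i, ψ (X (s i) ω)) 2 P := fun n s => by
    refine MemLp.of_bound (Finset.measurable_prod _ fun i _ =>
      hψm.comp (hmeas _)).aestronglyMeasurable 1 (ae_of_all _ fun ω => ?_)
    rw [Real.norm_eq_abs, Finset.abs_prod]
    exact Finset.prod_le_one (fun _ _ => abs_nonneg _) fun i _ => hψ1 _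
  have hcov : ∀ (u v : ℕ) (s : Fin u → ℤ) (t : Fin v → ℤ),
      ∫ ω, (∏ i, ψ (X (s i) ω)) * ∏ i, ψ (X (t i) ω) ∂P =
        cov[fun ω => ∏ i, ψ (X (s i) ω), fun ω => ∏ j, ψ (X (t j) ω); P] +
        (∫ ω, ∏ i, ψ (X (s i) ω) ∂P) * ∫ ω, ∏ i, ψ (X (t i) ω) ∂P := by
    intro u v s t
    rw [covariance_eq_sub (hm u s) (hm v t)]
    simp
  set z₁ := a + k₁ with hz₁
  set z₂ := z₁ + k₂ with hz₂
  set z₃ := z₂ + k₃ with hz₃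
  have hk1 : (0 : ℤ) ≤ k₁ := by positivity
  have hk2 : (0 : ℤ) ≤ k₂ := by positivity
  have hk3 : (0 : ℤ) ≤ k₃ := by positivity
  have mono1 : ∀ x : ℤ, Monotone ![x] := fun x => Subsingleton.monotone _
  have mono2 : ∀ x y : ℤ, x ≤ y → Monotone ![x, y] := by
    intro x y hxy i j hij
    fin_cases i <;> fin_cases j <;> simp_all
  have mono3 : ∀ x y z : ℤ, x ≤ y → y ≤ z → Monotone ![x, y, z] := by
    intro x y z hxy hyz i j hij
    have := hxy.trans hyz
    fin_cases i <;> fin_cases j <;> simp_all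
  have b1 : |∫ ω, ψ (X a ω) * ψ (X z₁ ω) * ψ (X z₂ ω) * ψ (X z₃ ω) ∂P| ≤
      D * (1 + k₁ : ℝ) ^ (-θ) := by
    have h1 := hw.cov_prod_le hl hψ1 hψl (r := k₁) le_rfl (by norm_num : 1 ≤ 3)
      (mono1 a) (mono3 z₁ z₂ z₃ (by omega) (by omega))
      (by intro i j; fin_cases i; fin_cases j <;> simp <;> omega)
    have h2 := hcov 1 3 ![a] ![z₁, z₂, z₃]
    simp only [Fin.prod_univ_three, Fin.prod_univ_one, Matrix.cons_val_zero, Matrix.cons_val_one,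
      Matrix.cons_val] at h1 h2
    rw [hψ0, zero_mul, add_zero] at h2
    rw [← h2] at h1
    simp only [← mul_assoc] at h1 ⊢
    refine h1.trans ?_
    rw [hD]
    push_cast
    have : 0 ≤ (1 + k₁ : ℝ) ^ (-θ) := by positivity
    calc _ = K * (3 * l ^ 2 + 4 * β * l) * (1 + k₁ : ℝ) ^ (-θ) := by ring
      _ ≤ _ := by gcongr; norm_num
  have b3 : |∫ ω, ψ (X a ω) * ψ (X z₁ ω) * ψ (X z₂ ω) * ψ (X z₃ ω) ∂P| ≤
      D * (1 + k₃ : ℝ) ^ (-θ) := by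
    have h1 := hw.cov_prod_le hl hψ1 hψl (r := k₃) (by norm_num : 1 ≤ 3) le_rfl
      (mono3 a z₁ z₂ (by omega) (by omega)) (mono1 z₃)
      (by intro i j; fin_cases j; fin_cases i <;> simp <;> omega)
    have h2 := hcov 3 1 ![a, z₁, z₂] ![z₃]
    simp only [Fin.prod_univ_three, Fin.prod_univ_one, Matrix.cons_val_zero, Matrix.cons_val_one,
      Matrix.cons_val] at h1 h2
    rw [hψ0, mul_zero, add_zero] at h2
    rw [← h2] at h1
    refine h1.trans ?_
    rw [hD]
    push_cast
    have : 0 ≤ (1 + k₃ : ℝ) ^ (-θ) := by positivity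
    calc _ = K * (3 * l ^ 2 + 4 * β * l) * (1 + k₃ : ℝ) ^ (-θ) := by ring
      _ ≤ _ := by gcongr; norm_num
  have b2 : |∫ ω, ψ (X a ω) * ψ (X z₁ ω) * ψ (X z₂ ω) * ψ (X z₃ ω) ∂P| ≤
      D * (1 + k₂ : ℝ) ^ (-θ) + γ k₁ * γ k₃ := by
    have h1 := hw.cov_prod_le hl hψ1 hψl (r := k₂) (by norm_num : 1 ≤ 2) (by norm_num : 1 ≤ 2)
      (mono2 a z₁ (by omega)) (mono2 z₂ z₃ (by omega))
      (by intro i j; fin_cases i <;> fin_cases j <;> simp <;> omega)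
    have h2 := hcov 2 2 ![a, z₁] ![z₂, z₃]
    simp only [Fin.prod_univ_two, Matrix.cons_val_zero, Matrix.cons_val_one] at h1 h2
    simp only [← mul_assoc] at h2
    rw [h2]
    refine (abs_add_le _ _).trans (add_le_add (h1.trans (le_of_eq ?_)) ?_)
    · rw [hD]; push_cast; ring
    · rw [abs_mul]
      exact mul_le_mul (hγ a k₁) (hγ z₂ k₃) (abs_nonneg _) (hγ0 _)
  have hdecr : ∀ i j : ℕ, i ≤ j → (1 + j : ℝ) ^ (-(θ / 3)) ≤ (1 + i : ℝ) ^ (-(θ / 3)) := by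
    intro i j hij
    have h0 : (i : ℝ) ≤ j := by exact_mod_cast hij
    exact Real.rpow_le_rpow_of_nonpos (by positivity) (by linarith) (by linarith)
  have hcube : ∀ j : ℕ, (1 + j : ℝ) ^ (-θ) = (1 + j : ℝ) ^ (-(θ / 3)) * (1 + j : ℝ) ^ (-(θ / 3)) *
      (1 + j : ℝ) ^ (-(θ / 3)) := by
    intro j
    have h0 : (0 : ℝ) < 1 + j := by positivity
    rw [← Real.rpow_add h0, ← Real.rpow_add h0]; ring_nf
  have hpos : ∀ j : ℕ, 0 ≤ (1 + j : ℝ) ^ (-(θ / 3)) := fun j => by positivity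
  have hg := mul_nonneg (hγ0 k₁) (hγ0 k₃)
  have hp1 := hpos k₁
  have hp2 := hpos k₂
  have hp3 := hpos k₃
  rcases le_total k₁ k₂ with h12 | h12 <;> rcases le_total k₂ k₃ with h23 | h23
  · refine b3.trans (le_add_of_le_of_nonneg ?_ hg)
    rw [hcube k₃]
    have := hdecr k₁ k₃ (h12.trans h23); have := hdecr k₂ k₃ h23
    gcongr
  · refine b2.trans (add_le_add ?_ le_rfl)
    rw [hcube k₂]
    have := hdecr k₁ k₂ h12; have := hdecr k₃ k₂ h23
    gcongr
  · rcases le_total k₁ k₃ with h13 | h13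
    · refine b3.trans (le_add_of_le_of_nonneg ?_ hg)
      rw [hcube k₃]
      have := hdecr k₁ k₃ h13; have := hdecr k₂ k₃ h23
      gcongr
    · refine b1.trans (le_add_of_le_of_nonneg ?_ hg)
      rw [hcube k₁]
      have := hdecr k₂ k₁ h12; have := hdecr k₃ k₁ h13
      gcongr
  · refine b1.trans (le_add_of_le_of_nonneg ?_ hg)
    rw [hcube k₁]
    have := hdecr k₂ k₁ h12; have := hdecr k₃ k₁ (h23.trans h12)
    gcongr

end

/-- A symmetric sum over quadruples is dominated by `24` times the sum over sorted ones, which are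
parametrized by the first entry and the three gaps. -/
lemma sum_piFinset_le (p : ℕ) {F : (Fin 4 → ℤ) → ℝ} (hF0 : ∀ z, 0 ≤ F z)
    (hsymm : ∀ (σ : Equiv.Perm (Fin 4)) z, F (z ∘ σ) = F z) {H : ℕ → ℕ → ℕ → ℝ}
    (hH0 : ∀ i j k, 0 ≤ H i j k)
    (hFH : ∀ (a : ℤ) (i j k : ℕ), F ![a, a + i, a + i + j, a + i + j + k] ≤ H i j k) :
    ∑ z ∈ Fintype.piFinset fun _ : Fin 4 => Finset.Ioc (0 : ℤ) p, F z ≤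
      24 * (p * ∑ i ∈ Finset.range p, ∑ j ∈ Finset.range p, ∑ k ∈ Finset.range p, H i j k) := by
  classical
  set S := Fintype.piFinset fun _ : Fin 4 => Finset.Ioc (0 : ℤ) p with hS
  have hperm : ∀ (σ : Equiv.Perm (Fin 4)) (G : (Fin 4 → ℤ) → ℝ),
      ∑ z ∈ S, G (z ∘ σ) = ∑ z ∈ S, G z := by
    intro σ G
    refine Finset.sum_equiv (Equiv.arrowCongr σ.symm (Equiv.refl ℤ)) (fun z => ?_) fun z _ => ?_
    · simp only [hS, Fintype.mem_piFinset]
      exact ⟨fun h i => h _, fun h i => by simpa using h (σ.symm i)⟩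
    · rfl
  -- every quadruple is sorted by at least one of the `24` permutations
  have hsort : ∑ z ∈ S, F z ≤ 24 * ∑ z ∈ S.filter Monotone, F z := by
    have h1 : ∀ z, F z ≤ ∑ σ : Equiv.Perm (Fin 4), if Monotone (z ∘ σ) then F (z ∘ σ) else 0 := by
      intro z
      refine le_trans ?_ (Finset.single_le_sum (f := fun σ : Equiv.Perm (Fin 4) =>
        if Monotone (z ∘ σ) then F (z ∘ σ) else 0) (fun σ _ => ?_) (Finset.mem_univ (Tuple.sort z)))
      · rw [if_pos (Tuple.monotone_sort z), hsymm]
      · split_ifs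
        · exact hF0 _
        · exact le_rfl
    refine (Finset.sum_le_sum fun z _ => h1 z).trans ?_
    rw [Finset.sum_comm]
    have h2 : ∀ σ : Equiv.Perm (Fin 4), ∑ z ∈ S, (if Monotone (z ∘ σ) then F (z ∘ σ) else 0) =
        ∑ z ∈ S.filter Monotone, F z := by
      intro σ
      rw [hperm σ fun z => if Monotone z then F z else 0, Finset.sum_filter]
    rw [Finset.sum_congr rfl fun σ _ => h2 σ, Finset.sum_const, Finset.card_univ,
      Fintype.card_perm, Fintype.card_fin, nsmul_eq_mul]
    norm_num [Nat.factorial]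
  refine hsort.trans ?_
  gcongr
  set T := Finset.Ioc (0 : ℤ) p ×ˢ (Finset.range p ×ˢ (Finset.range p ×ˢ Finset.range p)) with hT
  set Φ : (Fin 4 → ℤ) → ℤ × ℕ × ℕ × ℕ := fun z =>
    (z 0, (z 1 - z 0).toNat, (z 2 - z 1).toNat, (z 3 - z 2).toNat) with hΦ
  have hm : ∀ z ∈ S.filter Monotone, z 0 ≤ z 1 ∧ z 1 ≤ z 2 ∧ z 2 ≤ z 3 ∧ 0 < z 0 ∧ z 3 ≤ p := by
    intro z hz
    simp only [hS, Finset.mem_filter, Fintype.mem_piFinset, Finset.mem_Ioc] at hz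
    exact ⟨hz.2 (by decide), hz.2 (by decide), hz.2 (by decide), (hz.1 0).1, (hz.1 3).2⟩
  have hval : ∀ z ∈ S.filter Monotone, F z ≤ H (Φ z).2.1 (Φ z).2.2.1 (Φ z).2.2.2 := by
    intro z hz
    obtain ⟨h1, h2, h3, -, -⟩ := hm z hz
    have e : z = ![z 0, z 0 + ((z 1 - z 0).toNat : ℤ),
        z 0 + ((z 1 - z 0).toNat : ℤ) + ((z 2 - z 1).toNat : ℤ),
        z 0 + ((z 1 - z 0).toNat : ℤ) + ((z 2 - z 1).toNat : ℤ) + ((z 3 - z 2).toNat : ℤ)] := by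
      funext i
      fin_cases i <;> simp <;> omega
    exact (le_of_eq (congrArg F e)).trans (hFH _ _ _ _)
  have hinj : Set.InjOn Φ (S.filter Monotone : Finset (Fin 4 → ℤ)) := by
    intro z hz w hw hzw
    obtain ⟨h1, h2, h3, -, -⟩ := hm z (by simpa using hz)
    obtain ⟨h1', h2', h3', -, -⟩ := hm w (by simpa using hw)
    simp only [hΦ, Prod.mk.injEq] at hzw
    funext i
    fin_cases i <;> simp <;> omega
  have hmaps : (S.filter Monotone).image Φ ⊆ T := by
    intro t ht
    obtain ⟨z, hz, rfl⟩ := Finset.mem_image.1 ht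
    obtain ⟨h1, h2, h3, h4, h5⟩ := hm z hz
    simp only [hT, hΦ, Finset.mem_product, Finset.mem_Ioc, Finset.mem_range]
    omega
  calc ∑ z ∈ S.filter Monotone, F z
      ≤ ∑ z ∈ S.filter Monotone, H (Φ z).2.1 (Φ z).2.2.1 (Φ z).2.2.2 := Finset.sum_le_sum hval
    _ = ∑ t ∈ (S.filter Monotone).image Φ, H t.2.1 t.2.2.1 t.2.2.2 :=
        (Finset.sum_image (f := fun t : ℤ × ℕ × ℕ × ℕ => H t.2.1 t.2.2.1 t.2.2.2) hinj).symm
    _ ≤ ∑ t ∈ T, H t.2.1 t.2.2.1 t.2.2.2 :=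
        Finset.sum_le_sum_of_subset_of_nonneg hmaps fun _ _ _ => hH0 _ _ _
    _ = _ := by
        rw [hT, Finset.sum_product]
        simp only [Finset.sum_product, Finset.sum_const, Int.card_Ioc, sub_zero, Int.toNat_natCast,
          nsmul_eq_mul]

section

variable {Ω : Type*} [MeasurableSpace Ω] {P : Measure Ω} {X : ℤ → Ω → ℝ} [IsProbabilityMeasure P]

/-- Fourth moment of a sum of `p` consecutive bounded centred variables. -/
lemma PolyWeakDep.integral_sum_pow_four_le (hmeas : ∀ t, Measurable (X t)) {β K θ : ℝ} (hβ : 0 ≤ β)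
    (hK : 0 ≤ K) (hθ : 0 ≤ θ) (hw : PolyWeakDep P X β K θ) {ψ : ℝ → ℝ} (hψm : Measurable ψ) {l : ℝ}
    (hl : 0 ≤ l) (hψ1 : ∀ x, |ψ x| ≤ 1) (hψl : ∀ x y, |ψ x - ψ y| ≤ l * |x - y|)
    (hψ0 : ∀ t, ∫ ω, ψ (X t ω) ∂P = 0) {γ : ℕ → ℝ}
    (hγ : ∀ (i : ℤ) (k : ℕ), |∫ ω, ψ (X i ω) * ψ (X (i + k) ω) ∂P| ≤ γ k) (p : ℕ) :
    ∫ ω, (∑ i ∈ Finset.Ioc (0 : ℤ) p, ψ (X i ω)) ^ 4 ∂P ≤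
      24 * (p * (K * (4 * l ^ 2 + 4 * β * l) *
        (∑ r ∈ Finset.range p, (1 + r : ℝ) ^ (-(θ / 3))) ^ 3
          + p * (∑ r ∈ Finset.range p, γ r) ^ 2)) := by
  have hγ0 : ∀ k, 0 ≤ γ k := fun k => (abs_nonneg _).trans (hγ 0 k)
  set F : (Fin 4 → ℤ) → ℝ := fun z => |∫ ω, ∏ i, ψ (X (z i) ω) ∂P| with hF
  have hexp : ∀ ω, (∑ i ∈ Finset.Ioc (0 : ℤ) p, ψ (X i ω)) ^ 4 =
      ∑ z ∈ Fintype.piFinset fun _ : Fin 4 => Finset.Ioc (0 : ℤ) p, ∏ i, ψ (X (z i) ω) := by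
    intro ω
    have := Finset.prod_univ_sum (fun _ : Fin 4 => Finset.Ioc (0 : ℤ) p) fun _ i => ψ (X i ω)
    rw [← this]
    simp
  have hint : ∀ z : Fin 4 → ℤ, Integrable (fun ω => ∏ i, ψ (X (z i) ω)) P := fun z => by
    refine Integrable.of_bound (C := 1) (Finset.measurable_prod _ fun i _ =>
      hψm.comp (hmeas _)).aestronglyMeasurable (ae_of_all _ fun ω => ?_)
    rw [Real.norm_eq_abs, Finset.abs_prod]
    exact Finset.prod_le_one (fun _ _ => abs_nonneg _) fun i _ => hψ1 _
  simp_rw [hexp]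
  rw [integral_finsetSum _ fun z _ => hint z]
  refine (Finset.sum_le_sum fun z _ => le_abs_self _).trans ?_
  refine (sum_piFinset_le p (F := F) (fun z => abs_nonneg _) (fun σ z => ?_)
    (H := fun k₁ k₂ k₃ => K * (4 * l ^ 2 + 4 * β * l) * ((1 + k₁ : ℝ) ^ (-(θ / 3)) *
      (1 + k₂ : ℝ) ^ (-(θ / 3)) * (1 + k₃ : ℝ) ^ (-(θ / 3))) + γ k₁ * γ k₃) ?_ ?_).trans
    (le_of_eq ?_)
  · simp only [hF, Function.comp_apply]
    congr 2
    ext ω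
    exact Equiv.prod_comp σ fun i => ψ (X (z i) ω)
  · intro i j k
    have := hγ0 i; have := hγ0 k
    positivity
  · intro a i j k
    have := hw.abs_integral_four_le hmeas hβ hK hθ hψm hl hψ1 hψl hψ0 hγ a i j k
    simpa only [hF, Fin.prod_univ_four, Matrix.cons_val_zero, Matrix.cons_val_one,
      Matrix.cons_val] using this
  · congr 2
    simp only [Finset.sum_add_distrib, ← Finset.mul_sum, ← Finset.sum_mul, Finset.sum_const,
      Finset.card_range, nsmul_eq_mul]
    ring

end

end WeakDep

/-! ### Taylor expansion, perturbation of variances and of distribution functions -/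

namespace WeakDep

section

variable {Ω : Type*} [MeasurableSpace Ω] {P : Measure Ω}

lemma sq_integral_mul_le {f g : Ω → ℝ} (hf : MemLp f 2 P) (hg : MemLp g 2 P) :
    (∫ ω, f ω * g ω ∂P) ^ 2 ≤ (∫ ω, f ω ^ 2 ∂P) * ∫ ω, g ω ^ 2 ∂P := by
  have hfg : Integrable (fun ω => f ω * g ω) P := hf.integrable_mul hg
  have key : ∀ c : ℝ, 0 ≤ (∫ ω, g ω ^ 2 ∂P) * (c * c) + (-2 * ∫ ω, f ω * g ω ∂P) * c
      + ∫ ω, f ω ^ 2 ∂P := by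
    intro c
    have e : (∫ ω, g ω ^ 2 ∂P) * (c * c) + (-2 * ∫ ω, f ω * g ω ∂P) * c + ∫ ω, f ω ^ 2 ∂P =
        ∫ ω, (f ω - c * g ω) ^ 2 ∂P := by
      have : ∀ ω, (f ω - c * g ω) ^ 2 = f ω ^ 2 + (-2 * c) * (f ω * g ω) + c ^ 2 * g ω ^ 2 := by
        intro ω; ring
      simp_rw [this]
      have i12 : Integrable (fun ω => f ω ^ 2 + -2 * c * (f ω * g ω)) P :=
        hf.integrable_sq.add (hfg.const_mul _)
      rw [integral_add i12 (hg.integrable_sq.const_mul _),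
        integral_add hf.integrable_sq (hfg.const_mul _), integral_const_mul, integral_const_mul]
      ring
    rw [e]
    exact integral_nonneg fun ω => sq_nonneg _
  have := discrim_le_zero key
  rw [discrim] at this
  linarith

variable [IsProbabilityMeasure P]

lemma sq_integral_sq_le {U : Ω → ℝ} (hU : Measurable U) {b : ℝ} (hb : ∀ ω, |U ω| ≤ b) :
    (∫ ω, U ω ^ 2 ∂P) ^ 2 ≤ ∫ ω, U ω ^ 4 ∂P := by
  have h1 : MemLp (fun ω => U ω ^ 2) 2 P :=
    MemLp.of_bound (hU.pow_const 2).aestronglyMeasurable (b ^ 2) (ae_of_all _ fun ω => by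
      rw [Real.norm_of_nonneg (sq_nonneg _), ← sq_abs]
      exact pow_le_pow_left₀ (abs_nonneg _) (hb ω) 2)
  have h := sq_integral_mul_le h1 (memLp_const (1 : ℝ))
  simp only [mul_one, one_pow, integral_const, probReal_univ, smul_eq_mul, ← pow_mul] at h
  exact h

open Complex in
/-- Second-order expansion of a characteristic function, with the remainder controlled by the
second and the fourth moment. -/
lemma norm_integral_exp_sub_le {U : Ω → ℝ} (hU : Measurable U) {b : ℝ} (hb : ∀ ω, |U ω| ≤ b)
    (hU0 : ∫ ω, U ω ∂P = 0) {B : ℝ} (hB : 0 ≤ B)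
    (hUB : (∫ ω, U ω ^ 2 ∂P) * ∫ ω, U ω ^ 4 ∂P ≤ B ^ 2) (s : ℝ) :
    ‖∫ ω, cexp ((s * U ω : ℝ) * I) ∂P - ((1 - (∫ ω, U ω ^ 2 ∂P) * s ^ 2 / 2 : ℝ) : ℂ)‖
      ≤ 4 * B * |s| ^ 3 := by
  have hpow : ∀ n : ℕ, Integrable (fun ω => U ω ^ n) P := fun n =>
    Integrable.of_bound (C := b ^ n) (hU.pow_const n).aestronglyMeasurable
      (ae_of_all _ fun ω => by
        rw [norm_pow, Real.norm_eq_abs]; exact pow_le_pow_left₀ (abs_nonneg _) (hb ω) n)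
  have habs : Integrable (fun ω => |U ω| ^ 3) P :=
    Integrable.of_bound (C := b ^ 3) (by fun_prop)
      (ae_of_all _ fun ω => by
        rw [norm_pow, Real.norm_eq_abs, abs_abs]; exact pow_le_pow_left₀ (abs_nonneg _) (hb ω) 3)
  have h3 : ∫ ω, |U ω| ^ 3 ∂P ≤ B := by
    have m1 : MemLp (fun ω => |U ω|) 2 P :=
      MemLp.of_bound (by fun_prop) b (ae_of_all _ fun ω => by
        rw [Real.norm_eq_abs, abs_abs]; exact hb ω)
    have m2 : MemLp (fun ω => U ω ^ 2) 2 P :=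
      MemLp.of_bound (hU.pow_const 2).aestronglyMeasurable (b ^ 2) (ae_of_all _ fun ω => by
        rw [Real.norm_of_nonneg (sq_nonneg _), ← sq_abs]
        exact pow_le_pow_left₀ (abs_nonneg _) (hb ω) 2)
    have h := sq_integral_mul_le m1 m2
    have e1 : ∀ ω, |U ω| * U ω ^ 2 = |U ω| ^ 3 := fun ω => by rw [← sq_abs]; ring
    simp_rw [e1, sq_abs, ← pow_mul] at h
    exact abs_le_of_sq_le_sq' (h.trans hUB) hB |>.2
  have hi : Integrable (fun ω => cexp ((s * U ω : ℝ) * I)) P :=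
    Integrable.of_bound (C := 1) (by fun_prop) (ae_of_all _ fun ω => by
      rw [Complex.norm_exp_ofReal_mul_I])
  have hU1 : Integrable U P := by simpa using hpow 1
  have i1 : Integrable (fun ω => ((s * U ω : ℝ) : ℂ) * I) P := (hU1.const_mul s).ofReal.mul_const _
  have i2 : Integrable (fun ω => (((s * U ω) ^ 2 / 2 : ℝ) : ℂ)) P := by
    refine Integrable.ofReal ?_
    simp_rw [mul_pow]
    exact ((hpow 2).const_mul _).div_const _
  have e : ∫ ω, cexp ((s * U ω : ℝ) * I) ∂P - ((1 - (∫ ω, U ω ^ 2 ∂P) * s ^ 2 / 2 : ℝ) : ℂ) =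
      ∫ ω, (cexp ((s * U ω : ℝ) * I) -
        (1 + ((s * U ω : ℝ) : ℂ) * I - (((s * U ω) ^ 2 / 2 : ℝ) : ℂ))) ∂P := by
    have i3 : Integrable (fun ω => 1 + ((s * U ω : ℝ) : ℂ) * I) P := (integrable_const _).add i1
    have i4 : Integrable (fun ω => 1 + ((s * U ω : ℝ) : ℂ) * I - (((s * U ω) ^ 2 / 2 : ℝ) : ℂ)) P :=
      i3.sub i2
    rw [integral_sub hi i4, integral_sub i3 i2, integral_add (integrable_const _) i1,
      integral_mul_const, integral_complex_ofReal, integral_complex_ofReal]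
    rw [integral_const_mul, hU0]
    have : ∫ ω, (s * U ω) ^ 2 / 2 ∂P = (∫ ω, U ω ^ 2 ∂P) * s ^ 2 / 2 := by
      simp_rw [mul_pow]
      rw [integral_div, integral_const_mul]; ring
    rw [this]
    simp
  rw [e]
  have hbnd := norm_integral_le_of_norm_le (μ := P) (habs.const_mul (4 * |s| ^ 3))
    (ae_of_all _ fun ω => (norm_exp_mul_I_sub_le (s * U ω)).trans
      (le_of_eq (by rw [abs_mul, mul_pow]; ring)))
  refine hbnd.trans ?_
  rw [integral_const_mul]
  calc 4 * |s| ^ 3 * ∫ ω, |U ω| ^ 3 ∂P ≤ 4 * |s| ^ 3 * B := by gcongr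
    _ = _ := by ring

/-- Young's inequality for the covariance, with a free weight `c`. -/
lemma abs_variance_add_sub_le {f g : Ω → ℝ} (hf : MemLp f 2 P) (hg : MemLp g 2 P) {c : ℝ}
    (hc : 0 < c) :
    |Var[fun ω => f ω + g ω; P] - Var[f; P]| ≤ c * Var[f; P] + (1 + 1 / c) * Var[g; P] := by
  have h1 := variance_fun_add hf hg
  have h2 := variance_nonneg (fun ω => c * f ω + g ω) P
  have h3 := variance_nonneg (fun ω => c * f ω - g ω) P
  rw [variance_fun_add (hf.const_mul c) hg, variance_const_mul, covariance_const_mul_left] at h2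
  rw [variance_fun_sub (hf.const_mul c) hg, variance_const_mul, covariance_const_mul_left] at h3
  have h4 : 2 * |cov[f, g; P]| ≤ c * Var[f; P] + 1 / c * Var[g; P] := by
    have : c * (2 * |cov[f, g; P]|) ≤ c * (c * Var[f; P] + 1 / c * Var[g; P]) := by
      have e : c * (c * Var[f; P] + 1 / c * Var[g; P]) = c ^ 2 * Var[f; P] + Var[g; P] := by
        field_simp
      rw [e]
      rcases abs_cases (cov[f, g; P]) with ⟨h, -⟩ | ⟨h, -⟩ <;> rw [h] <;> linarith
    exact le_of_mul_le_mul_left this hc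
  rw [h1, add_sub_right_comm, add_sub_right_comm, sub_self, zero_add]
  refine (abs_add_le _ _).trans ?_
  rw [abs_mul, abs_of_pos (two_pos : (0 : ℝ) < 2), abs_of_nonneg (variance_nonneg g P)]
  linarith

lemma variance_add_le {f g : Ω → ℝ} (hf : MemLp f 2 P) (hg : MemLp g 2 P) :
    Var[fun ω => f ω + g ω; P] ≤ 2 * Var[f; P] + 2 * Var[g; P] := by
  have h := abs_variance_add_sub_le hf hg one_pos
  have := (abs_le.1 h).2
  linarith

/-- Passing from `W` to `W + V` costs a shift `δ` of the argument and the Chebyshev bound for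
`V`. -/
lemma abs_measureReal_add_le_sub_le {W V : Ω → ℝ} (hW : Measurable W) (hV : MemLp V 2 P)
    {F : ℝ → ℝ} {L D δ : ℝ} (hδ : 0 < δ) (hL : ∀ x y, x ≤ y → F y ≤ F x + L * (y - x))
    (hD : ∀ x, |(P.map W).real (Set.Iic x) - F x| ≤ D) (x : ℝ) :
    |P.real {ω | W ω + V ω ≤ x} - F x| ≤ D + L * δ + (∫ ω, V ω ^ 2 ∂P) / δ ^ 2 := by
  have hWx : ∀ y, (P.map W).real (Set.Iic y) = P.real {ω | W ω ≤ y} := fun y => by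
    rw [map_measureReal_apply hW measurableSet_Iic]; rfl
  have hcheb : P.real {ω | δ ≤ |V ω|} ≤ (∫ ω, V ω ^ 2 ∂P) / δ ^ 2 := by
    have h := mul_meas_ge_le_integral_of_nonneg (μ := P) (f := fun ω => V ω ^ 2)
      (ae_of_all _ fun ω => sq_nonneg _) hV.integrable_sq (δ ^ 2)
    rw [le_div_iff₀ (by positivity), mul_comm]
    have hset : ∀ ω, δ ≤ |V ω| ↔ δ ^ 2 ≤ V ω ^ 2 := fun ω => by
      rw [← sq_abs (V ω)]
      exact ⟨fun h => pow_le_pow_left₀ hδ.le h 2, fun h => le_of_sq_le_sq h (abs_nonneg _)⟩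
    simp_rw [hset]
    exact h
  have h1 : P.real {ω | W ω + V ω ≤ x} ≤
      (P.map W).real (Set.Iic (x + δ)) + P.real {ω | δ ≤ |V ω|} := by
    rw [hWx]
    refine (measureReal_mono ?_).trans (measureReal_union_le _ _)
    intro ω hω
    simp only [Set.mem_ofPred_eq, Set.mem_union] at hω ⊢
    by_contra hcon
    push Not at hcon
    linarith [(abs_lt.1 hcon.2).1]
  have h2 : (P.map W).real (Set.Iic (x - δ)) ≤
      P.real {ω | W ω + V ω ≤ x} + P.real {ω | δ ≤ |V ω|} := by
    rw [hWx]
    refine (measureReal_mono ?_).trans (measureReal_union_le _ _)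
    intro ω hω
    simp only [Set.mem_ofPred_eq, Set.mem_union] at hω ⊢
    by_contra hcon
    push Not at hcon
    linarith [(abs_lt.1 hcon.2).2]
  have h3 := (abs_le.1 (hD (x + δ))).2
  have h4 := (abs_le.1 (hD (x - δ))).1
  have h5 := hL x (x + δ) (by linarith)
  have h6 := hL (x - δ) x (by linarith)
  rw [abs_le]
  constructor <;> linarith

end

end WeakDep

/-! ### Truncated blocks -/

namespace WeakDep

section

variable {Ω : Type*} [MeasurableSpace Ω] {P : Measure Ω} {X : ℤ → Ω → ℝ}

/-- The centred truncation at level `T` of a variable with the common marginal law. -/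
noncomputable def centredClip (P : Measure Ω) (X : ℤ → Ω → ℝ) (T x : ℝ) : ℝ :=
  clip T x - ∫ ω, clip T (X 0 ω) ∂P

/-- The sum of the centred truncations over the block of length `p` that starts at `1`. -/
noncomputable def blockSum (P : Measure Ω) (X : ℤ → Ω → ℝ) (p : ℕ) (T : ℝ) (ω : Ω) : ℝ :=
  ∑ i ∈ Finset.Ioc (0 : ℤ) p, centredClip P X T (X i ω)

lemma abs_centredClip_sub_le {T : ℝ} (hT : 0 ≤ T) (x y : ℝ) :
    |centredClip P X T x - centredClip P X T y| ≤ |x - y| := by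
  simp only [centredClip, sub_sub_sub_cancel_right]
  exact (isContr_clip hT).lip x y

lemma measurable_centredClip {T : ℝ} (hT : 0 ≤ T) : Measurable (centredClip P X T) :=
  (isContr_clip hT).measurable.sub_const _

lemma blockSum_eq (p : ℕ) (T : ℝ) (ω : Ω) : blockSum P X p T ω =
    ∑ i ∈ Finset.Ioc (0 : ℤ) p, clip T (X i ω) - p * ∫ ω, clip T (X 0 ω) ∂P := by
  simp [blockSum, centredClip, Finset.sum_sub_distrib]

lemma StationaryMoment.measurable_blockSum {ζ : ℝ} (h : StationaryMoment P X ζ) {T : ℝ} (hT : 0 ≤ T) (p : ℕ) :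
    Measurable (blockSum P X p T) :=
  Finset.measurable_sum _ fun i _ => (measurable_centredClip hT).comp (h.meas i)

variable [IsProbabilityMeasure P]

lemma abs_centredClip_le {T : ℝ} (hT : 0 ≤ T) (x : ℝ) : |centredClip P X T x| ≤ 2 * T := by
  have h1 : |∫ ω, clip T (X 0 ω) ∂P| ≤ T := by
    have := norm_integral_le_of_norm_le_const (μ := P) (f := fun ω => clip T (X 0 ω)) (C := T)
      (ae_of_all _ fun ω => abs_clip_le hT _)
    simpa using this
  refine (abs_sub _ _).trans ?_
  linarith [abs_clip_le hT x]

lemma abs_blockSum_le {T : ℝ} (hT : 0 ≤ T) (p : ℕ) (ω : Ω) : |blockSum P X p T ω| ≤ p * (2 * T) := by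
  refine (Finset.abs_sum_le_sum_abs _ _).trans ?_
  refine (Finset.sum_le_card_nsmul _ _ _ fun i _ => abs_centredClip_le hT _).trans ?_
  simp

variable {ζ : ℝ}

namespace StationaryMoment

lemma integral_centredClip (h : StationaryMoment P X ζ) {T : ℝ} (hT : 0 ≤ T) (t : ℤ) :
    ∫ ω, centredClip P X T (X t ω) ∂P = 0 := by
  have hc := isContr_clip hT
  simp only [centredClip]
  rw [integral_sub ((h.memLp_comp hc t).integrable (by norm_num)) (integrable_const _),
    h.integral_comp_eq hc.measurable t]
  simp

lemma memLp_centredClip (h : StationaryMoment P X ζ) {T : ℝ} (hT : 0 ≤ T) (t : ℤ) :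
    MemLp (fun ω => centredClip P X T (X t ω)) 2 P :=
  MemLp.of_bound ((measurable_centredClip hT).comp (h.meas t)).aestronglyMeasurable (2 * T)
    (ae_of_all _ fun _ => abs_centredClip_le hT _)

lemma integral_blockSum (h : StationaryMoment P X ζ) {T : ℝ} (hT : 0 ≤ T) (p : ℕ) :
    ∫ ω, blockSum P X p T ω ∂P = 0 := by
  simp only [blockSum]
  rw [integral_finsetSum _ fun i _ => (h.memLp_centredClip hT i).integrable (by norm_num)]
  exact Finset.sum_eq_zero fun i _ => h.integral_centredClip hT i

lemma integral_blockSum_sq (h : StationaryMoment P X ζ) {T : ℝ} (hT : 0 ≤ T) (p : ℕ) :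
    ∫ ω, blockSum P X p T ω ^ 2 ∂P = Var[fun ω => ∑ i ∈ Finset.Ioc (0 : ℤ) p, clip T (X i ω); P] := by
  have hm := h.measurable_blockSum hT p
  rw [← variance_of_integral_eq_zero hm.aemeasurable (h.integral_blockSum hT p)]
  have e : blockSum P X p T = fun ω => ∑ i ∈ Finset.Ioc (0 : ℤ) p, clip T (X i ω)
      - p * ∫ ω, clip T (X 0 ω) ∂P := funext fun ω => blockSum_eq p T ω
  rw [e, variance_sub_const]
  exact (Finset.measurable_sum _ fun i _ =>
    (isContr_clip hT).measurable.comp (h.meas i)).aestronglyMeasurable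

/-- The part of the sum outside the truncated blocks has a small second moment. -/
lemma remainder_moment_le (h : StationaryMoment P X ζ) {C₂ C₃ e : ℝ} (hC₃ : 0 ≤ C₃)
    (hC₂ : ∀ ψ, IsContr ψ → ∀ A : Finset ℤ, Var[fun ω => ∑ i ∈ A, ψ (X i ω); P] ≤ C₂ * A.card)
    {T : ℝ} (hT : 1 ≤ T)
    (hT₃ : ∀ A : Finset ℤ, Var[fun ω => ∑ i ∈ A, (X i ω - clip T (X i ω)); P] ≤
      C₃ * A.card * T ^ (-e)) {p q k n : ℕ} (hkn : k * (p + q) ≤ n) :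
    MemLp (fun ω => ∑ i ∈ Finset.Ioc (0 : ℤ) n, X i ω
      - ∑ j ∈ Finset.range k, ∑ i ∈ block p (p + q) j, centredClip P X T (X i ω)) 2 P ∧
    ∫ ω, (∑ i ∈ Finset.Ioc (0 : ℤ) n, X i ω
      - ∑ j ∈ Finset.range k, ∑ i ∈ block p (p + q) j, centredClip P X T (X i ω)) ^ 2 ∂P ≤
      2 * (C₂ * (n - k * p)) + 2 * (C₃ * n * T ^ (-e)) := by
  have hT0 : 0 ≤ T := by linarith
  have hpL : p ≤ p + q := by omega
  set Bk := blocks p (p + q) k with hBk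
  have hsub : Bk ⊆ Finset.Ioc (0 : ℤ) n := by
    refine Finset.biUnion_subset.2 fun j hj => block_subset _ _ _ _ ?_
    have := Finset.mem_range.1 hj
    nlinarith
  have hcard : (Bk.card : ℝ) = k * p := by rw [hBk, card_blocks hpL]; push_cast; ring
  have hcR : ((Finset.Ioc (0 : ℤ) n \ Bk).card : ℝ) = n - k * p := by
    rw [Finset.cast_card_sdiff hsub, hcard]; simp
  have hkp : (k * p : ℝ) ≤ n := by exact_mod_cast (by nlinarith : k * p ≤ n)
  set a := ∫ ω, clip T (X 0 ω) ∂P with ha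
  set f : Ω → ℝ := fun ω => ∑ i ∈ Finset.Ioc (0 : ℤ) n \ Bk, X i ω with hf
  set g : Ω → ℝ := fun ω => ∑ i ∈ Bk, (X i ω - clip T (X i ω)) with hg
  have hVe : ∀ ω, ∑ i ∈ Finset.Ioc (0 : ℤ) n, X i ω
      - ∑ j ∈ Finset.range k, ∑ i ∈ block p (p + q) j, centredClip P X T (X i ω) =
      f ω + g ω + Bk.card * a := by
    intro ω
    rw [← sum_blocks hpL k fun i => centredClip P X T (X i ω), ← Finset.sum_sdiff hsub]
    simp only [hf, hg, centredClip, Finset.sum_sub_distrib, Finset.sum_const, nsmul_eq_mul]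
    ring
  have hfL : MemLp f 2 P := memLp_finsetSum _ fun i _ => h.memLp i
  have hgL : MemLp g 2 P := memLp_finsetSum _ fun i _ => h.memLp_comp (isContr_sub_clip hT0) i
  have hfg : MemLp (fun ω => f ω + g ω) 2 P := hfL.add hgL
  have hVL : MemLp (fun ω => f ω + g ω + Bk.card * a) 2 P :=
    hfg.add (memLp_const _)
  have hV0 : ∫ ω, (f ω + g ω + Bk.card * a) ∂P = 0 := by
    simp_rw [← hVe]
    have hX0 : ∀ t, ∫ ω, X t ω ∂P = 0 := fun t => by
      exact (h.integral_comp_eq (ψ := fun x => x) measurable_id t).trans h.mean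
    rw [integral_sub (integrable_finsetSum _ fun i _ => (h.memLp i).integrable (by norm_num))
      (integrable_finsetSum _ fun j _ => integrable_finsetSum _ fun i _ =>
        (h.memLp_centredClip hT0 i).integrable (by norm_num)),
      integral_finsetSum _ fun i _ => (h.memLp i).integrable (by norm_num),
      integral_finsetSum _ fun j _ => integrable_finsetSum _ fun i _ =>
        (h.memLp_centredClip hT0 i).integrable (by norm_num),
      Finset.sum_eq_zero fun i _ => hX0 i, Finset.sum_eq_zero fun j _ => ?_, sub_zero]
    rw [integral_finsetSum _ fun i _ => (h.memLp_centredClip hT0 i).integrable (by norm_num)]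
    exact Finset.sum_eq_zero fun i _ => h.integral_centredClip hT0 i
  simp_rw [hVe]
  refine ⟨hVL, ?_⟩
  rw [← variance_of_integral_eq_zero hVL.aestronglyMeasurable.aemeasurable hV0,
    variance_add_const hfg.aestronglyMeasurable]
  refine (variance_add_le hfL hgL).trans ?_
  have b1 := hC₂ _ isContr_id (Finset.Ioc (0 : ℤ) n \ Bk)
  have b2 := hT₃ Bk
  rw [hcR] at b1
  rw [hcard] at b2
  have b3 : C₃ * (k * p) * T ^ (-e) ≤ C₃ * n * T ^ (-e) := by gcongr
  linarith

/-- The second moment of a truncated block is close to `p σ²`. The weight `T ^ (-e / 2)` balances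
the two terms of `abs_variance_add_sub_le`. -/
lemma abs_integral_blockSum_sq_sub_le (h : StationaryMoment P X ζ) {C₂ C₃ C₄ e : ℝ}
    (hC₃ : 0 ≤ C₃) (he : 0 ≤ e)
    (hC₂ : ∀ ψ, IsContr ψ → ∀ A : Finset ℤ, Var[fun ω => ∑ i ∈ A, ψ (X i ω); P] ≤ C₂ * A.card)
    {T : ℝ} (hT : 1 ≤ T)
    (hT₃ : ∀ A : Finset ℤ, Var[fun ω => ∑ i ∈ A, (X i ω - clip T (X i ω)); P] ≤
      C₃ * A.card * T ^ (-e)) (p : ℕ)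
    (hC₄ : |Var[fun ω => ∑ i ∈ Finset.Ioc (0 : ℤ) p, X i ω; P] - p * sigmaSq P X| ≤ C₄) :
    |∫ ω, blockSum P X p T ω ^ 2 ∂P - p * sigmaSq P X| ≤
      C₄ + (C₂ + 2 * C₃) * p * T ^ (-(e / 2)) := by
  have hT0 : 0 ≤ T := by linarith
  have hTp : 0 < T := by linarith
  rw [h.integral_blockSum_sq hT0]
  set I := Finset.Ioc (0 : ℤ) p with hI
  have hcard : (I.card : ℝ) = p := by simp [hI]
  have hA : MemLp (fun ω => ∑ i ∈ I, clip T (X i ω)) 2 P :=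
    memLp_finsetSum _ fun i _ => h.memLp_comp (isContr_clip hT0) i
  have hD : MemLp (fun ω => ∑ i ∈ I, (X i ω - clip T (X i ω))) 2 P :=
    memLp_finsetSum _ fun i _ => h.memLp_comp (isContr_sub_clip hT0) i
  have hy : 0 < T ^ (-(e / 2)) := by positivity
  have hb := abs_variance_add_sub_le hA hD hy
  have e1 : (fun ω => ∑ i ∈ I, clip T (X i ω) + ∑ i ∈ I, (X i ω - clip T (X i ω))) =
      fun ω => ∑ i ∈ I, X i ω := by
    funext ω
    rw [← Finset.sum_add_distrib]
    exact Finset.sum_congr rfl fun i _ => by ring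
  rw [e1] at hb
  have v1 := hC₂ _ (isContr_clip hT0) I
  have v2 := hT₃ I
  rw [hcard] at v1 v2
  have hy2 : T ^ (-e) = T ^ (-(e / 2)) * T ^ (-(e / 2)) := by
    rw [← Real.rpow_add hTp]; ring_nf
  have hy1 : T ^ (-(e / 2)) ≤ 1 := Real.rpow_le_one_of_one_le_of_nonpos hT (by linarith)
  set y := T ^ (-(e / 2)) with hydef
  have hCp : 0 ≤ C₃ * p := by positivity
  have b2 : (1 + 1 / y) * Var[fun ω => ∑ i ∈ I, (X i ω - clip T (X i ω)); P] ≤ 2 * C₃ * p * y := by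
    calc _ ≤ (1 + 1 / y) * (C₃ * p * T ^ (-e)) := by gcongr
      _ = C₃ * p * (y * y + y) := by rw [hy2]; field_simp
      _ ≤ C₃ * p * (y + y) := by
          have : y * y ≤ y := mul_le_of_le_one_left hy.le hy1
          gcongr
      _ = _ := by ring
  have b1 : y * Var[fun ω => ∑ i ∈ I, clip T (X i ω); P] ≤ y * (C₂ * p) := by gcongr
  have hb2 := abs_le.1 hb
  have h4 := abs_le.1 hC₄
  rw [abs_le]
  constructor <;> nlinarith

/-- The fourth moment of a truncated block. -/
lemma integral_blockSum_pow_four_le (h : StationaryMoment P X ζ) {β K θ C θ' : ℝ} (hβ : 0 ≤ β)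
    (hK : 0 ≤ K) (hθ : 0 ≤ θ) (hw : PolyWeakDep P X β K θ) (hC : 0 ≤ C)
    (hcov : ∀ ψ : ℝ → ℝ, IsContr ψ → ∀ i j : ℤ,
      |cov[fun ω => ψ (X i ω), fun ω => ψ (X j ω); P]| ≤ C * (1 + |((j - i : ℤ) : ℝ)|) ^ (-θ'))
    (hθ' : 1 < θ') {T : ℝ} (hT : 1 ≤ T) (p : ℕ) :
    ∫ ω, blockSum P X p T ω ^ 4 ∂P ≤
      24 * p * (16 * K * (T ^ 2 + 2 * β * T ^ 3) *
        (∑ r ∈ Finset.range p, (1 + r : ℝ) ^ (-(θ / 3))) ^ 3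
        + (C * ∑' k : ℤ, (1 + |(k : ℝ)|) ^ (-θ')) ^ 2 * p) := by
  have hT0 : 0 ≤ T := by linarith
  have hTp : 0 < T := by linarith
  -- the summands are normalized to be bounded by `1`; the Lipschitz constant becomes `1 / (2 T)`
  set ψ : ℝ → ℝ := fun x => centredClip P X T x / (2 * T) with hψ
  have hψm : Measurable ψ := (measurable_centredClip hT0).div_const _
  have hψ1 : ∀ x, |ψ x| ≤ 1 := fun x => by
    simp only [hψ]
    rw [abs_div, abs_of_pos (by positivity : 0 < 2 * T), div_le_one (by positivity)]
    exact abs_centredClip_le hT0 x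
  have hψl : ∀ x y, |ψ x - ψ y| ≤ 1 / (2 * T) * |x - y| := fun x y => by
    simp only [hψ]
    rw [← sub_div, abs_div, abs_of_pos (by positivity : 0 < 2 * T), div_eq_mul_one_div, mul_comm]
    exact mul_le_mul_of_nonneg_left (abs_centredClip_sub_le hT0 x y) (by positivity)
  have hψ0 : ∀ t, ∫ ω, ψ (X t ω) ∂P = 0 := fun t => by
    simp only [hψ]
    rw [integral_div, h.integral_centredClip hT0, zero_div]
  have hγ : ∀ (i : ℤ) (k : ℕ), |∫ ω, ψ (X i ω) * ψ (X (i + k) ω) ∂P| ≤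
      C / (4 * T ^ 2) * (1 + |((k : ℤ) : ℝ)|) ^ (-θ') := by
    intro i k
    have h1 := hcov _ (isContr_clip hT0) i (i + k)
    rw [add_sub_cancel_left, covariance,
      h.integral_comp_eq (isContr_clip hT0).measurable i,
      h.integral_comp_eq (isContr_clip hT0).measurable (i + k)] at h1
    have e : ∫ ω, ψ (X i ω) * ψ (X (i + k) ω) ∂P =
        (∫ ω, (clip T (X i ω) - ∫ ω, clip T (X 0 ω) ∂P) *
          (clip T (X (i + k) ω) - ∫ ω, clip T (X 0 ω) ∂P) ∂P) / (4 * T ^ 2) := by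
      rw [← integral_div]
      congr 1; ext ω
      simp only [hψ, centredClip]
      field_simp; ring
    rw [e, abs_div, abs_of_pos (by positivity : 0 < 4 * T ^ 2), div_mul_eq_mul_div]
    gcongr
  have key := hw.integral_sum_pow_four_le h.meas hβ hK hθ hψm (by positivity) hψ1 hψl hψ0
    (γ := fun k => C / (4 * T ^ 2) * (1 + |((k : ℤ) : ℝ)|) ^ (-θ')) hγ p
  have hsum : ∑ r ∈ Finset.range p, C / (4 * T ^ 2) * (1 + |((r : ℤ) : ℝ)|) ^ (-θ') ≤
      C / (4 * T ^ 2) * ∑' k : ℤ, (1 + |(k : ℝ)|) ^ (-θ') := by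
    rw [← Finset.mul_sum]
    gcongr
    have e : ∑ r ∈ Finset.range p, (1 + |((r : ℤ) : ℝ)|) ^ (-θ') =
        ∑ k ∈ (Finset.range p).map Nat.castEmbedding, (1 + |((k : ℤ) : ℝ)|) ^ (-θ') := by
      rw [Finset.sum_map]; rfl
    rw [e]
    exact (summable_one_add_abs_rpow hθ').sum_le_tsum _ fun k _ => by positivity
  have hsum0 : 0 ≤ ∑ r ∈ Finset.range p, C / (4 * T ^ 2) * (1 + |((r : ℤ) : ℝ)|) ^ (-θ') :=
    Finset.sum_nonneg fun r _ => by positivity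
  have e4 : ∀ ω, blockSum P X p T ω ^ 4 =
      (2 * T) ^ 4 * (∑ i ∈ Finset.Ioc (0 : ℤ) p, ψ (X i ω)) ^ 4 := by
    intro ω
    rw [← mul_pow, Finset.mul_sum]
    congr 1
    refine Finset.sum_congr rfl fun i _ => ?_
    simp only [hψ]
    field_simp
  simp_rw [e4]
  rw [integral_const_mul]
  set Q := (∑ r ∈ Finset.range p, (1 + r : ℝ) ^ (-(θ / 3))) ^ 3 with hQ
  have hQ0 : 0 ≤ Q := pow_nonneg (Finset.sum_nonneg fun r _ => by positivity) 3
  set G := ∑' k : ℤ, (1 + |(k : ℝ)|) ^ (-θ') with hG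
  calc _ ≤ (2 * T) ^ 4 * (24 * (p * (K * (4 * (1 / (2 * T)) ^ 2 + 4 * β * (1 / (2 * T))) * Q
          + p * (∑ r ∈ Finset.range p, C / (4 * T ^ 2) * (1 + |((r : ℤ) : ℝ)|) ^ (-θ')) ^ 2))) := by
        gcongr
    _ ≤ (2 * T) ^ 4 * (24 * (p * (K * (4 * (1 / (2 * T)) ^ 2 + 4 * β * (1 / (2 * T))) * Q
          + p * (C / (4 * T ^ 2) * G) ^ 2))) := by gcongr
    _ = _ := by field_simp; ring

end StationaryMoment

end

end WeakDep

/-! ### The bound for a fixed sample size -/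

namespace WeakDep

lemma partialSum_eq {Ω : Type*} (X : ℤ → Ω → ℝ) (n : ℕ) (ω : Ω) :
    partialSum X n ω = ∑ i ∈ Finset.Ioc (0 : ℤ) n, X i ω := by
  unfold partialSum
  have e : Finset.Ioc (0 : ℤ) n = (Finset.Icc 1 n).map Nat.castEmbedding := by
    ext i
    simp only [Finset.mem_Ioc, Finset.mem_map, Finset.mem_Icc, Nat.castEmbedding_apply]
    constructor
    · rintro ⟨h1, h2⟩
      exact ⟨i.toNat, by omega, by omega⟩
    · rintro ⟨a, h1, rfl⟩
      omega
  rw [e, Finset.sum_map]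
  rfl

section

variable {Ω : Type*} [MeasurableSpace Ω] {P : Measure Ω} [IsProbabilityMeasure P]
  {X : ℤ → Ω → ℝ} {ζ : ℝ}

open Complex in
/-- The Berry–Esseen bound for a fixed number of observations, in terms of the moments of one
truncated block and of the remainder. The parameters `R` (range of frequencies on which the
characteristic function is controlled), `b` and `d` (width and shift of the Gaussian smoothing) and
`δ` (level at which the remainder is discarded) are free. -/
lemma StationaryMoment.abs_cdfSum_sub_cdfNormal_le (h : StationaryMoment P X ζ) {β K θ : ℝ}
    (hβ : 0 ≤ β) (hK : 0 ≤ K) (hw : PolyWeakDep P X β K θ) {T : ℝ} (hT : 0 ≤ T) {p q k n : ℕ}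
    (hp : 1 ≤ p) (hn : 1 ≤ n) (hkn : k * (p + q) ≤ n) {B A₁ A₂ A₄ D R b d δ : ℝ} (hB : 0 ≤ B)
    (hUB : (∫ ω, blockSum P X p T ω ^ 2 ∂P) * ∫ ω, blockSum P X p T ω ^ 4 ∂P ≤ B ^ 2)
    (hV : MemLp (fun ω => ∑ i ∈ Finset.Ioc (0 : ℤ) n, X i ω
      - ∑ j ∈ Finset.range k, ∑ i ∈ block p (p + q) j, centredClip P X T (X i ω)) 2 P)
    (hD : ∫ ω, (∑ i ∈ Finset.Ioc (0 : ℤ) n, X i ω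
      - ∑ j ∈ Finset.range k, ∑ i ∈ block p (p + q) j, centredClip P X T (X i ω)) ^ 2 ∂P ≤ D)
    (hA₁ : 4 * k * p * (K * (1 + q : ℝ) ^ (-θ)) ≤ A₁)
    (hA₂ : 4 * k * (β * (n + p) / √n) * (K * (1 + q : ℝ) ^ (-θ)) ≤ A₂)
    (hA₄ : |k * ((∫ ω, blockSum P X p T ω ^ 2 ∂P) / n) - sigmaSq P X| ≤ A₄)
    (hS : 0 < sigmaSq P X)
    (hkv : sigmaSq P X / 2 ≤ k * ((∫ ω, blockSum P X p T ω ^ 2 ∂P) / n)) (hR : 0 < R)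
    (hRv : R * (24 * (B / (n * √n))) ≤ (∫ ω, blockSum P X p T ω ^ 2 ∂P) / n) (hb : 0 < b)
    (hd : 0 ≤ d) (hδ : 0 < δ) (x : ℝ) :
    |cdfSum P X n x - cdfNormal (sigmaSq P X) x| ≤
      ((A₁ / b + A₂ + 2 / R * Real.exp (-(b ^ 2 * R ^ 2 / 4))) * (√Real.pi * 2 / b)
        + (10 * k * (B / (n * √n)) + A₄) * (1 + 12 / sigmaSq P X)
          * √(12 * Real.pi / sigmaSq P X)) / Real.pi
      + 2 * (√(2 * Real.pi * sigmaSq P X))⁻¹ * d + 2 * Real.exp (-(d ^ 2 / (2 * b ^ 2)))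
      + (√(2 * Real.pi * sigmaSq P X))⁻¹ * δ + D / (n * δ ^ 2) := by
  set S := sigmaSq P X with hSdef
  set U := blockSum P X p T with hU
  set m₂ := ∫ ω, U ω ^ 2 ∂P with hm₂
  set m₄ := ∫ ω, U ω ^ 4 ∂P with hm₄
  set E := K * (1 + q : ℝ) ^ (-θ) with hE
  have hE0 : 0 ≤ E := by positivity
  have hn0 : (0 : ℝ) < n := by exact_mod_cast hn
  have hs0 : (0 : ℝ) < √n := Real.sqrt_pos.2 hn0
  have hss : √(n : ℝ) * √n = n := Real.mul_self_sqrt hn0.le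
  have hm₂0 : 0 ≤ m₂ := integral_nonneg fun ω => sq_nonneg _
  have hUm : Measurable U := h.measurable_blockSum hT p
  have hUb : ∀ ω, |U ω| ≤ p * (2 * T) := abs_blockSum_le hT p
  set Z : Ω → ℝ := fun ω => ∑ j ∈ Finset.range k, ∑ i ∈ block p (p + q) j,
    centredClip P X T (X i ω) with hZ
  have hZm : Measurable Z := Finset.measurable_sum _ fun j _ => Finset.measurable_sum _ fun i _ =>
    (measurable_centredClip hT).comp (h.meas i)
  set W : Ω → ℝ := fun ω => Z ω / √n with hW
  have hWm : Measurable W := hZm.div_const _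
  have : IsProbabilityMeasure (P.map W) := Measure.isProbabilityMeasure_map hWm.aemeasurable
  set φ : ℝ → ℂ := fun t => ∫ ω, cexp ((t / √n * U ω : ℝ) * I) ∂P with hφdef
  have hU0 : ∀ ω, ∑ i ∈ block p (p + q) 0, centredClip P X T (X i ω) = U ω := fun ω => by
    rw [sum_block]; simp [hU, blockSum]
  have hvρ : (m₂ / n) ^ 3 ≤ (B / (n * √n)) ^ 2 := by
    have h1 : m₂ ^ 2 ≤ m₄ := sq_integral_sq_le hUm hUb
    have h2 : m₂ ^ 3 ≤ B ^ 2 := by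
      calc m₂ ^ 3 = m₂ * m₂ ^ 2 := by ring
        _ ≤ m₂ * m₄ := by gcongr
        _ ≤ _ := hUB
    have e : ((n : ℝ) * √n) ^ 2 = (n : ℝ) ^ 3 := by rw [mul_pow, sq (√(n : ℝ)), hss]; ring
    rw [div_pow, div_pow, e]
    gcongr
  have hφ : ∀ t, ‖φ t - ((1 - (m₂ / n) * t ^ 2 / 2 : ℝ) : ℂ)‖ ≤ 4 * (B / (n * √n)) * |t| ^ 3 := by
    intro t
    have := norm_integral_exp_sub_le hUm hUb (h.integral_blockSum hT p) hB hUB (t / √n)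
    have e1 : m₂ * (t / √n) ^ 2 / 2 = m₂ / n * t ^ 2 / 2 := by
      rw [div_pow, sq (√(n : ℝ)), hss]; ring
    have e2 : 4 * B * |t / √n| ^ 3 = 4 * (B / (n * √n)) * |t| ^ 3 := by
      rw [abs_div, abs_of_pos hs0, div_pow]
      have : √(n : ℝ) ^ 3 = n * √n := by rw [pow_succ, sq, hss]
      rw [this]; ring
    rw [e1, e2] at this
    exact this
  have hz : ∀ t, ‖charFun (P.map W) t - φ t ^ k‖ ≤ A₁ * t ^ 2 + A₂ * |t| := by
    intro t
    have hdec := hw.norm_integral_exp_blocks_sub_le h.meas h.stat hβ hK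
      (ψ := centredClip P X T) (abs_centredClip_sub_le hT) (measurable_centredClip hT) hp
      (t / √n) k hkn
    simp_rw [hU0] at hdec
    have e1 : charFun (P.map W) t = ∫ ω, cexp ((t / √n * Z ω : ℝ) * I) ∂P := by
      rw [charFun_apply_real, integral_map hWm.aemeasurable (by fun_prop)]
      congr 1; ext ω
      congr 1
      simp only [hW]; push_cast; ring
    rw [e1]
    refine hdec.trans ?_
    calc k * (4 * ((n * p * (t / √n) ^ 2 + β * ((n + p) * |t / √n|)) * E))
        = (4 * k * p * E) * t ^ 2 + (4 * k * (β * (n + p) / √n) * E) * |t| := by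
          rw [abs_div, abs_of_pos hs0, div_pow, sq (√(n : ℝ)), hss]
          field_simp
      _ ≤ _ := by gcongr
  have hA₁0 : 0 ≤ A₁ := le_trans (by positivity) hA₁
  have hA₂0 : 0 ≤ A₂ := le_trans (by positivity) hA₂
  have main := abs_measureReal_Iic_sub_gaussianReal_le (P.map W) (φ := φ) k
    (by positivity : 0 ≤ m₂ / n) (by positivity : 0 ≤ B / (n * √n)) hvρ hφ
    (fun t => norm_integral_exp_le_one _) hz hA₁0 hA₂0 hA₄ hS hkv hR hRv hb hd
  have hSn : S.toNNReal ≠ 0 := by simpa using hS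
  have hSc : ((S.toNNReal : NNReal) : ℝ) = S := Real.coe_toNNReal _ hS.le
  set V : Ω → ℝ := fun ω => (∑ i ∈ Finset.Ioc (0 : ℤ) n, X i ω - Z ω) / √n with hVdef
  have hVL : MemLp V 2 P := by
    have := hV.mul_const (√(n : ℝ))⁻¹
    simpa only [hVdef, div_eq_mul_inv] using this
  have fin := abs_measureReal_add_le_sub_le hWm hVL hδ
    (F := fun x => (gaussianReal 0 S.toNNReal).real (Set.Iic x))
    (L := (√(2 * Real.pi * S))⁻¹)
    (fun x y hxy => by
      have := gaussianReal_real_Iic_le_add hSn x y hxy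
      rwa [hSc] at this) main x
  have eV : (∫ ω, V ω ^ 2 ∂P) / δ ^ 2 ≤ D / (n * δ ^ 2) := by
    have e2 : ∀ ω, V ω ^ 2 = (∑ i ∈ Finset.Ioc (0 : ℤ) n, X i ω - Z ω) ^ 2 / n := fun ω => by
      simp only [hVdef]; rw [div_pow, sq (√(n : ℝ)), hss]
    simp_rw [e2]
    rw [integral_div, div_div]
    gcongr
  have eW : cdfSum P X n x = P.real {ω | W ω + V ω ≤ x} := by
    unfold cdfSum
    congr 1
    ext ω
    simp only [hW, hVdef, Set.mem_ofPred_eq, partialSum_eq]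
    rw [← add_div, add_sub_cancel]
  rw [eW]
  exact fin.trans (by gcongr)

end

end WeakDep

/-! ### Sequences of polynomial order -/

namespace WeakDep

/-- The sequence `f` is `O(n ^ x)`. The exponent is kept as an index, so that products of sequences
reduce to sums of exponents. -/
def PowBound (f : ℕ → ℝ) (x : ℝ) : Prop := f =O[atTop] fun n : ℕ => (n : ℝ) ^ x

namespace PowBound

variable {f g : ℕ → ℝ} {x y : ℝ}

lemma of_le (C : ℝ) (h : ∀ᶠ n : ℕ in atTop, |f n| ≤ C * (n : ℝ) ^ x) : PowBound f x :=
  IsBigO.of_bound C <| h.mono fun n hn => by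
    rwa [Real.norm_eq_abs, Real.norm_of_nonneg (by positivity)]

lemma of_abs_le (hg : PowBound g x) (h : ∀ᶠ n : ℕ in atTop, |f n| ≤ g n) : PowBound f x :=
  (IsBigO.of_bound 1 <| h.mono fun n hn => by
    rw [Real.norm_eq_abs, one_mul, Real.norm_eq_abs]; exact hn.trans (le_abs_self _)).trans hg

lemma of_nonneg_of_le (hg : PowBound g x) (h0 : ∀ n, 0 ≤ f n) (h : ∀ᶠ n : ℕ in atTop, f n ≤ g n) :
    PowBound f x :=
  hg.of_abs_le <| h.mono fun n hn => by rwa [abs_of_nonneg (h0 n)]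

lemma rpow (x : ℝ) : PowBound (fun n : ℕ => (n : ℝ) ^ x) x := isBigO_refl _ _

lemma mono (hf : PowBound f x) (hxy : x ≤ y) : PowBound f y :=
  hf.trans <| IsBigO.of_bound 1 <| (eventually_ge_atTop 1).mono fun n hn => by
    rw [Real.norm_of_nonneg (by positivity), Real.norm_of_nonneg (by positivity), one_mul]
    exact Real.rpow_le_rpow_of_exponent_le (by exact_mod_cast hn) hxy

lemma add (hf : PowBound f x) (hg : PowBound g x) : PowBound (fun n => f n + g n) x :=
  IsBigO.add hf hg

lemma mul (hf : PowBound f x) (hg : PowBound g y) : PowBound (fun n => f n * g n) (x + y) :=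
  (IsBigO.mul hf hg).trans_eventuallyEq <| (eventually_ge_atTop 1).mono fun n hn =>
    (Real.rpow_add (by exact_mod_cast hn) x y).symm

lemma mul_le {z : ℝ} (hf : PowBound f x) (hg : PowBound g y) (h : x + y ≤ z) :
    PowBound (fun n => f n * g n) z := (hf.mul hg).mono h

lemma const_mul (C : ℝ) (hf : PowBound f x) : PowBound (fun n => C * f n) x :=
  IsBigO.const_mul_left hf C

lemma mul_const (hf : PowBound f x) (C : ℝ) : PowBound (fun n => f n * C) x := by
  simpa only [mul_comm] using hf.const_mul C

lemma sqrt (hf : PowBound f x) : PowBound (fun n => √(f n)) (x / 2) := by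
  obtain ⟨C, hC0, hC⟩ := hf.exists_pos
  refine of_le (√C) (hC.bound.mono fun n hn => ?_)
  rw [Real.norm_eq_abs, Real.norm_of_nonneg (by positivity)] at hn
  rw [abs_of_nonneg (Real.sqrt_nonneg _)]
  calc √(f n) ≤ √(C * (n : ℝ) ^ x) := Real.sqrt_le_sqrt ((le_abs_self _).trans hn)
    _ = √C * √((n : ℝ) ^ x) := Real.sqrt_mul hC0.le _
    _ = _ := by rw [Real.sqrt_eq_rpow ((n : ℝ) ^ x), ← Real.rpow_mul (by positivity)]; ring_nf

lemma isLittleO (hf : PowBound f x) (hxy : x < y) :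
    f =o[atTop] fun n : ℕ => (n : ℝ) ^ y := by
  refine IsBigO.trans_isLittleO hf ?_
  rw [isLittleO_iff_tendsto' ((eventually_ge_atTop 1).mono fun n hn h0 => ?_)]
  · refine Tendsto.congr' ?_ ((tendsto_rpow_neg_atTop (sub_pos.2 hxy)).comp
      tendsto_natCast_atTop_atTop)
    refine (eventually_ge_atTop 1).mono fun n hn => ?_
    have hn0 : (0 : ℝ) < n := by exact_mod_cast hn
    simp only [Function.comp]
    rw [← Real.rpow_sub hn0, neg_sub]
  · have hn0 : (0 : ℝ) < n := by exact_mod_cast hn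
    exact absurd h0 (by positivity)

lemma eventually_le (hf : PowBound f x) (hxy : x < y) {C : ℝ} (hC : 0 < C) :
    ∀ᶠ n : ℕ in atTop, f n ≤ C * (n : ℝ) ^ y := by
  refine ((hf.isLittleO hxy).bound hC).mono fun n hn => ?_
  rw [Real.norm_eq_abs, Real.norm_of_nonneg (by positivity)] at hn
  exact (le_abs_self _).trans hn

/-- A stretched exponential decays faster than every power. -/
lemma exp_neg {C η : ℝ} (hC : 0 < C) (hη : 0 < η) (x : ℝ) :
    PowBound (fun n : ℕ => Real.exp (-(C * (n : ℝ) ^ η))) x := by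
  have h1 := (isLittleO_exp_neg_mul_rpow_atTop hC (x / η)).isBigO
  have ht : Tendsto (fun n : ℕ => (n : ℝ) ^ η) atTop atTop :=
    (tendsto_rpow_atTop hη).comp tendsto_natCast_atTop_atTop
  have h2 := h1.comp_tendsto ht
  refine (h2.congr (fun n => by simp [neg_mul]) fun n => ?_)
  simp only [Function.comp]
  rw [← Real.rpow_mul (by positivity), mul_div_cancel₀ _ hη.ne']

end PowBound

lemma powBound_ceil {a : ℝ} (ha : 0 ≤ a) : PowBound (fun n : ℕ => (⌈(n : ℝ) ^ a⌉₊ : ℝ)) a :=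
  PowBound.of_le 2 <| (eventually_ge_atTop 1).mono fun n hn => by
    have h1 : (1 : ℝ) ≤ (n : ℝ) ^ a := Real.one_le_rpow (by exact_mod_cast hn) ha
    have h2 := Nat.ceil_lt_add_one (a := (n : ℝ) ^ a) (by positivity)
    rw [abs_of_nonneg (by positivity)]
    linarith

end WeakDep

/-! ### The rate for given exponents -/

namespace WeakDep

/-- The order of the fixed-`n` bound for `R = n ^ (c + η)`, `b = δ = n ^ (-c)` and
`d = n ^ (-c + η)`. -/
lemma powBound_total {A₁ A₂ A₄ r D : ℕ → ℝ} {c η : ℝ} (hη : 0 < η) (S : ℝ)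
    (hA₁ : PowBound A₁ (-(3 * c))) (hA₂ : PowBound A₂ (-(2 * c))) (hr : PowBound r (-c))
    (hA₄ : PowBound A₄ (-c)) (hD : PowBound D (1 - 3 * c)) :
    PowBound (fun n => ((A₁ n * (n : ℝ) ^ c + A₂ n + 2 * (n : ℝ) ^ (-(c + η)) *
      Real.exp (-(1 / 4 * (n : ℝ) ^ (2 * η)))) * (√Real.pi * 2 * (n : ℝ) ^ c)
        + (10 * r n + A₄ n) * ((1 + 12 / S) * √(12 * Real.pi / S)))
          * Real.pi⁻¹
      + 2 * (√(2 * Real.pi * S))⁻¹ * (n : ℝ) ^ (-c + η)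
      + 2 * Real.exp (-(1 / 2 * (n : ℝ) ^ (2 * η)))
      + (√(2 * Real.pi * S))⁻¹ * (n : ℝ) ^ (-c) + D n * (n : ℝ)⁻¹ * (n : ℝ) ^ (2 * c)) (-c + η) := by
  have Oinv : PowBound (fun n => (n : ℝ)⁻¹) (-1) := by
    simpa [Real.rpow_neg_one] using PowBound.rpow (-1)
  have hz : -c ≤ -c + η := by linarith
  have t1 := hA₁.mul_le (PowBound.rpow c) (z := -(2 * c)) (by linarith)
  have t2 : PowBound (fun n : ℕ => 2 * (n : ℝ) ^ (-(c + η)) *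
      Real.exp (-(1 / 4 * (n : ℝ) ^ (2 * η)))) (-(2 * c)) :=
    ((PowBound.rpow (-(c + η))).const_mul 2).mul_le
      (PowBound.exp_neg (by norm_num : (0 : ℝ) < 1 / 4) (by linarith : 0 < 2 * η) (-c))
      (by linarith)
  have t3 := ((t1.add hA₂).add t2).mul_le ((PowBound.rpow c).const_mul (√Real.pi * 2))
    (z := -c) (by linarith)
  have t4 := (t3.add (((hr.const_mul 10).add hA₄).mul_const
    ((1 + 12 / S) * √(12 * Real.pi / S)))).mul_const Real.pi⁻¹
  have t5 := (PowBound.exp_neg (by norm_num : (0 : ℝ) < 1 / 2) (by linarith : 0 < 2 * η)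
    (-c + η)).const_mul 2
  have t6 := (hD.mul Oinv).mul_le (PowBound.rpow (2 * c)) (z := -c) (by linarith)
  exact ((((t4.mono hz).add ((PowBound.rpow (-c + η)).const_mul _)).add t5).add
    (((PowBound.rpow (-c)).const_mul _).mono hz)).add (t6.mono hz)

section

variable {Ω : Type*} [MeasurableSpace Ω] {P : Measure Ω} [IsProbabilityMeasure P]
  {X : ℤ → Ω → ℝ} {ζ : ℝ}

/-- The rate obtained from blocks of length `n ^ a`, gaps of length `n ^ b` and truncation at
`n ^ τ`, when the fourth moment of a truncated block is `O(n ^ (2 a + 2 ρ))`. -/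
lemma StationaryMoment.powBound_kolmogorovDist (h : StationaryMoment P X ζ) {β K θ C θ' s : ℝ}
    (hβ : 0 ≤ β) (hK : 0 ≤ K) (hw : PolyWeakDep P X β K θ) (hθ : 0 ≤ θ) (hC : 0 ≤ C)
    (hcov : ∀ ψ : ℝ → ℝ, IsContr ψ → ∀ i j : ℤ,
      |cov[fun ω => ψ (X i ω), fun ω => ψ (X j ω); P]| ≤ C * (1 + |((j - i : ℤ) : ℝ)|) ^ (-θ'))
    (hθ' : 2 < θ') (hs0 : 0 < s) (hs1 : s < 1) (hs : 1 < s * θ') (hS : 0 < sigmaSq P X)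
    {a b τ c η ρ : ℝ} (hc : 0 < c) (hη : 0 < η) (hb : 0 < b) (hτ : 0 ≤ τ)
    (hab : b + 3 * c ≤ a) (ha : a ≤ 1 - 3 * c) (hτc : 3 * c ≤ τ * (ζ * (1 - s)))
    (hρ : c + η < (1 - a) / 2 - ρ) (hbθ : 1 + 3 * c ≤ θ * b)
    (hβθ : β = 0 ∨ 3 / 2 + 2 * c ≤ θ * b + a)
    (hm₄ : PowBound (fun n : ℕ => ∫ ω, blockSum P X ⌈(n : ℝ) ^ a⌉₊ ((n : ℝ) ^ τ) ω ^ 4 ∂P)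
      (2 * a + 2 * ρ)) :
    PowBound (fun n : ℕ => kolmogorovDist P X n) (-c + η) := by
  set S := sigmaSq P X with hSdef
  set e := ζ * (1 - s) with he
  have he0 : 0 ≤ e := mul_nonneg h.pos.le (by linarith)
  have ha0 : 0 ≤ a := by linarith
  obtain ⟨C₃, hC₃, hT₃⟩ := h.exists_variance_sum_sub_clip_le hC hcov hs0 hs1 hs
  obtain ⟨C₄, hC₄0, hC₄⟩ := h.exists_abs_variance_sub_le hC hcov hθ'
  set C₂ := ∑' k : ℤ, C * (1 + |(k : ℝ)|) ^ (-θ') with hC₂def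
  have hC₂0 : 0 ≤ C₂ := tsum_nonneg fun k => by positivity
  have hC₂ : ∀ ψ, IsContr ψ → ∀ A : Finset ℤ,
      Var[fun ω => ∑ i ∈ A, ψ (X i ω); P] ≤ C₂ * A.card := fun ψ hψ A => by
    have := h.variance_sum_le hψ ((summable_one_add_abs_rpow (by linarith)).mul_left C)
      (hcov ψ hψ) A
    rwa [mul_comm]
  set p : ℕ → ℕ := fun n => ⌈(n : ℝ) ^ a⌉₊ with hpdef
  set q : ℕ → ℕ := fun n => ⌈(n : ℝ) ^ b⌉₊ with hqdef
  set k : ℕ → ℕ := fun n => n / (p n + q n) with hkdef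
  set T : ℕ → ℝ := fun n => (n : ℝ) ^ τ with hTdef
  set m₂ : ℕ → ℝ := fun n => ∫ ω, blockSum P X (p n) (T n) ω ^ 2 ∂P with hm₂def
  set m₄ : ℕ → ℝ := fun n => ∫ ω, blockSum P X (p n) (T n) ω ^ 4 ∂P with hm₄def
  set B : ℕ → ℝ := fun n => √(m₂ n * m₄ n) with hBdef
  set E : ℕ → ℝ := fun n => K * (1 + q n : ℝ) ^ (-θ) with hEdef
  have hm₂0 : ∀ n, 0 ≤ m₂ n := fun n => integral_nonneg fun ω => sq_nonneg _
  have hm₄0 : ∀ n, 0 ≤ m₄ n := fun n => integral_nonneg fun ω => by positivity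
  have hE0 : ∀ n, 0 ≤ E n := fun n => by positivity
  have ev1 : ∀ᶠ n : ℕ in atTop, 1 ≤ n := eventually_ge_atTop 1
  have hpa : ∀ n : ℕ, (n : ℝ) ^ a ≤ p n := fun n => Nat.le_ceil _
  have hqb : ∀ n : ℕ, (n : ℝ) ^ b ≤ q n := fun n => Nat.le_ceil _
  have hkn : ∀ n : ℕ, k n * (p n + q n) ≤ n := fun n => Nat.div_mul_le_self _ _
  have hkpn : ∀ n : ℕ, (k n * p n : ℝ) ≤ n := fun n => by
    exact_mod_cast (by nlinarith [hkn n] : k n * p n ≤ n)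
  have hT1 : ∀ n : ℕ, 1 ≤ n → 1 ≤ T n := fun n hn => Real.one_le_rpow (by exact_mod_cast hn) hτ
  have hpos : ∀ n : ℕ, 1 ≤ n → (0 : ℝ) < n := fun n hn => by exact_mod_cast hn
  have hp1 : ∀ n : ℕ, 1 ≤ n → 1 ≤ p n := fun n hn => Nat.one_le_ceil_iff.2 (by
    have := hpos n hn; positivity)
  -- orders of growth of the basic quantities
  have Op : PowBound (fun n : ℕ => (p n : ℝ)) a := powBound_ceil ha0
  have Oq : PowBound (fun n : ℕ => (q n : ℝ)) b := powBound_ceil hb.le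
  have On : PowBound (fun n : ℕ => (n : ℝ)) 1 := by simpa using PowBound.rpow 1
  have Osq : PowBound (fun n : ℕ => √(n : ℝ)) (1 / 2) := On.sqrt
  have Oinv : PowBound (fun n : ℕ => (n : ℝ)⁻¹) (-1) := by
    simpa [Real.rpow_neg_one] using PowBound.rpow (-1)
  have Osqinv : PowBound (fun n : ℕ => (√(n : ℝ))⁻¹) (-(1 / 2)) := by
    refine (PowBound.rpow (-(1 / 2))).of_nonneg_of_le (fun n => by positivity)
      (Eventually.of_forall fun n => ?_)
    rw [Real.rpow_neg (by positivity), ← Real.sqrt_eq_rpow]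
  have Okp : PowBound (fun n : ℕ => (k n * p n : ℝ)) 1 :=
    On.of_nonneg_of_le (fun n => by positivity) (Eventually.of_forall hkpn)
  have Ok : PowBound (fun n : ℕ => (k n : ℝ)) (1 - a) := by
    refine (PowBound.rpow (1 - a)).of_nonneg_of_le (fun n => by positivity) (ev1.mono fun n hn => ?_)
    have hn0 := hpos n hn
    rw [Real.rpow_sub hn0, Real.rpow_one, le_div_iff₀ (by positivity)]
    exact (mul_le_mul_of_nonneg_left (hpa n) (by positivity)).trans (hkpn n)
  have OE : PowBound E (-(θ * b)) := by
    refine ((PowBound.rpow (-(θ * b))).const_mul K).of_nonneg_of_le hE0 (ev1.mono fun n hn => ?_)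
    have hn0 := hpos n hn
    simp only [hEdef]
    gcongr
    rw [show -(θ * b) = b * (-θ) by ring, Real.rpow_mul hn0.le]
    exact Real.rpow_le_rpow_of_nonpos (by positivity) ((hqb n).trans (by linarith)) (by linarith)
  have OTe : PowBound (fun n : ℕ => T n ^ (-e)) (-(3 * c)) := by
    refine (PowBound.rpow (-(3 * c))).of_nonneg_of_le (fun n => by positivity)
      (ev1.mono fun n hn => ?_)
    simp only [hTdef]
    rw [← Real.rpow_mul (by positivity)]
    exact Real.rpow_le_rpow_of_exponent_le (by exact_mod_cast hn) (by linarith)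
  have OTe2 : PowBound (fun n : ℕ => T n ^ (-(e / 2))) (-c) := by
    refine (PowBound.rpow (-c)).of_nonneg_of_le (fun n => by positivity)
      (ev1.mono fun n hn => ?_)
    simp only [hTdef]
    rw [← Real.rpow_mul (by positivity)]
    exact Real.rpow_le_rpow_of_exponent_le (by exact_mod_cast hn) (by linarith)
  -- the number of indices outside the blocks: the gaps and an incomplete period at the end
  have Orest : PowBound (fun n : ℕ => (n - k n * p n : ℝ)) (1 - 3 * c) := by
    have h1 : PowBound (fun n : ℕ => (k n * q n + p n + q n : ℝ)) (1 - 3 * c) :=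
      ((Ok.mul_le Oq (by linarith)).add (Op.mono ha)).add (Oq.mono (by linarith))
    refine h1.of_abs_le (ev1.mono fun n hn => ?_)
    rw [abs_of_nonneg (sub_nonneg.2 (hkpn n))]
    have h2 : n < (p n + q n) * (k n + 1) :=
      Nat.lt_mul_div_succ n (by have := hp1 n hn; omega)
    have h3 : (n : ℝ) < (p n + q n) * (k n + 1) := by exact_mod_cast h2
    nlinarith
  have Om₂ : PowBound m₂ a := by
    refine (Op.const_mul C₂).of_nonneg_of_le hm₂0 (ev1.mono fun n hn => ?_)
    have hT0 : 0 ≤ T n := by have := hT1 n hn; linarith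
    simp only [hm₂def]
    rw [h.integral_blockSum_sq hT0]
    simpa using hC₂ _ (isContr_clip hT0) (Finset.Ioc (0 : ℤ) (p n))
  have OB : PowBound B ((3 * a + 2 * ρ) / 2) := by
    have := (Om₂.mul hm₄).sqrt
    rwa [show a + (2 * a + 2 * ρ) = 3 * a + 2 * ρ by ring] at this
  have OBn : PowBound (fun n : ℕ => B n / (n * √n)) ((3 * a + 2 * ρ) / 2 - 3 / 2) := by
    refine (OB.mul_le (Oinv.mul Osqinv) (z := (3 * a + 2 * ρ) / 2 - 3 / 2)
      (by linarith)).of_abs_le (Eventually.of_forall fun n => le_of_eq ?_)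
    rw [abs_of_nonneg (by positivity), div_eq_mul_inv, mul_inv]
  set A₁ : ℕ → ℝ := fun n => 4 * k n * p n * E n with hA₁
  set A₂ : ℕ → ℝ := fun n => 4 * k n * (β * (n + p n) / √n) * E n with hA₂
  set A₄ : ℕ → ℝ := fun n => |k n * (m₂ n / n) - S| with hA₄
  have OA₁ : PowBound A₁ (1 - θ * b) :=
    ((Okp.const_mul 4).mul_le OE (z := 1 - θ * b) (by linarith)).of_abs_le
      (Eventually.of_forall fun n => le_of_eq (by
        simp only [hA₁]; rw [abs_of_nonneg (by have := hE0 n; positivity)]; ring))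
  have OA₂ : PowBound A₂ (-(2 * c)) := by
    rcases hβθ with h0 | h0
    · refine (PowBound.rpow (-(2 * c))).of_nonneg_of_le (fun n => ?_) (Eventually.of_forall fun n => ?_)
      · have := hE0 n; positivity
      · simp only [hA₂, h0]; simp; positivity
    · have h1 := ((Ok.const_mul 4).mul (((On.add (Op.mono (by linarith))).const_mul β).mul
        Osqinv)).mul_le OE (z := -(2 * c)) (by linarith)
      refine h1.of_abs_le (Eventually.of_forall fun n => le_of_eq ?_)
      simp only [hA₂]; rw [abs_of_nonneg (by have := hE0 n; positivity)]; ring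
  have OA₄ : PowBound A₄ (-c) := by
    have h1 : PowBound (fun n : ℕ => C₄ * ((k n : ℝ) * (n : ℝ)⁻¹) + (C₂ + 2 * C₃) * T n ^ (-(e / 2))
        + S * ((n - k n * p n : ℝ) * (n : ℝ)⁻¹)) (-c) :=
      (((Ok.mul_le Oinv (by linarith)).const_mul C₄).add (OTe2.const_mul _)).add
        ((Orest.mul_le Oinv (by linarith)).const_mul S)
    refine h1.of_abs_le (ev1.mono fun n hn => ?_)
    have hn0 := hpos n hn
    simp only [hA₄]
    rw [abs_abs]
    have h2 := h.abs_integral_blockSum_sq_sub_le hC₃ he0 hC₂ (hT1 n hn) (hT₃ _ (hT1 n hn)) (p n)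
      (hC₄ (p n))
    have e1 : k n * (m₂ n / n) - S = (k n * (n : ℝ)⁻¹) * (m₂ n - p n * S)
        - S * ((n - k n * p n) * (n : ℝ)⁻¹) := by
      field_simp; ring
    rw [e1]
    refine (abs_sub _ _).trans ?_
    rw [abs_mul, abs_of_nonneg (by positivity : 0 ≤ (k n : ℝ) * (n : ℝ)⁻¹),
      abs_of_nonneg (mul_nonneg hS.le (mul_nonneg (sub_nonneg.2 (hkpn n)) (by positivity)))]
    have h3 : (k n * (n : ℝ)⁻¹) * |m₂ n - p n * S| ≤
        (k n * (n : ℝ)⁻¹) * (C₄ + (C₂ + 2 * C₃) * p n * T n ^ (-(e / 2))) := by gcongr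
    have h4 : (k n * (n : ℝ)⁻¹) * p n ≤ 1 := by
      rw [mul_right_comm, ← div_eq_mul_inv, div_le_one hn0]; exact hkpn n
    have hTp : 0 < T n := by have := hT1 n hn; linarith
    have h5 : (k n * (n : ℝ)⁻¹) * p n * ((C₂ + 2 * C₃) * T n ^ (-(e / 2))) ≤
        1 * ((C₂ + 2 * C₃) * T n ^ (-(e / 2))) := by gcongr
    linarith
  set D : ℕ → ℝ := fun n => 2 * (C₂ * (n - k n * p n)) + 2 * (C₃ * n * T n ^ (-e)) with hD
  have OD : PowBound D (1 - 3 * c) := by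
    refine ((Orest.const_mul C₂).const_mul 2).add
      ((((On.const_mul C₃).mul_le OTe ?_)).const_mul 2)
    linarith
  -- the conditions under which the fixed-`n` bound applies
  have ev2 : ∀ᶠ n : ℕ in atTop, S / 2 ≤ k n * (m₂ n / n) := by
    have := OA₄.eventually_le (by linarith : -c < 0) (half_pos hS)
    refine this.mono fun n hn => ?_
    simp only [hA₄, Real.rpow_zero, mul_one] at hn
    linarith [(abs_le.1 hn).1]
  have ev3 : ∀ᶠ n : ℕ in atTop, (n : ℝ) ^ (c + η) * (24 * (B n / (n * √n))) ≤ m₂ n / n := by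
    have h1 := ((PowBound.rpow (c + η)).mul (OBn.const_mul 24)).eventually_le (y := a - 1)
      (by linarith) (half_pos hS)
    filter_upwards [h1, ev1, ev2] with n hn hn1 hn2
    have hn0 := hpos n hn1
    refine hn.trans ?_
    have hk0 : (0 : ℝ) < k n := by
      rcases Nat.eq_zero_or_pos (k n) with h0 | h0
      · rw [h0] at hn2; simp at hn2; linarith
      · exact_mod_cast h0
    have h2 : k n * (S / 2 * (n : ℝ) ^ (a - 1)) ≤ k n * (m₂ n / n) := by
      refine le_trans ?_ hn2
      have h3 : k n * (n : ℝ) ^ (a - 1) ≤ 1 := by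
        rw [Real.rpow_sub hn0, Real.rpow_one, ← mul_div_assoc, div_le_one hn0]
        exact (mul_le_mul_of_nonneg_left (hpa n) hk0.le).trans (hkpn n)
      nlinarith
    exact le_of_mul_le_mul_left h2 hk0
  have OF := powBound_total hη S (OA₁.mono (by linarith)) OA₂
    (Ok.mul_le OBn (z := -c) (by linarith)) OA₄ OD
  refine OF.of_nonneg_of_le (fun n => Real.iSup_nonneg fun x => abs_nonneg _) ?_
  filter_upwards [ev1, ev2, ev3] with n hn h2 h3
  have hn0 := hpos n hn
  have hT0 : 0 ≤ T n := by have := hT1 n hn; linarith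
  refine ciSup_le fun x => ?_
  obtain ⟨hV, hVD⟩ := h.remainder_moment_le hC₃ hC₂ (hT1 n hn) (hT₃ _ (hT1 n hn)) (hkn n)
  refine (h.abs_cdfSum_sub_cdfNormal_le hβ hK hw hT0 (hp1 n hn) hn (hkn n)
    (B := B n) (A₁ := A₁ n) (A₂ := A₂ n) (A₄ := A₄ n) (D := D n) (R := (n : ℝ) ^ (c + η))
    (b := (n : ℝ) ^ (-c)) (d := (n : ℝ) ^ (-c + η)) (δ := (n : ℝ) ^ (-c)) (Real.sqrt_nonneg _)
    (Real.sq_sqrt (mul_nonneg (hm₂0 n) (hm₄0 n))).ge hV hVD le_rfl le_rfl le_rfl hS h2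
    (by positivity) h3 (by positivity) (by positivity) (by positivity) x).trans (le_of_eq ?_)
  have hnn := hn0.le
  have e1 : ((n : ℝ) ^ (-c)) ^ 2 * ((n : ℝ) ^ (c + η)) ^ 2 / 4 = 1 / 4 * (n : ℝ) ^ (2 * η) := by
    rw [← mul_pow, ← Real.rpow_add hn0, ← Real.rpow_natCast, ← Real.rpow_mul hnn]
    push_cast; ring_nf
  have e2 : ((n : ℝ) ^ (-c + η)) ^ 2 / (2 * ((n : ℝ) ^ (-c)) ^ 2) = 1 / 2 * (n : ℝ) ^ (2 * η) := by
    have : ((n : ℝ) ^ (-c + η)) ^ 2 = ((n : ℝ) ^ (-c)) ^ 2 * (n : ℝ) ^ (2 * η) := by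
      rw [Real.rpow_add hn0, mul_pow, ← Real.rpow_natCast ((n : ℝ) ^ η), ← Real.rpow_mul hnn]
      push_cast; ring_nf
    rw [this]
    have hne : (n : ℝ) ^ (-c) ≠ 0 := by positivity
    field_simp
  have e3 : ((n : ℝ) ^ (-c))⁻¹ = (n : ℝ) ^ c := by rw [Real.rpow_neg hnn, inv_inv]
  have e4 : (((n : ℝ) ^ (-c)) ^ 2)⁻¹ = (n : ℝ) ^ (2 * c) := by
    rw [← inv_pow, e3, ← Real.rpow_natCast, ← Real.rpow_mul hnn]
    push_cast; ring_nf
  have e5 : ((n : ℝ) ^ (c + η))⁻¹ = (n : ℝ) ^ (-(c + η)) := (Real.rpow_neg hnn _).symm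
  rw [e1, e2]
  simp only [div_eq_mul_inv, mul_inv, e3, e4, e5]
  ring

end

end WeakDep

/-! ### Fourth moments of blocks and the constants `A` and `B` -/

namespace WeakDep

/-- Comparison with `∫ x ^ (-2/3)`, by telescoping `3 r ^ (1/3)`. -/
lemma sum_one_add_rpow_le (p : ℕ) :
    ∑ r ∈ Finset.range p, (1 + r : ℝ) ^ (-(2 / 3) : ℝ) ≤ 3 * (p : ℝ) ^ (1 / 3 : ℝ) := by
  induction p with
  | zero => simp
  | succ p ih =>
    rw [Finset.sum_range_succ]
    refine (add_le_add_left ih _).trans ?_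
    push_cast
    set x := (p : ℝ) ^ (1 / 3 : ℝ) with hx
    set y := ((p : ℝ) + 1) ^ (1 / 3 : ℝ) with hy
    have hx0 : 0 ≤ x := by positivity
    have hy0 : 0 < y := by positivity
    have hxy : x ≤ y := Real.rpow_le_rpow (by positivity) (by linarith) (by norm_num)
    have hx3 : x ^ 3 = p := by
      rw [hx, ← Real.rpow_natCast, ← Real.rpow_mul (by positivity)]; norm_num
    have hy3 : y ^ 3 = p + 1 := by
      rw [hy, ← Real.rpow_natCast, ← Real.rpow_mul (by positivity)]; norm_num
    have hy2 : (1 + p : ℝ) ^ (-(2 / 3) : ℝ) = 1 / y ^ 2 := by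
      rw [hy, ← Real.rpow_natCast, ← Real.rpow_mul (by positivity), one_div,
        ← Real.rpow_neg (by positivity), add_comm]; norm_num
    have h1 : 1 / y ^ 2 ≤ 3 * (y - x) := by
      rw [div_le_iff₀ (by positivity)]
      have h2 : 1 = (y - x) * (y ^ 2 + x * y + x ^ 2) := by linarith [hx3, hy3]
      have h3 : y ^ 2 + x * y + x ^ 2 ≤ 3 * y ^ 2 := by nlinarith
      calc 1 = (y - x) * (y ^ 2 + x * y + x ^ 2) := h2
        _ ≤ (y - x) * (3 * y ^ 2) := mul_le_mul_of_nonneg_left h3 (sub_nonneg.2 hxy)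
        _ = _ := by ring
    rw [hy2]
    linarith

section FourthMoment

variable {Ω : Type*} [MeasurableSpace Ω] {P : Measure Ω} [IsProbabilityMeasure P]
  {X : ℤ → Ω → ℝ} {ζ : ℝ}

namespace StationaryMoment

/-- Fourth moment of a truncated block under `κ`-weak dependence. The exponent `θ / 3` may be below
`1`, and the cube of the sum over the gaps is then only bounded by a multiple of `p`. -/
lemma powBound_fourth_kappa (h : StationaryMoment P X ζ) {K θ C θ' : ℝ}
    (hK : 0 ≤ K) (hθ : 2 ≤ θ) (hw : PolyWeakDep P X 0 K θ) (hC : 0 ≤ C)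
    (hcov : ∀ ψ : ℝ → ℝ, IsContr ψ → ∀ i j : ℤ,
      |cov[fun ω => ψ (X i ω), fun ω => ψ (X j ω); P]| ≤ C * (1 + |((j - i : ℤ) : ℝ)|) ^ (-θ'))
    (hθ' : 1 < θ') {a τ : ℝ} (ha : 0 ≤ a) (hτ : 0 ≤ τ) :
    PowBound (fun n : ℕ => ∫ ω, blockSum P X ⌈(n : ℝ) ^ a⌉₊ ((n : ℝ) ^ τ) ω ^ 4 ∂P)
      (2 * a + 2 * τ) := by
  set G := C * ∑' k : ℤ, (1 + |(k : ℝ)|) ^ (-θ')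
  have Op := powBound_ceil ha
  have OT2 : PowBound (fun n : ℕ => ((n : ℝ) ^ τ) ^ 2) (2 * τ) := by
    simp_rw [sq]
    exact (PowBound.rpow τ).mul_le (PowBound.rpow τ) (by linarith)
  have hF : PowBound (fun n : ℕ => 24 * (⌈(n : ℝ) ^ a⌉₊ : ℝ) *
      (16 * K * 27 * (((n : ℝ) ^ τ) ^ 2 * ⌈(n : ℝ) ^ a⌉₊) + G ^ 2 * ⌈(n : ℝ) ^ a⌉₊))
      (2 * a + 2 * τ) :=
    (Op.const_mul 24).mul_le (((OT2.mul Op).const_mul _).add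
      ((Op.const_mul _).mono (by linarith : a ≤ 2 * τ + a))) (by linarith)
  refine hF.of_nonneg_of_le (fun n => integral_nonneg fun ω => by positivity) ?_
  filter_upwards [eventually_ge_atTop 1] with n hn
  have hT : 1 ≤ (n : ℝ) ^ τ := Real.one_le_rpow (by exact_mod_cast hn) hτ
  refine (h.integral_blockSum_pow_four_le le_rfl hK (by linarith) hw hC hcov hθ' hT _).trans ?_
  set p := ⌈(n : ℝ) ^ a⌉₊
  have hQ : (∑ r ∈ Finset.range p, (1 + r : ℝ) ^ (-(θ / 3))) ^ 3 ≤ 27 * p := by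
    have h1 : ∑ r ∈ Finset.range p, (1 + r : ℝ) ^ (-(θ / 3)) ≤ 3 * (p : ℝ) ^ (1 / 3 : ℝ) :=
      (Finset.sum_le_sum fun r _ => Real.rpow_le_rpow_of_exponent_le
        (by linarith [(Nat.cast_nonneg r : (0 : ℝ) ≤ r)]) (by linarith)).trans
        (sum_one_add_rpow_le p)
    have h0 : 0 ≤ ∑ r ∈ Finset.range p, (1 + r : ℝ) ^ (-(θ / 3)) :=
      Finset.sum_nonneg fun r _ => by positivity
    refine (pow_le_pow_left₀ h0 h1 3).trans (le_of_eq ?_)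
    rw [mul_pow, ← Real.rpow_natCast ((p : ℝ) ^ (1 / 3 : ℝ)), ← Real.rpow_mul (by positivity)]
    norm_num
  calc _ ≤ 24 * p * (16 * K * (((n : ℝ) ^ τ) ^ 2 + 2 * 0 * ((n : ℝ) ^ τ) ^ 3) * (27 * p)
        + G ^ 2 * p) := by gcongr
    _ = _ := by ring

/-- Fourth moment of a truncated block under `λ`-weak dependence, where `θ / 3 > 1` and the sum over
the gaps is bounded. -/
lemma powBound_fourth_lambda (h : StationaryMoment P X ζ) {K θ C θ' : ℝ}
    (hK : 0 ≤ K) (hθ : 3 < θ) (hw : PolyWeakDep P X 1 K θ) (hC : 0 ≤ C)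
    (hcov : ∀ ψ : ℝ → ℝ, IsContr ψ → ∀ i j : ℤ,
      |cov[fun ω => ψ (X i ω), fun ω => ψ (X j ω); P]| ≤ C * (1 + |((j - i : ℤ) : ℝ)|) ^ (-θ'))
    (hθ' : 1 < θ') {a τ ρ : ℝ} (ha : 0 ≤ a) (hτ : 0 ≤ τ) (hρ : 0 ≤ ρ) (hτρ : 3 * τ ≤ a + 2 * ρ) :
    PowBound (fun n : ℕ => ∫ ω, blockSum P X ⌈(n : ℝ) ^ a⌉₊ ((n : ℝ) ^ τ) ω ^ 4 ∂P)
      (2 * a + 2 * ρ) := by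
  set G := C * ∑' k : ℤ, (1 + |(k : ℝ)|) ^ (-θ')
  set Q := ∑' k : ℤ, (1 + |(k : ℝ)|) ^ (-(θ / 3)) with hQdef
  have Op := powBound_ceil ha
  have OT3 : PowBound (fun n : ℕ => ((n : ℝ) ^ τ) ^ 3) (3 * τ) := by
    simp_rw [pow_succ, pow_zero, one_mul]
    exact ((PowBound.rpow τ).mul (PowBound.rpow τ)).mul_le (PowBound.rpow τ) (by linarith)
  have hF : PowBound (fun n : ℕ => 24 * (⌈(n : ℝ) ^ a⌉₊ : ℝ) *
      (16 * K * 3 * Q ^ 3 * ((n : ℝ) ^ τ) ^ 3 + G ^ 2 * ⌈(n : ℝ) ^ a⌉₊)) (2 * a + 2 * ρ) :=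
    (Op.const_mul 24).mul_le (((OT3.const_mul _).mono hτρ).add
      ((Op.const_mul _).mono (by linarith : a ≤ a + 2 * ρ))) (by linarith)
  refine hF.of_nonneg_of_le (fun n => integral_nonneg fun ω => by positivity) ?_
  filter_upwards [eventually_ge_atTop 1] with n hn
  have hT : 1 ≤ (n : ℝ) ^ τ := Real.one_le_rpow (by exact_mod_cast hn) hτ
  refine (h.integral_blockSum_pow_four_le zero_le_one hK (by linarith) hw hC hcov hθ' hT _).trans ?_
  set p := ⌈(n : ℝ) ^ a⌉₊
  have hQ : ∑ r ∈ Finset.range p, (1 + r : ℝ) ^ (-(θ / 3)) ≤ Q := by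
    have e : ∑ r ∈ Finset.range p, (1 + r : ℝ) ^ (-(θ / 3)) =
        ∑ k ∈ (Finset.range p).map Nat.castEmbedding, (1 + |((k : ℤ) : ℝ)|) ^ (-(θ / 3)) := by
      rw [Finset.sum_map]
      simp
    rw [e]
    exact (summable_one_add_abs_rpow (by linarith)).sum_le_tsum _ fun k _ => by positivity
  have h0 : 0 ≤ ∑ r ∈ Finset.range p, (1 + r : ℝ) ^ (-(θ / 3)) :=
    Finset.sum_nonneg fun r _ => by positivity
  set t := (n : ℝ) ^ τ
  have h23 : t ^ 2 ≤ t ^ 3 := pow_le_pow_right₀ hT (by norm_num)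
  calc _ ≤ 24 * p * (16 * K * (t ^ 3 + 2 * 1 * t ^ 3) * Q ^ 3 + G ^ 2 * p) := by gcongr
    _ = _ := by ring

end StationaryMoment

end FourthMoment

/-- The positive root of `t² + x t = y`, capped at `1`. -/
lemma min_root_spec {x y : ℝ} (hy : 0 < y) :
    0 < min ((√(x ^ 2 + 4 * y) - x) / 2) 1 ∧ min ((√(x ^ 2 + 4 * y) - x) / 2) 1 ≤ 1 ∧
      min ((√(x ^ 2 + 4 * y) - x) / 2) 1 ^ 2 + x * min ((√(x ^ 2 + 4 * y) - x) / 2) 1 ≤ y := by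
  set r := (√(x ^ 2 + 4 * y) - x) / 2 with hr
  have hr0 : 0 < r := by
    have : x < √(x ^ 2 + 4 * y) := Real.lt_sqrt_of_sq_lt (by linarith)
    rw [hr]; linarith
  have hre : r ^ 2 + x * r = y := by
    have := Real.sq_sqrt (by positivity : 0 ≤ x ^ 2 + 4 * y)
    rw [hr]; linarith
  have hw0 : 0 < min r 1 := lt_min hr0 one_pos
  refine ⟨hw0, min_le_right _ _, ?_⟩
  have hwr : min r 1 ≤ r := min_le_left _ _
  -- `t² + x t` is nonpositive for `0 ≤ t ≤ -x`, and increasing for `t ≥ max 0 (-x)`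
  rcases le_or_gt (min r 1 + x) 0 with h | h <;> nlinarith

/-- The inequality `2 A ≤ ζ` is the only consequence of the defining equation of `A` that enters
the choice of the truncation level. -/
lemma constA_spec {ζ κ : ℝ} (hζ : 0 < ζ) (hκ : 2 + 1 / ζ < κ) :
    0 < constA ζ κ ∧ constA ζ κ ≤ 1 ∧ 2 * constA ζ κ ≤ ζ := by
  have h1 : 0 < κ * ζ - 2 * ζ - 1 := by
    have := mul_lt_mul_of_pos_right hκ hζ
    rw [add_mul, one_div, inv_mul_cancel₀ hζ.ne'] at this
    linarith
  obtain ⟨h2, h3, h4⟩ := min_root_spec (x := 2 * κ - 3 - ζ) h1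
  have e : constA ζ κ = min ((√((2 * κ - 3 - ζ) ^ 2 + 4 * (κ * ζ - 2 * ζ - 1))
      - (2 * κ - 3 - ζ)) / 2) 1 := by
    unfold constA; ring_nf
  rw [← e] at h2 h3 h4
  refine ⟨h2, h3, ?_⟩
  set w := constA ζ κ
  have hκ2 : 2 < κ := by
    have : 0 < 1 / ζ := by positivity
    linarith
  have h5 : (2 * w) * (κ - 2 + w) ≤ ζ * (κ - 2 + w) := by nlinarith
  exact le_of_mul_le_mul_right h5 (by linarith)

/-- The last inequality says that `2 B < ζ (1 - 1 / θ')`, where `θ' = λ ζ / (1 + ζ)` is the decay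
exponent of the covariances. -/
lemma constB_spec {ζ lam : ℝ} (hζ : 0 < ζ) (hl : 4 + 2 / ζ < lam) :
    0 < constB ζ lam ∧ constB ζ lam ≤ 1 ∧ 2 * lam * constB ζ lam < ζ * (lam - 1) - 1 := by
  have h1 : 0 < lam * ζ - 4 * ζ - 2 := by
    have := mul_lt_mul_of_pos_right hl hζ
    rw [add_mul, div_mul_cancel₀ _ hζ.ne'] at this
    linarith
  obtain ⟨h2, h3, h4⟩ := min_root_spec (x := 2 * lam - 6 - ζ) h1
  have e : constB ζ lam = min ((√((2 * lam - 6 - ζ) ^ 2 + 4 * (lam * ζ - 4 * ζ - 2))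
      - (2 * lam - 6 - ζ)) / 2) 1 := by
    unfold constB; ring_nf
  rw [← e] at h2 h3 h4
  refine ⟨h2, h3, ?_⟩
  set w := constB ζ lam
  have hl4 : 4 < lam := by
    have : 0 < 2 / ζ := by positivity
    linarith
  have h6 : w ^ 2 + 2 * lam * w - 6 * w + 2 ≤ ζ * (lam - 4 + w) := by linarith
  have hpos : 0 < lam - 4 + w := by linarith
  have h7 : (2 * lam * w + 1) * (lam - 4 + w) < (lam - 1) * (ζ * (lam - 4 + w)) := by
    have h8 := mul_le_mul_of_nonneg_left h6 (by linarith : 0 ≤ lam - 1)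
    have h9 : 0 ≤ lam * (1 - w ^ 2) := mul_nonneg (by linarith) (by nlinarith)
    nlinarith
  have h10 : 2 * lam * w + 1 < (lam - 1) * ζ := by
    refine lt_of_mul_lt_mul_right ?_ hpos.le
    rw [mul_assoc (lam - 1)]; exact h7
  linarith

end WeakDep

/-! ### Choice of the exponents -/

namespace WeakDep

/-- The exponents of the block length, the gap and the truncation level are compatible with every
rate below the one claimed under `κ`-weak dependence. -/
lemma kappa_exponent_lt {κ w c : ℝ} (hκ : 2 < κ) (hw : 0 < w) (hc0 : 0 < c)
    (hc : c < (κ - 1) * w / (w + 2 * κ * (1 + w)) / (3 + w)) :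
    c < (1 - ((1 + 3 * c) / κ + 3 * c)) / 2 - 3 * c / w ∧ (1 + 3 * c) / κ + 3 * c ≤ 1 - 3 * c := by
  have hκ0 : 0 < κ := by linarith
  rw [div_div, lt_div_iff₀ (by positivity)] at hc
  have h1 : c * (5 * w * κ + 3 * w + 6 * κ) < (κ - 1) * w := by
    refine lt_of_le_of_lt (mul_le_mul_of_nonneg_left ?_ hc0.le) hc
    have h2 : 0 < κ * w := by positivity
    nlinarith [mul_pos h2 hw, sq_nonneg w]
  have e1 : (1 - ((1 + 3 * c) / κ + 3 * c)) / 2 - 3 * c / w - c =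
      ((κ - 1) * w - c * (5 * w * κ + 3 * w + 6 * κ)) / (2 * κ * w) := by
    field_simp; ring
  have h3 : 0 < ((κ - 1) * w - c * (5 * w * κ + 3 * w + 6 * κ)) / (2 * κ * w) :=
    div_pos (by linarith) (by positivity)
  have h4 : c * (6 * w * κ + 3 * w) ≤ (κ - 1) * w := by
    refine le_trans (mul_le_mul_of_nonneg_left ?_ hc0.le) hc.le
    have h2 : 0 < κ * w := by positivity
    nlinarith [mul_pos h2 hw, sq_nonneg w]
  have h5 : c * (6 * κ + 3) ≤ κ - 1 := by
    refine le_of_mul_le_mul_right ?_ hw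
    linarith
  refine ⟨by linarith, ?_⟩
  have e2 : 1 - 3 * c - ((1 + 3 * c) / κ + 3 * c) = (κ - 1 - c * (6 * κ + 3)) / κ := by
    field_simp; ring
  have h6 : 0 ≤ (κ - 1 - c * (6 * κ + 3)) / κ := div_nonneg (by linarith) hκ0.le
  linarith

/-- Two numerical consequences of the bound on the rate under `λ`-weak dependence: `c < 0.07`, and
`c < B / (6 + 2 B)`. -/
lemma lambda_exponent_lt {lam w c : ℝ} (hl : 4 < lam) (hw : 0 < w) (hw1 : w ≤ 1) (hc0 : 0 < c)
    (hc : c < (lam + 1) * w / (2 + w + 2 * lam * (1 + w)) / (3 + w)) :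
    100 * c < 7 ∧ c * (6 + 2 * w) < w := by
  have hl0 : 0 < lam := by linarith
  rw [div_div, lt_div_iff₀ (by positivity)] at hc
  set M := (2 + w + 2 * lam * (1 + w)) * (3 + w) with hM
  have hM0 : 0 < M := by positivity
  constructor
  · have h1 : (lam + 1) * w * 100 ≤ 7 * M := by
      rw [hM]
      have h2 : 0 ≤ 42 - 44 * w + 14 * w ^ 2 := by nlinarith [sq_nonneg (w - 1)]
      have h3 : 0 ≤ (lam - 4) * (42 - 44 * w + 14 * w ^ 2) := mul_nonneg (by linarith) h2
      nlinarith [sq_nonneg (w - 1)]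
    refine lt_of_mul_lt_mul_right ?_ hM0.le
    linarith
  · have h1 : (lam + 1) * (6 + 2 * w) ≤ M := by
      rw [hM]
      have : 0 < lam * w := by positivity
      nlinarith [mul_pos this hw, sq_nonneg w]
    have h2 : (lam + 1) * (c * (6 + 2 * w)) < (lam + 1) * w := by
      refine lt_of_le_of_lt ?_ hc
      rw [mul_left_comm]
      exact mul_le_mul_of_nonneg_left h1 hc0.le
    exact lt_of_mul_lt_mul_left h2 (by linarith)

section

variable {Ω : Type*} [MeasurableSpace Ω] {P : Measure Ω} [IsProbabilityMeasure P]
  {X : ℤ → Ω → ℝ} {ζ : ℝ}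

/-- An arbitrarily small loss in the exponent turns a family of `O`-bounds into the `o`-bound. -/
lemma isLittleO_of_powBound {f : ℕ → ℝ} {c₀ : ℝ} (hc₀ : 0 < c₀)
    (hf : ∀ c, 0 < c → c < c₀ → ∃ η₀ > 0, ∀ η, 0 < η → η ≤ η₀ → PowBound f (-c + η)) {c : ℝ}
    (hc : c < c₀) : f =o[atTop] fun n : ℕ => (n : ℝ) ^ (-c) := by
  obtain ⟨c₁, h1, h2⟩ := exists_between (max_lt hc hc₀)
  obtain ⟨η₀, hη₀, H⟩ := hf c₁ ((le_max_right _ _).trans_lt h1) h2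
  have hcc : c < c₁ := (le_max_left _ _).trans_lt h1
  refine (H (min η₀ ((c₁ - c) / 2)) (lt_min hη₀ (by linarith)) (min_le_left _ _)).isLittleO ?_
  linarith [min_le_right η₀ ((c₁ - c) / 2)]

namespace StationaryMoment

/-- The gap exponent `b` is the smallest one that decouples the blocks, the block exponent
`b + 3 c` the smallest one for which the gaps are negligible, and the truncation exponent
`3 c / A` uses `2 A ≤ ζ`. -/
theorem clt_rate_kappa (h : StationaryMoment P X ζ) {κ K : ℝ} (hκ : 2 + 1 / ζ < κ) (hK : 0 ≤ K)
    (hw : PolyWeakDep P X 0 K κ) :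
    Summable (fun k : ℤ => cov[X 0, X k; P]) ∧ (0 < sigmaSq P X → ∀ c : ℝ,
      c < cStarKappa ζ κ / (3 + constA ζ κ) →
        (fun n : ℕ => kolmogorovDist P X n) =o[atTop] fun n : ℕ => (n : ℝ) ^ (-c)) := by
  have hζ := h.pos
  obtain ⟨hA0, -, hAζ⟩ := constA_spec hζ hκ
  have hκ2 : 2 < κ := by
    have : 0 < 1 / ζ := by positivity
    linarith
  have hκ0 : 0 < κ := by linarith
  obtain ⟨C, hC, hcov⟩ := h.exists_abs_cov_le (θ' := κ) le_rfl hK hw (e := κ / ζ) (by positivity)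
    (div_mul_cancel₀ _ hζ.ne').ge le_rfl (Or.inl rfl)
  refine ⟨summable_cov hcov (by linarith), fun hS c hc => ?_⟩
  refine isLittleO_of_powBound ?_ (fun c hc0 hc => ?_) hc
  · unfold cStarKappa
    have : 0 < κ - 1 := by linarith
    positivity
  unfold cStarKappa at hc
  set w := constA ζ κ
  obtain ⟨h1, h2⟩ := kappa_exponent_lt hκ2 hA0 hc0 hc
  set b := (1 + 3 * c) / κ with hb
  have hb0 : 0 < b := by positivity
  have hτ : 0 ≤ 3 * c / w := by positivity
  refine ⟨((1 - (b + 3 * c)) / 2 - 3 * c / w - c) / 2, by linarith, fun η hη0 hη => ?_⟩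
  -- `s = 1 / 2` interpolates the covariance bounds
  refine h.powBound_kolmogorovDist le_rfl hK hw hκ0.le hC.le hcov hκ2 (s := 1 / 2) (by norm_num)
    (by norm_num) (by linarith) hS (a := b + 3 * c) (b := b) (τ := 3 * c / w) (ρ := 3 * c / w)
    hc0 hη0 hb0 hτ le_rfl h2 ?_ (by linarith) ?_ (Or.inl rfl)
    (h.powBound_fourth_kappa hK hκ2.le hw hC.le hcov (by linarith) (by linarith) hτ)
  · rw [div_mul_eq_mul_div, le_div_iff₀ hA0]
    exact mul_le_mul_of_nonneg_left (by linarith) (by linarith)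
  · rw [hb, mul_div_cancel₀ _ hκ0.ne']

/-- Since `c < 0.07`, a gap exponent that does not depend on `c` suffices. The truncation exponent
`3 c / (2 B)` uses the full decay of the covariances. -/
theorem clt_rate_lambda (h : StationaryMoment P X ζ) {lam K : ℝ} (hl : 4 + 2 / ζ < lam)
    (hK : 0 ≤ K) (hw : PolyWeakDep P X 1 K lam) :
    Summable (fun k : ℤ => cov[X 0, X k; P]) ∧ (0 < sigmaSq P X → ∀ c : ℝ,
      c < cStarLambda ζ lam / (3 + constB ζ lam) →
        (fun n : ℕ => kolmogorovDist P X n) =o[atTop] fun n : ℕ => (n : ℝ) ^ (-c)) := by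
  have hζ := h.pos
  obtain ⟨hB0, hB1, hBζ⟩ := constB_spec hζ hl
  have hl4 : 4 < lam := by
    have : 0 < 2 / ζ := by positivity
    linarith
  have hl0 : 0 < lam := by linarith
  have hlζ : 4 * ζ + 2 < lam * ζ := by
    have := mul_lt_mul_of_pos_right hl hζ
    rwa [add_mul, div_mul_cancel₀ _ hζ.ne'] at this
  -- truncating at `k ^ (lam / (1 + ζ))` balances the two errors in the covariance at lag `k`
  set e := lam / (1 + ζ) with he
  have he0 : 0 < e := by positivity
  have heq : lam - e = e * ζ := by rw [he]; field_simp; ring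
  obtain ⟨C, hC, hcov⟩ := h.exists_abs_cov_le (θ' := e * ζ) zero_le_one hK hw he0.le le_rfl
    (by linarith) (Or.inr heq.ge)
  have hθ' : 2 < e * ζ := by
    rw [he, div_mul_eq_mul_div, lt_div_iff₀ (by positivity)]
    linarith
  refine ⟨summable_cov hcov (by linarith), fun hS c hc => ?_⟩
  refine isLittleO_of_powBound ?_ (fun c hc0 hc => ?_) hc
  · unfold cStarLambda
    positivity
  unfold cStarLambda at hc
  set w := constB ζ lam
  obtain ⟨h1, h2⟩ := lambda_exponent_lt hl4 hB0 hB1 hc0 hc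
  have hwζ : 2 * w < ζ := by
    have : lam * (2 * w) < lam * ζ := by linarith
    exact lt_of_mul_lt_mul_left this hl0.le
  -- here `λ b + b = 9 / 5`, and `b < 0.36` with `c < 0.07` leaves room in all conditions
  set b := 9 / (5 * (lam + 1)) with hb
  have hb0 : 0 < b := by positivity
  have hb1 : b < 9 / 25 := by
    rw [hb, div_lt_div_iff₀ (by positivity) (by norm_num)]; linarith
  have hb2 : lam * b = 9 / 5 - b := by rw [hb]; field_simp; ring
  set τ := 3 * c / (2 * w) with hτdef
  have hτ : 0 ≤ τ := by positivity
  have hτ3 : 3 * τ + 2 * c < 1 := by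
    have e1 : 1 - (3 * τ + 2 * c) = (2 * w - c * (9 + 4 * w)) / (2 * w) := by
      rw [hτdef]; field_simp; ring
    have : 0 < (2 * w - c * (9 + 4 * w)) / (2 * w) := div_pos (by linarith) (by positivity)
    linarith
  set ρ := max 0 ((3 * τ - (b + 3 * c)) / 2) with hρdef
  have hρ0 : 0 ≤ ρ := le_max_left _ _
  have hρ1 : (3 * τ - (b + 3 * c)) / 2 ≤ ρ := le_max_right _ _
  have hρ2 : ρ < (1 - (b + 3 * c)) / 2 - c := max_lt (by linarith) (by linarith)
  refine ⟨((1 - (b + 3 * c)) / 2 - ρ - c) / 2, by linarith, fun η hη0 hη => ?_⟩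
  -- the weight `s = 1 - 2 B / ζ` interpolates the covariance bounds
  have hs : 1 < (1 - 2 * w / ζ) * (e * ζ) := by
    have e1 : (1 - 2 * w / ζ) * (e * ζ) = lam * (ζ - 2 * w) / (1 + ζ) := by
      rw [he]; field_simp
    rw [e1, one_lt_div (by positivity)]
    linarith
  have hs1 : 2 * w / ζ < 1 := (div_lt_one hζ).2 hwζ
  refine h.powBound_kolmogorovDist zero_le_one hK hw hl0.le hC.le hcov hθ' (s := 1 - 2 * w / ζ)
    (by linarith) (by linarith [(by positivity : 0 < 2 * w / ζ)]) hs hS (a := b + 3 * c) (b := b)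
    (τ := τ) (ρ := ρ) hc0 hη0 hb0 hτ le_rfl (by linarith) ?_ (by linarith) (by linarith)
    (Or.inr (by linarith))
    (h.powBound_fourth_lambda hK (by linarith) hw hC.le hcov (by linarith) (by linarith) hτ hρ0
      (by linarith))
  rw [sub_sub_cancel, mul_div_cancel₀ _ hζ.ne', hτdef, div_mul_cancel₀ _ (by positivity)]

end StationaryMoment

end

end WeakDep

theorem mainTheorem6 {Ω : Type*} [MeasurableSpace Ω] (P : Measure Ω) [IsProbabilityMeasure P]
    (X : ℤ → Ω → ℝ) (hmeas : ∀ t, Measurable (X t))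
    (hstat : WeakDep.IsStationary P X)
    (hmean : ∫ ω, X 0 ω ∂P = 0)
    (ζ : ℝ) (hζ : 0 < ζ)
    (hmom : Integrable (fun ω => |X 0 ω| ^ (2 + ζ)) P) :
    (∀ (κ : ℝ) (ε : ℕ → ℝ), 2 + 1 / ζ < κ →
      WeakDep.IsWeaklyDependent P X WeakDep.psiKappa ε →
      ε =O[atTop] (fun r : ℕ => (r : ℝ) ^ (-κ)) →
      Summable (fun k : ℤ => cov[X 0, X k; P]) ∧
      (0 < WeakDep.sigmaSq P X →
        ∀ c : ℝ, c < WeakDep.cStarKappa ζ κ / (3 + WeakDep.constA ζ κ) →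
          (fun n : ℕ => WeakDep.kolmogorovDist P X n) =o[atTop] (fun n : ℕ => (n : ℝ) ^ (-c)))) ∧
    (∀ (lam : ℝ) (ε : ℕ → ℝ), 4 + 2 / ζ < lam →
      WeakDep.IsWeaklyDependent P X WeakDep.psiLambda ε →
      ε =O[atTop] (fun r : ℕ => (r : ℝ) ^ (-lam)) →
      Summable (fun k : ℤ => cov[X 0, X k; P]) ∧
      (0 < WeakDep.sigmaSq P X →
        ∀ c : ℝ, c < WeakDep.cStarLambda ζ lam / (3 + WeakDep.constB ζ lam) →
          (fun n : ℕ => WeakDep.kolmogorovDist P X n) =o[atTop] (fun n : ℕ => (n : ℝ) ^ (-c)))) := by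
  have h : WeakDep.StationaryMoment P X ζ := ⟨hmeas, hstat, hmean, hζ, hmom⟩
  refine ⟨fun κ ε hκ hdep hO => ?_, fun lam ε hl hdep hO => ?_⟩
  · have hκ0 : 0 < κ := lt_trans (by positivity) hκ
    obtain ⟨K, hK, hw⟩ := hdep.polyWeakDep le_rfl
      (fun u v a b => by simp [WeakDep.psiKappa]) hκ0 hO
    exact h.clt_rate_kappa hκ hK.le hw
  · have hl0 : 0 < lam := lt_trans (by positivity) hl
    obtain ⟨K, hK, hw⟩ := hdep.polyWeakDep zero_le_one
      (fun u v a b => by simp only [WeakDep.psiLambda]; ring) hl0 hO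
    exact h.clt_rate_lambda hl hK.le hw
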